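/- A distribution on $[0,1)$ is called $\ell$-flat if there is a partition of $[0,1)$ into $\ell$ intervals such that it has a probability density that is constant on each of them. For probability distributions $p,q$ let $d_{TV}(q,p)=\sup_A |q(A)-p(A)|$ ($A$ Borel), and for a probability distribution $p$ on $[0,1)$ (possibly with atoms) let $\mathrm{opt}_k(p)=\inf\{d_{TV}(q,p) : q \text{ is } k\text{-flat}\}$. Theorem. There are an algorithm $A$ and absolute constants $C$ and $c$ with the following property. Here an algorithm is a single program for a real RAM (unit-cost exact real arithmetic $+,-,\times,/$ and comparisons, natural-number registers with $+,-$ and comparisons, indirect addressing, and an instruction that draws the next sample point). Let $k\ge 1$ be an integer and $\varepsilon>0$ a real number; both are given to $A$ as input. (a) On every sequence of sample points in $[0,1)$, $A$ halts after drawing at most $C\,\frac{k}{\varepsilon^2}\log^c\!\big(2+\frac{k}{\varepsilon^2}\big)$ points and after at most $C\,\big(1+\frac{k}{\varepsilon^2}\big)\log^c\!\big(2+\frac{k}{\varepsilon^2}\big)$ time steps (thus it uses $\tilde O(k/\varepsilon^2)$ samples and time $\tilde O(k/\varepsilon^2)$), and it outputs the breakpoints and heights of an $\ell$-flat hypothesis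 distribution $h$ with $\ell\le C\,k\log^2\!\big(2+\frac1\varepsilon\big)$, i.e. $\ell=O(k\log^2(1/\varepsilon))$. (b) For every probability distribution $p$ on $[0,1)$, if the sample points are independent draws from $p$, then with probability at least $9/10$ the output satisfies $d_{TV}(h,p)\le C\cdot \mathrm{opt}_k(p)+\varepsilon$. -/

import Mathlib

open Set MeasureTheory

/-! ## A real RAM

The memory consists of arrays of natural numbers and arrays of real numbers. An array is indexed by
the natural numbers and is named by a natural number; a program mentions only finitely many
array names, and a register is a cell with a constant index. The exact real arithmetic is
`+, -, *, /` and comparison; the natural numbers are used for counting and for addressing and have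
only `+`, truncated `-` and comparison. The constants of a program are natural numbers. There is a
conversion from natural numbers to reals, but none in the other direction (no rounding). -/

/-- Natural-number expressions; `get a i` reads cell `i` of the natural-number array `a`. -/
inductive NExp : Type
  | lit (n : ℕ)
  | get (a : ℕ) (i : NExp)
  | add (e f : NExp)
  | sub (e f : NExp)

/-- Real expressions; `get a i` reads cell `i` of the real array `a`. -/
inductive RExp : Type
  | ofNat (e : NExp)
  | get (a : ℕ) (i : NExp)
  | add (e f : RExp)
  | sub (e f : RExp)
  | mul (e f : RExp)
  | div (e f : RExp)

/-- Tests. -/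
inductive BExp : Type
  | ltN (e f : NExp)
  | ltR (e f : RExp)
  | not (b : BExp)
  | and (b c : BExp)

/-- Programs. `setN a i e` and `setR a i e` store the value of `e` in cell `i` of the
natural-number, respectively real, array `a`; `draw a i` stores a fresh sample point in cell `i` of
the real array `a`. -/
inductive Prog : Type
  | skip
  | setN (a : ℕ) (i : NExp) (e : NExp)
  | setR (a : ℕ) (i : NExp) (e : RExp)
  | draw (a : ℕ) (i : NExp)
  | seq (P Q : Prog)
  | ite (b : BExp) (P Q : Prog)
  | loop (b : BExp) (P : Prog)

/-- A memory state: the natural-number arrays, the real arrays, and the number of sample points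
drawn so far. -/
structure State : Type where
  nat : ℕ → ℕ → ℕ
  real : ℕ → ℕ → ℝ
  draws : ℕ

namespace State

/-- Write `v` to cell `i` of the natural-number array `a`. -/
def writeN (s : State) (a i v : ℕ) : State :=
  { s with nat := Function.update s.nat a (Function.update (s.nat a) i v) }

/-- Write `v` to cell `i` of the real array `a`. -/
noncomputable def writeR (s : State) (a i : ℕ) (v : ℝ) : State :=
  { s with real := Function.update s.real a (Function.update (s.real a) i v) }

end State

namespace NExp

def eval (s : State) : NExp → ℕ
  | lit n => n
  | get a i => s.nat a (i.eval s)
  | add e f => e.eval s + f.eval s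
  | sub e f => e.eval s - f.eval s

/-- The time to evaluate an expression: one unit for each constant, memory access and operation. -/
def cost : NExp → ℕ
  | lit _ => 1
  | get _ i => i.cost + 1
  | add e f => e.cost + f.cost + 1
  | sub e f => e.cost + f.cost + 1

end NExp

namespace RExp

/-- The value of a real expression; a division by `0` returns `0`. -/
noncomputable def eval (s : State) : RExp → ℝ
  | ofNat e => (e.eval s : ℝ)
  | get a i => s.real a (i.eval s)
  | add e f => e.eval s + f.eval s
  | sub e f => e.eval s - f.eval s
  | mul e f => e.eval s * f.eval s
  | div e f => e.eval s / f.eval s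

def cost : RExp → ℕ
  | ofNat e => e.cost + 1
  | get _ i => i.cost + 1
  | add e f => e.cost + f.cost + 1
  | sub e f => e.cost + f.cost + 1
  | mul e f => e.cost + f.cost + 1
  | div e f => e.cost + f.cost + 1

end RExp

namespace BExp

def eval (s : State) : BExp → Prop
  | ltN e f => e.eval s < f.eval s
  | ltR e f => e.eval s < f.eval s
  | not b => ¬ b.eval s
  | and b c => b.eval s ∧ c.eval s

def cost : BExp → ℕ
  | ltN e f => e.cost + f.cost + 1
  | ltR e f => e.cost + f.cost + 1
  | not b => b.cost + 1
  | and b c => b.cost + c.cost + 1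

end BExp

/-- `Run ω P s t s'`: on the stream `ω` of sample points, the program `P` started in the state `s`
halts after exactly `t` time steps, in the state `s'`. -/
inductive Run (ω : ℕ → ℝ) : Prog → State → ℕ → State → Prop
  | skip (s : State) : Run ω .skip s 1 s
  | setN (a : ℕ) (i e : NExp) (s : State) :
      Run ω (.setN a i e) s (i.cost + e.cost + 1) (s.writeN a (i.eval s) (e.eval s))
  | setR (a : ℕ) (i : NExp) (e : RExp) (s : State) :
      Run ω (.setR a i e) s (i.cost + e.cost + 1) (s.writeR a (i.eval s) (e.eval s))
  | draw (a : ℕ) (i : NExp) (s : State) :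
      Run ω (.draw a i) s (i.cost + 1)
        { s.writeR a (i.eval s) (ω s.draws) with draws := s.draws + 1 }
  | seq {P Q : Prog} {s s₁ s₂ : State} {t₁ t₂ : ℕ} :
      Run ω P s t₁ s₁ → Run ω Q s₁ t₂ s₂ → Run ω (.seq P Q) s (t₁ + t₂) s₂
  | ite_true {b : BExp} {P Q : Prog} {s s' : State} {t : ℕ} :
      b.eval s → Run ω P s t s' → Run ω (.ite b P Q) s (b.cost + 1 + t) s'
  | ite_false {b : BExp} {P Q : Prog} {s s' : State} {t : ℕ} :
      ¬ b.eval s → Run ω Q s t s' → Run ω (.ite b P Q) s (b.cost + 1 + t) s'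
  | loop_true {b : BExp} {P : Prog} {s s₁ s₂ : State} {t₁ t₂ : ℕ} :
      b.eval s → Run ω P s t₁ s₁ → Run ω (.loop b P) s₁ t₂ s₂ →
      Run ω (.loop b P) s (b.cost + 1 + t₁ + t₂) s₂
  | loop_false {b : BExp} {P : Prog} {s : State} :
      ¬ b.eval s → Run ω (.loop b P) s (b.cost + 1) s

/-- A program has at most one halting run on a given stream of sample points. -/
theorem Run.unique {ω : ℕ → ℝ} {P : Prog} {s : State} {t : ℕ} {s' : State}
    (h : Run ω P s t s') : ∀ {u : ℕ} {s'' : State}, Run ω P s u s'' → t = u ∧ s' = s'' := by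
  induction h with
  | skip s => intro u s'' h'; cases h'; exact ⟨rfl, rfl⟩
  | setN a i e s => intro u s'' h'; cases h'; exact ⟨rfl, rfl⟩
  | setR a i e s => intro u s'' h'; cases h'; exact ⟨rfl, rfl⟩
  | draw a i s => intro u s'' h'; cases h'; exact ⟨rfl, rfl⟩
  | seq _ _ ih₁ ih₂ =>
    intro u s'' h'
    cases h' with
    | seq k₁ k₂ =>
      obtain ⟨rfl, rfl⟩ := ih₁ k₁
      obtain ⟨rfl, rfl⟩ := ih₂ k₂
      exact ⟨rfl, rfl⟩
  | ite_true hb _ ih =>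
    intro u s'' h'
    cases h' with
    | ite_true _ k => obtain ⟨rfl, rfl⟩ := ih k; exact ⟨rfl, rfl⟩
    | ite_false hb' _ => exact absurd hb hb'
  | ite_false hb _ ih =>
    intro u s'' h'
    cases h' with
    | ite_true hb' _ => exact absurd hb' hb
    | ite_false _ k => obtain ⟨rfl, rfl⟩ := ih k; exact ⟨rfl, rfl⟩
  | loop_true hb _ _ ih₁ ih₂ =>
    intro u s'' h'
    cases h' with
    | loop_true _ k₁ k₂ =>
      obtain ⟨rfl, rfl⟩ := ih₁ k₁
      obtain ⟨rfl, rfl⟩ := ih₂ k₂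
      exact ⟨rfl, rfl⟩
    | loop_false hb' => exact absurd hb hb'
  | loop_false hb =>
    intro u s'' h'
    cases h' with
    | loop_true hb' _ _ => exact absurd hb' hb
    | loop_false _ => exact ⟨rfl, rfl⟩

/-- The initial state on input `(k, ε)`: cell `0` of the natural-number array `0` holds `k`, cell
`0` of the real array `0` holds `ε`, all other cells hold `0`, and nothing has been drawn. -/
noncomputable def State.init (k : ℕ) (ε : ℝ) : State where
  nat := fun a i => if a = 0 ∧ i = 0 then k else 0
  real := fun a i => if a = 0 ∧ i = 0 then ε else 0
  draws := 0

/-! ## Histograms and total variation distance -/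

/-- `ℓ`, `b`, `c` describe a probability density on `[0,1)` that has the constant value `c i` on the
interval `[b i, b (i+1))`, for `i < ℓ`, where `0 = b 0 ≤ b 1 ≤ ⋯ ≤ b ℓ = 1`. (Empty intervals do no
harm: a density with fewer than `ℓ` nonempty pieces can be subdivided into exactly `ℓ` of them.) -/
def IsHistogram (ℓ : ℕ) (b c : ℕ → ℝ) : Prop :=
  b 0 = 0 ∧ b ℓ = 1 ∧ (∀ i < ℓ, b i ≤ b (i + 1)) ∧ (∀ i < ℓ, 0 ≤ c i) ∧
    ∑ i ∈ Finset.range ℓ, c i * (b (i + 1) - b i) = 1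

/-- The piecewise constant function described by `ℓ`, `b`, `c`. -/
noncomputable def histDensity (ℓ : ℕ) (b c : ℕ → ℝ) (x : ℝ) : ℝ :=
  ∑ i ∈ Finset.range ℓ, (Ico (b i) (b (i + 1))).indicator (fun _ => c i) x

/-- The distribution with density `histDensity ℓ b c`. -/
noncomputable def histMeasure (ℓ : ℕ) (b c : ℕ → ℝ) : Measure ℝ :=
  volume.withDensity (fun x => ENNReal.ofReal (histDensity ℓ b c x))

/-- The `k`-flat distributions over `[0,1)`. -/
def IsFlat (k : ℕ) (q : Measure ℝ) : Prop :=
  ∃ b c : ℕ → ℝ, IsHistogram k b c ∧ q = histMeasure k b c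

/-- The total variation distance of two probability measures on the line. -/
noncomputable def dTV (q p : Measure ℝ) : ℝ :=
  ⨆ A : {A : Set ℝ // MeasurableSet A}, |q.real A - p.real A|

/-- The total variation distance from `p` to the class of `k`-flat distributions over `[0,1)`. -/
noncomputable def opt (k : ℕ) (p : Measure ℝ) : ℝ :=
  ⨅ q : {q : Measure ℝ // IsFlat k q}, dTV q p

/-! ## The output of a program

A program outputs an explicit histogram: the number of pieces is in cell `0` of the natural-number
array `0`, the breakpoints are in the real array `0`, and the heights in the real array `1`. -/

def State.pieces (s : State) : ℕ := s.nat 0 0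

/-- The output of the program is a (well-formed) histogram. -/
def State.OutputsHistogram (s : State) : Prop :=
  IsHistogram s.pieces (s.real 0) (s.real 1)

/-- The hypothesis distribution in the output of the program. -/
noncomputable def State.hypothesis (s : State) : Measure ℝ :=
  histMeasure s.pieces (s.real 0) (s.real 1)

/-! ## Reasoning about programs -/

namespace State

/-! The program draws `n` points, where `n` is of order `k * (L + 1) / ε ^ 2` and `2 ^ L` is about
`k / ε ^ 2`. It sorts them and cuts the grid of sample values greedily: a piece is extended as long
as the empirical distribution function stays, at the grid points, within `τ` of some line through
its value at the left end. The threshold `τ` is doubled until at most `4 * k` pieces remain, and the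
empirical distribution `e`, flattened on the pieces, is the output. No dynamic programming is
needed, so up to logarithms the time is linear in the sample size.

Everything rests on one statistic: the sum of `|e J - q J|` over at most `7 * k` disjoint intervals
`J`, for a nearly optimal `k`-flat `q`. Call a bound for it `G`. Two arguments, valid for a fixed
sample, use it.

(1) `IsGreedy.mul_le`: if the threshold `τ` gives at least `4 * k` pieces, then `k * τ ≤ G`. Of `2 *
k` pairs of neighbouring pieces at least `k` contain no breakpoint of `q`; there `q` is linear, and
the greedy piece stopped because no line fits, so `e` and `q` differ by more than `τ` on some
subinterval. Hence the final `τ`, at most twice a threshold that failed unless it is the starting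
value, has `k * τ` of order at most `G + ε`.

(2) `IsGreedy.dTV_le`: the flattening is within `21 * (k * τ) + 3 * G` of `q`. On the common
refinement of the greedy partition and the grid cells that contain a breakpoint of `q`, both
densities are constant outside those cells, so only the masses of the parts matter. Inside such a
cell the sample sits at the left endpoint, which is a null set of `q`, so its weight is itself part
of the statistic.

To bound `G`: passing from `p` to `q` costs `2 * dTV q p` whatever the number of intervals
(`IntervalDeviationLE.trans_dTV`). The deviation of `e` from `p` is controlled by treating a union
of intervals as one event: the line is divided into about `2 * M` cells, an interval is sandwiched
between two runs of cells, and Hoeffding's inequality with a union bound over all unions of `7 * k`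
runs gives `measure_not_intervalDeviationLE_le`. Bounding each interval separately would lose a
power of `k`.

The rest is a small program logic (`Ensures`, with an invariant that carries the number of remaining
iterations) that shows that the program computes these objects in the claimed time. -/

@[simp] theorem writeN_nat (s : State) (a i v b j : ℕ) :
    (s.writeN a i v).nat b j = if b = a ∧ j = i then v else s.nat b j := by
  unfold writeN
  by_cases h : b = a
  · subst h
    by_cases h' : j = i <;> simp [h', Function.update]
  · simp [h, Function.update]

@[simp] theorem writeN_real (s : State) (a i v : ℕ) : (s.writeN a i v).real = s.real := rfl

@[simp] theorem writeN_draws (s : State) (a i v : ℕ) : (s.writeN a i v).draws = s.draws := rfl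

@[simp] theorem writeR_nat (s : State) (a i : ℕ) (v : ℝ) : (s.writeR a i v).nat = s.nat := rfl

@[simp] theorem writeR_real (s : State) (a i : ℕ) (v : ℝ) (b j : ℕ) :
    (s.writeR a i v).real b j = if b = a ∧ j = i then v else s.real b j := by
  unfold writeR
  by_cases h : b = a
  · subst h
    by_cases h' : j = i <;> simp [h', Function.update]
  · simp [h, Function.update]

@[simp] theorem writeR_draws (s : State) (a i : ℕ) (v : ℝ) : (s.writeR a i v).draws = s.draws := rfl

end State

namespace Prog

/-- The program `P` started in `s` halts within time `B` in a state that satisfies `Q`. -/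
def Ensures (ω : ℕ → ℝ) (P : Prog) (s : State) (B : ℕ) (Q : State → Prop) : Prop :=
  ∃ t s', Run ω P s t s' ∧ t ≤ B ∧ Q s'

/-- A program without loops. -/
def LoopFree : Prog → Prop
  | skip => True
  | setN _ _ _ => True
  | setR _ _ _ => True
  | draw _ _ => True
  | seq P Q => P.LoopFree ∧ Q.LoopFree
  | ite _ P Q => P.LoopFree ∧ Q.LoopFree
  | loop _ _ => False

/-- An upper bound for the running time of a program without loops. -/
def bound : Prog → ℕ
  | skip => 1
  | setN _ i e => i.cost + e.cost + 1
  | setR _ i e => i.cost + e.cost + 1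
  | draw _ i => i.cost + 1
  | seq P Q => P.bound + Q.bound
  | ite b P Q => b.cost + 1 + max P.bound Q.bound
  | loop _ _ => 0

open Classical in
/-- The final state of a program without loops. -/
noncomputable def exec (ω : ℕ → ℝ) : Prog → State → State
  | skip, s => s
  | setN a i e, s => s.writeN a (i.eval s) (e.eval s)
  | setR a i e, s => s.writeR a (i.eval s) (e.eval s)
  | draw a i, s => { s.writeR a (i.eval s) (ω s.draws) with draws := s.draws + 1 }
  | seq P Q, s => exec ω Q (exec ω P s)
  | ite b P Q, s => if b.eval s then exec ω P s else exec ω Q s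
  | loop _ _, s => s

theorem LoopFree.run {ω : ℕ → ℝ} : ∀ {P : Prog}, P.LoopFree → ∀ s : State,
    ∃ t, Run ω P s t (P.exec ω s) ∧ t ≤ P.bound := by
  intro P
  induction P with
  | skip => exact fun _ s => ⟨_, Run.skip s, le_rfl⟩
  | setN a i e => exact fun _ s => ⟨_, Run.setN a i e s, le_rfl⟩
  | setR a i e => exact fun _ s => ⟨_, Run.setR a i e s, le_rfl⟩
  | draw a i => exact fun _ s => ⟨_, Run.draw a i s, le_rfl⟩
  | seq P Q ihP ihQ =>
    intro h s
    obtain ⟨t₁, r₁, h₁⟩ := ihP h.1 s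
    obtain ⟨t₂, r₂, h₂⟩ := ihQ h.2 (P.exec ω s)
    exact ⟨_, Run.seq r₁ r₂, Nat.add_le_add h₁ h₂⟩
  | ite b P Q ihP ihQ =>
    intro h s
    by_cases hb : b.eval s
    · obtain ⟨t, r, ht⟩ := ihP h.1 s
      refine ⟨_, ?_, Nat.add_le_add_left (ht.trans (le_max_left _ _)) _⟩
      simpa only [exec, if_pos hb] using Run.ite_true hb r
    · obtain ⟨t, r, ht⟩ := ihQ h.2 s
      refine ⟨_, ?_, Nat.add_le_add_left (ht.trans (le_max_right _ _)) _⟩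
      simpa only [exec, if_neg hb] using Run.ite_false hb r
  | loop b P => exact fun h => h.elim

theorem Ensures.of_loopFree {ω : ℕ → ℝ} {P : Prog} {s : State} {B : ℕ} {Q : State → Prop}
    (h : P.LoopFree) (hB : P.bound ≤ B) (hQ : Q (P.exec ω s)) : P.Ensures ω s B Q := by
  obtain ⟨t, r, ht⟩ := h.run (ω := ω) s
  exact ⟨t, _, r, ht.trans hB, hQ⟩

theorem Ensures.mono {ω : ℕ → ℝ} {P : Prog} {s : State} {B B' : ℕ} {Q Q' : State → Prop}
    (h : P.Ensures ω s B Q) (hB : B ≤ B') (hQ : ∀ s', Q s' → Q' s') : P.Ensures ω s B' Q' := by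
  obtain ⟨t, s', r, ht, hs⟩ := h
  exact ⟨t, s', r, ht.trans hB, hQ _ hs⟩

theorem Ensures.seq {ω : ℕ → ℝ} {P Q : Prog} {s : State} {B₁ B₂ : ℕ} {M R : State → Prop}
    (hP : P.Ensures ω s B₁ M) (hQ : ∀ s', M s' → Q.Ensures ω s' B₂ R) :
    (Prog.seq P Q).Ensures ω s (B₁ + B₂) R := by
  obtain ⟨t₁, s₁, r₁, h₁, hM⟩ := hP
  obtain ⟨t₂, s₂, r₂, h₂, hR⟩ := hQ s₁ hM
  exact ⟨_, s₂, Run.seq r₁ r₂, Nat.add_le_add h₁ h₂, hR⟩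

theorem Ensures.ite {ω : ℕ → ℝ} {b : BExp} {P Q : Prog} {s : State} {B : ℕ} {R : State → Prop}
    (hP : b.eval s → P.Ensures ω s B R) (hQ : ¬ b.eval s → Q.Ensures ω s B R) :
    (Prog.ite b P Q).Ensures ω s (b.cost + 1 + B) R := by
  by_cases hb : b.eval s
  · obtain ⟨t, s', r, h, hR⟩ := hP hb
    exact ⟨_, s', Run.ite_true hb r, Nat.add_le_add_left h _, hR⟩
  · obtain ⟨t, s', r, h, hR⟩ := hQ hb
    exact ⟨_, s', Run.ite_false hb r, Nat.add_le_add_left h _, hR⟩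

/-- The rule for loops: `I f s` is an invariant in which at most `f` iterations are left, each of
which costs at most `B`. -/
theorem Ensures.loop {ω : ℕ → ℝ} {b : BExp} {P : Prog} {B : ℕ} (I : ℕ → State → Prop)
    (step : ∀ f s, I f s → b.eval s → 0 < f ∧ P.Ensures ω s B (I (f - 1))) :
    ∀ f s, I f s → (Prog.loop b P).Ensures ω s (f * (B + b.cost + 1) + (b.cost + 1))
      (fun s' => (∃ g, I g s') ∧ ¬ b.eval s') := by
  intro f
  induction f with
  | zero =>
    intro s hs
    by_cases hb : b.eval s
    · exact absurd (step 0 s hs hb).1 (lt_irrefl 0)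
    · exact ⟨_, s, Run.loop_false hb, by omega, ⟨0, hs⟩, hb⟩
  | succ f ih =>
    intro s hs
    by_cases hb : b.eval s
    · obtain ⟨-, t₁, s₁, r₁, h₁, hI⟩ := step _ s hs hb
      obtain ⟨t₂, s₂, r₂, h₂, hI₂⟩ := ih s₁ hI
      refine ⟨_, s₂, Run.loop_true hb r₁ r₂, ?_, hI₂⟩
      rw [Nat.add_mul, Nat.one_mul]
      omega
    · exact ⟨_, s, Run.loop_false hb, Nat.le_add_left _ _, ⟨_, hs⟩, hb⟩

end Prog

/-! ## Sorting -/

/-- The registers: cell `0` of an array. -/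
abbrev NExp.reg (a : ℕ) : NExp := .get a (.lit 0)

abbrev RExp.reg (a : ℕ) : RExp := .get a (.lit 0)

abbrev Prog.regN (a : ℕ) (e : NExp) : Prog := .setN a (.lit 0) e

abbrev Prog.regR (a : ℕ) (e : RExp) : Prog := .setR a (.lit 0) e

abbrev Prog.incr (a : ℕ) : Prog := .setN a (.lit 0) (.add (.get a (.lit 0)) (.lit 1))

/-- The registers that stay fixed once the sample is drawn: `k`, the sample size, and `ε`. -/
structure State.Frame (k : ℕ) (ε : ℝ) (n : ℕ) (s : State) : Prop where
  hk : s.nat 1 0 = k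
  hn : s.nat 2 0 = n
  hε : s.real 2 0 = ε
  hd : s.draws = n

/-- The array `S` is monotone on `[l, r)`. -/
def SortedOn (S : ℕ → ℝ) (l r : ℕ) : Prop := ∀ a b, l ≤ a → a ≤ b → b < r → S a ≤ S b

/-- The state of merging the blocks `[l, l+w)` and `[l+w, l+2w)` of `A` into `B`: the parts
`[l, i)` and `[l+w, j)` have been written to `[l, o)`. -/
structure MergeInv (A B₀ B : ℕ → ℝ) (l w i j o : ℕ) : Prop where
  hi : l ≤ i
  hiw : i ≤ l + w
  hj : l + w ≤ j
  hjw : j ≤ l + w + w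
  ho : o + (l + w) = i + j
  sorted : SortedOn B l o
  left : ∀ a b, l ≤ a → a < o → i ≤ b → b < l + w → B a ≤ A b
  right : ∀ a b, l ≤ a → a < o → j ≤ b → b < l + w + w → B a ≤ A b
  sum : ∀ g : ℝ → ℝ, ∑ x ∈ Finset.Ico l o, g (B x) =
    ∑ x ∈ Finset.Ico l i, g (A x) + ∑ x ∈ Finset.Ico (l + w) j, g (A x)
  below : ∀ a < l, B a = B₀ a

theorem MergeInv.init (A B₀ : ℕ → ℝ) (l w : ℕ) : MergeInv A B₀ B₀ l w l (l + w) l where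
  hi := le_rfl
  hiw := by omega
  hj := le_rfl
  hjw := by omega
  ho := by omega
  sorted := fun a b _ _ _ => by omega
  left := fun a b _ _ _ => by omega
  right := fun a b _ _ _ => by omega
  sum := by simp
  below := fun _ _ => rfl

/-- If the guard fails, then the right block is exhausted or `A i ≤ A j`. Either way `A i` is the
least entry not yet moved, because both blocks are sorted. -/
theorem MergeInv.takeLeft {A B₀ B B' : ℕ → ℝ} {l w i j o : ℕ} (h : MergeInv A B₀ B l w i j o)
    (hA : SortedOn A l (l + w)) (hA' : SortedOn A (l + w) (l + w + w)) (hi : i < l + w)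
    (hij : ¬ (j < l + w + w ∧ A j < A i)) (hB' : ∀ x, B' x = if x = o then A i else B x) :
    MergeInv A B₀ B' l w (i + 1) j (o + 1) := by
  obtain ⟨h1, h2, h3, h4, h5, h6, h7, h8, h9, h10⟩ := h
  have hlo : l ≤ o := by omega
  have hB : ∀ x < o, B' x = B x := fun x hx => by rw [hB', if_neg hx.ne]
  have hBo : B' o = A i := by rw [hB', if_pos rfl]
  refine ⟨by omega, by omega, by omega, by omega, by omega, ?_, ?_, ?_, ?_, ?_⟩
  · intro a b ha hab hb
    rcases Nat.lt_succ_iff_lt_or_eq.1 hb with hb | rfl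
    · rw [hB a (by omega), hB b hb]; exact h6 a b ha hab hb
    · rcases hab.lt_or_eq with hab | rfl
      · rw [hB a hab, hBo]; exact h7 a i ha hab le_rfl hi
      · exact le_rfl
  · intro a b ha hao hb hb'
    rcases Nat.lt_succ_iff_lt_or_eq.1 hao with hao | rfl
    · rw [hB a hao]; exact h7 a b ha hao (by omega) hb'
    · rw [hBo]; exact hA i b h1 (by omega) hb'
  · intro a b ha hao hb hb'
    rcases Nat.lt_succ_iff_lt_or_eq.1 hao with hao | rfl
    · rw [hB a hao]; exact h8 a b ha hao hb hb'
    · rw [hBo]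
      have : A i ≤ A j := not_lt.1 fun h => hij ⟨by omega, h⟩
      exact this.trans (hA' j b h3 hb hb')
  · intro g
    rw [Finset.sum_Ico_succ_top hlo, Finset.sum_Ico_succ_top h1, hBo,
      Finset.sum_congr rfl (fun x hx => by rw [hB x (Finset.mem_Ico.1 hx).2]), h9 g]
    ring
  · intro a ha
    rw [hB a (by omega), h10 a ha]

/-- The bound `A j ≤ A i` is asked for only while the left block is not exhausted, since the same
branch of the program serves both situations. -/
theorem MergeInv.takeRight {A B₀ B B' : ℕ → ℝ} {l w i j o : ℕ} (h : MergeInv A B₀ B l w i j o)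
    (hA : SortedOn A l (l + w)) (hA' : SortedOn A (l + w) (l + w + w)) (hj : j < l + w + w)
    (hij : i < l + w → A j ≤ A i) (hB' : ∀ x, B' x = if x = o then A j else B x) :
    MergeInv A B₀ B' l w i (j + 1) (o + 1) := by
  obtain ⟨h1, h2, h3, h4, h5, h6, h7, h8, h9, h10⟩ := h
  have hlo : l ≤ o := by omega
  have hB : ∀ x < o, B' x = B x := fun x hx => by rw [hB', if_neg hx.ne]
  have hBo : B' o = A j := by rw [hB', if_pos rfl]
  refine ⟨by omega, by omega, by omega, by omega, by omega, ?_, ?_, ?_, ?_, ?_⟩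
  · intro a b ha hab hb
    rcases Nat.lt_succ_iff_lt_or_eq.1 hb with hb | rfl
    · rw [hB a (by omega), hB b hb]; exact h6 a b ha hab hb
    · rcases hab.lt_or_eq with hab | rfl
      · rw [hB a hab, hBo]; exact h8 a j ha hab le_rfl hj
      · exact le_rfl
  · intro a b ha hao hb hb'
    rcases Nat.lt_succ_iff_lt_or_eq.1 hao with hao | rfl
    · rw [hB a hao]; exact h7 a b ha hao hb hb'
    · rw [hBo]; exact (hij (by omega)).trans (hA i b h1 hb hb')
  · intro a b ha hao hb hb'
    rcases Nat.lt_succ_iff_lt_or_eq.1 hao with hao | rfl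
    · rw [hB a hao]; exact h8 a b ha hao (by omega) hb'
    · rw [hBo]; exact hA' j b h3 (by omega) hb'
  · intro g
    rw [Finset.sum_Ico_succ_top hlo, Finset.sum_Ico_succ_top h3, hBo,
      Finset.sum_congr rfl (fun x hx => by rw [hB x (Finset.mem_Ico.1 hx).2]), h9 g]
    ring
  · intro a ha
    rw [hB a (by omega), h10 a ha]

/-! ### Merge sort as a program. -/

namespace Prog

/-- One step of merging: the smaller one of the two current entries is moved. -/
def mergeStep : Prog :=
  .ite (.and (.ltN (.reg 4) (.reg 8))
      (.not (.and (.ltN (.reg 5) (.reg 9)) (.ltR (.get 3 (.reg 5)) (.get 3 (.reg 4))))))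
    (.seq (.setR 4 (.reg 7) (.get 3 (.reg 4))) (.seq (.incr 4) (.incr 7)))
    (.seq (.setR 4 (.reg 7) (.get 3 (.reg 5))) (.seq (.incr 5) (.incr 7)))

/-- Merging two adjacent blocks. -/
def mergeBlocks : Prog :=
  .seq (.seq (.regN 4 (.reg 7)) (.seq (.regN 8 (.add (.reg 7) (.reg 6)))
      (.seq (.regN 5 (.reg 8)) (.regN 9 (.add (.reg 8) (.reg 6))))))
    (.loop (.ltN (.reg 7) (.reg 9)) mergeStep)

/-- Copying the auxiliary array back. -/
def copyBack : Prog :=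
  .seq (.regN 4 (.lit 0))
    (.loop (.ltN (.reg 4) (.reg 2)) (.seq (.setR 3 (.reg 4) (.get 4 (.reg 4))) (.incr 4)))

def mergePass : Prog :=
  .seq (.seq (.regN 7 (.lit 0)) (.loop (.ltN (.reg 7) (.reg 2)) mergeBlocks))
    (.seq copyBack (.regN 6 (.add (.reg 6) (.reg 6))))

def mergeSort : Prog :=
  .seq (.regN 6 (.lit 1)) (.loop (.ltN (.reg 6) (.reg 2)) mergePass)

variable {ω : ℕ → ℝ} {k n : ℕ} {ε : ℝ}

/-- Equality of the sums of every `g` expresses that the multiset of entries is preserved, without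
naming a permutation; later it is applied directly to indicator functions. -/
theorem mergeBlocks_ensures {A B₀ : ℕ → ℝ} {l w : ℕ} {s : State} (hs : s.Frame k ε n)
    (h3 : s.real 3 = A) (h4 : s.real 4 = B₀) (h6 : s.nat 6 0 = w) (h7 : s.nat 7 0 = l)
    (hA : SortedOn A l (l + w)) (hA' : SortedOn A (l + w) (l + w + w)) :
    mergeBlocks.Ensures ω s (100 * w + 100) (fun s' => s'.Frame k ε n ∧ s'.real 3 = A ∧
      s'.nat 6 0 = w ∧ s'.nat 7 0 = l + w + w ∧ SortedOn (s'.real 4) l (l + w + w) ∧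
      (∀ g : ℝ → ℝ, ∑ x ∈ Finset.Ico l (l + w + w), g (s'.real 4 x) =
        ∑ x ∈ Finset.Ico l (l + w + w), g (A x)) ∧ ∀ a < l, s'.real 4 a = B₀ a) := by
  let I : ℕ → State → Prop := fun f s => s.Frame k ε n ∧ s.real 3 = A ∧ s.nat 6 0 = w ∧
    s.nat 8 0 = l + w ∧ s.nat 9 0 = l + w + w ∧
    MergeInv A B₀ (s.real 4) l w (s.nat 4 0) (s.nat 5 0) (s.nat 7 0) ∧
    l + w + w ≤ s.nat 7 0 + f
  -- Initialisation costs at most 22; each of the `2 * w` moves costs at most 39, plus 5 for the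
  -- loop test and 1 for the jump.
  refine Ensures.mono (B := 22 + (2 * w * (39 + 5 + 1) + (5 + 1))) (Ensures.seq (M := I (2 * w))
    (Ensures.of_loopFree (by simp [LoopFree]) (by simp [bound, NExp.cost]) ?_)
    (fun s' hs' => Ensures.loop I ?_ _ _ hs')) (by omega) ?_
  · obtain ⟨f1, f2, f3, f4⟩ := hs
    refine ⟨⟨?_, ?_, ?_, ?_⟩, ?_, ?_, ?_, ?_, ?_, ?_⟩ <;>
      simp [exec, NExp.eval, f1, f2, f3, f4, h3, h4, h6, h7]
    · exact MergeInv.init A B₀ l w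
    · omega
  · rintro f s ⟨⟨f1, f2, f3, f4⟩, i3, i6, i8, i9, hM, hf⟩ hb
    simp only [BExp.eval, NExp.eval, i9] at hb
    refine ⟨by omega, ?_⟩
    refine (Ensures.ite (B := 18) (fun hc => Ensures.of_loopFree (by simp [LoopFree])
      (by simp [bound, NExp.cost, RExp.cost]) ?_) (fun hc => Ensures.of_loopFree
      (by simp [LoopFree]) (by simp [bound, NExp.cost, RExp.cost]) ?_)).mono
      (by simp [BExp.cost, NExp.cost, RExp.cost]) fun _ h => h
    · simp only [BExp.eval, NExp.eval, RExp.eval, i8, i9, i3] at hc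
      refine ⟨⟨?_, ?_, ?_, ?_⟩, ?_, ?_, ?_, ?_, ?_, ?_⟩
      pick_goal 9
      · have := hM.takeLeft (B' := fun x => if x = s.nat 7 0 then A (s.nat 4 0) else s.real 4 x)
          hA hA' hc.1 hc.2 (fun x => rfl)
        convert this using 1 <;> simp [exec, NExp.eval, RExp.eval, i3]
        funext x; simp
      all_goals simp [exec, NExp.eval, RExp.eval, f1, f2, f3, f4, i3, i6, i8, i9]
      · funext x; simp [i3]
      · omega
    · simp only [BExp.eval, NExp.eval, RExp.eval, i8, i9, i3] at hc
      refine ⟨⟨?_, ?_, ?_, ?_⟩, ?_, ?_, ?_, ?_, ?_, ?_⟩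
      pick_goal 9
      · have := hM.takeRight (B' := fun x => if x = s.nat 7 0 then A (s.nat 5 0) else s.real 4 x)
          hA hA' (by
            have := hM.ho
            have := hM.hjw
            have := hM.hiw
            by_contra hcon
            exact hc ⟨by omega, fun h => hcon h.1⟩)
          (fun hi => by
            by_contra hcon
            exact hc ⟨hi, fun h => hcon h.2.le⟩) (fun x => rfl)
        convert this using 1 <;> simp [exec, NExp.eval, RExp.eval, i3]
        funext x; simp
      all_goals simp [exec, NExp.eval, RExp.eval, f1, f2, f3, f4, i3, i6, i8, i9]
      · funext x; simp [i3]
      · omega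
  · rintro s' ⟨⟨f, hf, i3, i6, i8, i9, hM, -⟩, hb⟩
    simp only [BExp.eval, NExp.eval, i9] at hb
    have h5 := hM.ho; have := hM.hjw; have := hM.hiw
    have ho : s'.nat 7 0 = l + w + w := by omega
    have hi : s'.nat 4 0 = l + w := by omega
    have hj : s'.nat 5 0 = l + w + w := by omega
    refine ⟨hf, i3, i6, ho, ho ▸ hM.sorted, fun g => ?_, hM.below⟩
    have := hM.sum g
    rw [ho, hi, hj, Finset.sum_Ico_consecutive _ (by omega) (by omega)] at this
    exact this

end Prog

namespace Prog

variable {ω : ℕ → ℝ} {k n : ℕ} {ε : ℝ}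

/-- As `n` is a multiple of `2 * w`, all blocks are complete. Each of the `Q` merges costs `O(w)`,
and `Q * w = n / 2`. -/
theorem mergeBlocks_loop_ensures {A : ℕ → ℝ} {w Q : ℕ} {s : State} (hs : s.Frame k ε n)
    (h3 : s.real 3 = A) (h6 : s.nat 6 0 = w) (hw : 0 < w) (hn : n = Q * (w + w))
    (hA : ∀ l, w ∣ l → l < n → SortedOn A l (l + w)) :
    (Prog.seq (.regN 7 (.lit 0)) (.loop (.ltN (.reg 7) (.reg 2)) mergeBlocks)).Ensures ω s
      (200 * n + 20) (fun s' => s'.Frame k ε n ∧ s'.nat 6 0 = w ∧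
        (∀ l, w + w ∣ l → l < n → SortedOn (s'.real 4) l (l + (w + w))) ∧
        ∀ g : ℝ → ℝ, ∑ x ∈ Finset.range n, g (s'.real 4 x) = ∑ x ∈ Finset.range n, g (A x)) := by
  let I : ℕ → State → Prop := fun f s => s.Frame k ε n ∧ s.real 3 = A ∧ s.nat 6 0 = w ∧ f ≤ Q ∧
    s.nat 7 0 = (Q - f) * (w + w) ∧
    (∀ l, w + w ∣ l → l < s.nat 7 0 → SortedOn (s.real 4) l (l + (w + w))) ∧
    ∀ g : ℝ → ℝ, ∑ x ∈ Finset.range (s.nat 7 0), g (s.real 4 x) =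
      ∑ x ∈ Finset.range (s.nat 7 0), g (A x)
  refine Ensures.mono (B := 4 + (Q * (100 * w + 100 + 5 + 1) + (5 + 1))) (Ensures.seq (M := I Q)
    (Ensures.of_loopFree (by simp [LoopFree]) (by simp [bound, NExp.cost]) ?_)
    (fun s' hs' => Ensures.loop I ?_ _ _ hs')) ?_ ?_
  · obtain ⟨f1, f2, f3, f4⟩ := hs
    refine ⟨⟨?_, ?_, ?_, ?_⟩, ?_, ?_, le_rfl, ?_, ?_, ?_⟩ <;>
      simp [exec, NExp.eval, f1, f2, f3, f4, h3, h6]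
  · rintro f s ⟨hf, i3, i6, hfQ, i7, hB, hsum⟩ hb
    simp only [BExp.eval, NExp.eval, hf.hn] at hb
    have hf0 : 0 < f := by
      rcases Nat.eq_zero_or_pos f with rfl | h
      · rw [i7, hn] at hb; simp at hb
      · exact h
    refine ⟨hf0, ?_⟩
    have hd : w ∣ s.nat 7 0 := i7 ▸ Dvd.dvd.mul_left ⟨2, by ring⟩ _
    have hle : s.nat 7 0 + (w + w) = (Q - (f - 1)) * (w + w) := by
      rw [i7, show Q - (f - 1) = Q - f + 1 by omega]; ring
    have hle' : s.nat 7 0 + (w + w) ≤ n := by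
      rw [hle, hn]; exact Nat.mul_le_mul_right _ (by omega)
    refine (mergeBlocks_ensures hf i3 rfl i6 rfl (hA _ hd hb)
      (hA _ (hd.add (dvd_refl w)) (by omega))).mono le_rfl ?_
    rintro s' ⟨hf', j3, j6, j7, hS, hg, hlow⟩
    refine ⟨hf', j3, j6, by omega, by rw [← hle, j7, add_assoc], ?_, ?_⟩
    · intro l hl hl'
      rcases lt_or_ge l (s.nat 7 0) with h | h
      · have hlt : l + (w + w) ≤ s.nat 7 0 := by
          obtain ⟨a, rfl⟩ := hl
          have : a < Q - f := by
            rw [i7, mul_comm] at h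
            exact lt_of_mul_lt_mul_right h (Nat.zero_le _)
          rw [i7]
          calc (w + w) * a + (w + w) = (a + 1) * (w + w) := by ring
            _ ≤ _ := Nat.mul_le_mul_right _ this
        intro a b ha hab hb'
        rw [hlow a (by omega), hlow b (by omega)]
        exact hB l hl h a b ha hab hb'
      · have : l = s.nat 7 0 := by
          obtain ⟨a, rfl⟩ := hl
          rw [j7, i7] at hl'
          rw [i7] at h ⊢
          have h1 : a < Q - f + 1 := by
            refine lt_of_mul_lt_mul_right (a := w + w) ?_ (Nat.zero_le _)
            calc a * (w + w) = (w + w) * a := mul_comm _ _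
              _ < (Q - f) * (w + w) + w + w := hl'
              _ = _ := by ring
          have h2 : Q - f ≤ a := by
            refine le_of_mul_le_mul_right (a := w + w) ?_ (by omega)
            rw [mul_comm a]; exact h
          rw [show a = Q - f by omega, mul_comm]
        subst this
        rwa [← add_assoc]
    · intro g
      have e1 : ∀ F : ℕ → ℝ, ∑ x ∈ Finset.range (s'.nat 7 0), F x =
          ∑ x ∈ Finset.range (s.nat 7 0), F x +
            ∑ x ∈ Finset.Ico (s.nat 7 0) (s.nat 7 0 + w + w), F x := by
        intro F
        rw [j7, Finset.range_eq_Ico, Finset.range_eq_Ico,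
          Finset.sum_Ico_consecutive _ (Nat.zero_le _) (by omega)]
      rw [e1, e1, hg g, ← hsum g]
      congr 1
      exact Finset.sum_congr rfl fun x hx => by rw [hlow x (Finset.mem_range.1 hx)]
  · have h1 : Q * w ≤ n := by rw [hn]; exact Nat.mul_le_mul_left _ (by omega)
    have h2 : Q ≤ Q * w := Nat.le_mul_of_pos_right _ hw
    have h3 : n = 2 * (Q * w) := by rw [hn]; ring
    have h4 : Q * (100 * w + 100 + 5 + 1) = 100 * (Q * w) + 106 * Q := by ring
    omega
  · rintro s' ⟨⟨f, hf, i3, i6, hfQ, i7, hB, hsum⟩, hb⟩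
    simp only [BExp.eval, NExp.eval, hf.hn] at hb
    have ho : s'.nat 7 0 = n := by
      refine le_antisymm ?_ (not_lt.1 hb)
      rw [i7, hn]; exact Nat.mul_le_mul_right _ (Nat.sub_le _ _)
    rw [ho] at hB hsum
    exact ⟨hf, i6, hB, hsum⟩

theorem copyBack_ensures {B : ℕ → ℝ} {w : ℕ} {s : State} (hs : s.Frame k ε n)
    (h4 : s.real 4 = B) (h6 : s.nat 6 0 = w) :
    copyBack.Ensures ω s (25 * n + 20) (fun s' => s'.Frame k ε n ∧ s'.nat 6 0 = w ∧
      ∀ x < n, s'.real 3 x = B x) := by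
  let I : ℕ → State → Prop := fun f s => s.Frame k ε n ∧ s.real 4 = B ∧ s.nat 6 0 = w ∧
    n ≤ s.nat 4 0 + f ∧ ∀ x < s.nat 4 0, s.real 3 x = B x
  refine Ensures.mono (B := 4 + (n * (14 + 5 + 1) + (5 + 1))) (Ensures.seq (M := I n)
    (Ensures.of_loopFree (by simp [LoopFree]) (by simp [bound, NExp.cost]) ?_)
    (fun s' hs' => Ensures.loop I ?_ _ _ hs')) (by ring_nf; omega) ?_
  · obtain ⟨f1, f2, f3, f4⟩ := hs
    refine ⟨⟨?_, ?_, ?_, ?_⟩, ?_, ?_, ?_, ?_⟩ <;>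
      simp [exec, NExp.eval, f1, f2, f3, f4, h4, h6]
  · rintro f s ⟨⟨f1, f2, f3, f4⟩, i4, i6, hf, hB⟩ hb
    simp only [BExp.eval, NExp.eval, f2] at hb
    refine ⟨by omega, Ensures.of_loopFree (by simp [LoopFree])
      (by simp [bound, NExp.cost, RExp.cost]) ?_⟩
    refine ⟨⟨?_, ?_, ?_, ?_⟩, ?_, ?_, ?_, ?_⟩
    all_goals simp [exec, NExp.eval, RExp.eval, f1, f2, f3, f4, i4, i6]
    · funext x; simp [i4]
    · omega
    · intro x hx
      split_ifs with h
      · rw [h]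
      · exact hB x (by omega)
  · rintro s' ⟨⟨f, hf, i4, i6, -, hB⟩, hb⟩
    simp only [BExp.eval, NExp.eval, hf.hn] at hb
    exact ⟨hf, i6, fun x hx => hB x (by omega)⟩

theorem mergePass_ensures {A : ℕ → ℝ} {w Q : ℕ} {s : State} (hs : s.Frame k ε n)
    (h3 : s.real 3 = A) (h6 : s.nat 6 0 = w) (hw : 0 < w) (hn : n = Q * (w + w))
    (hA : ∀ l, w ∣ l → l < n → SortedOn A l (l + w)) :
    mergePass.Ensures ω s (225 * n + 60) (fun s' => s'.Frame k ε n ∧ s'.nat 6 0 = w + w ∧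
      (∀ l, w + w ∣ l → l < n → SortedOn (s'.real 3) l (l + (w + w))) ∧
      ∀ g : ℝ → ℝ, ∑ x ∈ Finset.range n, g (s'.real 3 x) = ∑ x ∈ Finset.range n, g (A x)) := by
  refine Ensures.mono (B := (200 * n + 20) + ((25 * n + 20) + 7))
    (Ensures.seq (mergeBlocks_loop_ensures hs h3 h6 hw hn hA) (R := fun s' => s'.Frame k ε n ∧
      s'.nat 6 0 = w + w ∧ (∀ l, w + w ∣ l → l < n → SortedOn (s'.real 3) l (l + (w + w))) ∧
      ∀ g : ℝ → ℝ, ∑ x ∈ Finset.range n, g (s'.real 3 x) = ∑ x ∈ Finset.range n, g (A x)) ?_)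
    (by omega) (fun _ h => h)
  rintro s₁ ⟨hs₁, h6₁, hB, hsum⟩
  refine Ensures.seq (copyBack_ensures hs₁ rfl h6₁) ?_
  rintro s₂ ⟨⟨f1, f2, f3, f4⟩, h6₂, hC⟩
  refine Ensures.of_loopFree (by simp [LoopFree]) (by simp [bound, NExp.cost]) ?_
  refine ⟨⟨?_, ?_, ?_, ?_⟩, ?_, ?_, ?_⟩
  all_goals simp [exec, NExp.eval, f1, f2, f3, f4, h6₂]
  · intro l hl hln a b ha hab hb
    have hle : l + (w + w) ≤ n := by
      obtain ⟨c, rfl⟩ := hl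
      rw [hn, mul_comm] at hln ⊢
      have hc : c < Q := by
        rw [mul_comm] at hln
        exact lt_of_mul_lt_mul_left (a := w + w) (by rw [mul_comm, mul_comm _ Q]; linarith) (Nat.zero_le _)
      calc c * (w + w) + (w + w) = (c + 1) * (w + w) := by ring
        _ ≤ Q * (w + w) := Nat.mul_le_mul_right _ hc
        _ = _ := by ring
    rw [hC a (by omega), hC b (by omega)]
    exact hB l hl hln a b ha hab hb
  · intro g
    rw [← hsum g]
    exact Finset.sum_congr rfl fun x hx => by rw [hC x (Finset.mem_range.1 hx)]

/-- The block length doubles from `1` to `2 ^ μ = n`, so there are `μ` passes of cost `O(n)`. This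
is why the sample size is a power of two. -/
theorem mergeSort_ensures {A : ℕ → ℝ} {μ : ℕ} {s : State} (hs : s.Frame k ε n)
    (h3 : s.real 3 = A) (hn : n = 2 ^ μ) :
    mergeSort.Ensures ω s (μ * (225 * n + 66) + 10) (fun s' => s'.Frame k ε n ∧
      SortedOn (s'.real 3) 0 n ∧
      ∀ g : ℝ → ℝ, ∑ x ∈ Finset.range n, g (s'.real 3 x) = ∑ x ∈ Finset.range n, g (A x)) := by
  let I : ℕ → State → Prop := fun f s => s.Frame k ε n ∧ f ≤ μ ∧ s.nat 6 0 = 2 ^ (μ - f) ∧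
    (∀ l, s.nat 6 0 ∣ l → l < n → SortedOn (s.real 3) l (l + s.nat 6 0)) ∧
    ∀ g : ℝ → ℝ, ∑ x ∈ Finset.range n, g (s.real 3 x) = ∑ x ∈ Finset.range n, g (A x)
  refine Ensures.mono (B := 4 + (μ * (225 * n + 60 + 5 + 1) + (5 + 1))) (Ensures.seq (M := I μ)
    (Ensures.of_loopFree (by simp [LoopFree]) (by simp [bound, NExp.cost]) ?_)
    (fun s' hs' => Ensures.loop I ?_ _ _ hs')) (by ring_nf; omega) ?_
  · obtain ⟨f1, f2, f3, f4⟩ := hs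
    refine ⟨⟨?_, ?_, ?_, ?_⟩, le_rfl, ?_, ?_, ?_⟩
    all_goals simp [exec, NExp.eval, f1, f2, f3, f4, h3]
    intro l _ a b ha hab hb
    rw [show a = b by omega]
  · rintro f s ⟨hf, hfμ, i6, hB, hsum⟩ hb
    simp only [BExp.eval, NExp.eval, hf.hn] at hb
    have hf0 : 0 < f := by
      rcases Nat.eq_zero_or_pos f with rfl | h
      · rw [i6, hn] at hb; simp at hb
      · exact h
    refine ⟨hf0, ?_⟩
    refine (mergePass_ensures (Q := 2 ^ (f - 1)) hf rfl rfl (by rw [i6]; positivity) ?_ hB).mono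
      le_rfl ?_
    · rw [i6, ← two_mul, ← pow_succ', ← pow_add, hn]; congr 1; omega
    · rintro s' ⟨hf', j6, hB', hsum'⟩
      refine ⟨hf', by omega, ?_, ?_, fun g => (hsum' g).trans (hsum g)⟩
      · rw [j6, i6, ← two_mul, ← pow_succ']; congr 1; omega
      · rw [j6]; exact hB'
  · rintro s' ⟨⟨f, hf, hfμ, i6, hB, hsum⟩, hb⟩
    simp only [BExp.eval, NExp.eval, hf.hn] at hb
    have h6 : s'.nat 6 0 = n := by
      refine le_antisymm ?_ (not_lt.1 hb)
      rw [i6, hn]; exact Nat.pow_le_pow_right (by norm_num) (Nat.sub_le _ _)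
    refine ⟨hf, ?_, hsum⟩
    have := hB 0 (dvd_zero _) (by rw [hn]; positivity)
    rwa [h6, zero_add] at this

end Prog

/-! ## Sample size, sampling, and the grid of the sample values -/

/-- The grid of the values of the sorted sample `S` in `[0,1)`, with `0` and `1` added: `N j` is the
number of entries of `S` that are less than `X j`. -/
structure IsGrid (S : ℕ → ℝ) (n : ℕ) (X : ℕ → ℝ) (N : ℕ → ℕ) (m : ℕ) : Prop where
  zero : X 0 = 0
  one : X m = 1
  N_last : N m = n
  lt : ∀ a b, a < b → b ≤ m → X a < X b
  m_le : m ≤ n + 1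
  N_le : ∀ j ≤ m, N j ≤ n
  count : ∀ i < n, ∀ j ≤ m, (i < N j ↔ S i < X j)
  mem : ∀ i < n, ∃ j < m, S i = X j

/-- The state of the construction of the grid when `i` entries have been processed. -/
structure GridInv (S : ℕ → ℝ) (n : ℕ) (X : ℕ → ℝ) (N : ℕ → ℕ) (m i : ℕ) : Prop where
  i_le : i ≤ n
  zero : X 0 = 0
  top : X m < 1
  lt : ∀ a b, a < b → b ≤ m → X a < X b
  m_le : m ≤ i
  N_le : ∀ j ≤ m, N j ≤ i
  count : ∀ i' < i, ∀ j ≤ m, (i' < N j ↔ S i' < X j)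
  mem : ∀ i' < i, ∃ j ≤ m, S i' = X j
  last : ∀ i', i ≤ i' → i' < n → X m ≤ S i'

/-- The current sample is not above `X m`, and by sortedness it is not below it, so it repeats the
last grid value. -/
theorem GridInv.same {S X : ℕ → ℝ} {N : ℕ → ℕ} {n m i : ℕ} (h : GridInv S n X N m i)
    (hi : i < n) (hX : ¬ X m < S i) : GridInv S n X N m (i + 1) := by
  have hle : ∀ j ≤ m, X j ≤ X m := fun j hj => by
    rcases hj.lt_or_eq with hj | rfl
    · exact (h.lt j m hj le_rfl).le
    · exact le_rfl
  have he : S i = X m := le_antisymm (not_lt.1 hX) (h.last i le_rfl hi)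
  refine ⟨hi, h.zero, h.top, h.lt, h.m_le.trans (Nat.le_succ _), fun j hj => (h.N_le j hj).trans
    (Nat.le_succ _), ?_, ?_, fun i' hi' => h.last i' (by omega)⟩
  · intro i' hi' j hj
    rcases Nat.lt_succ_iff_lt_or_eq.1 hi' with hi' | rfl
    · exact h.count i' hi' j hj
    · exact ⟨fun hc => absurd (h.N_le j hj) (by omega), fun hc => absurd (hle j hj) (by
        rw [he] at hc
        exact not_le.2 hc)⟩
  · intro i' hi'
    rcases Nat.lt_succ_iff_lt_or_eq.1 hi' with hi' | rfl
    · exact h.mem i' hi'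
    · exact ⟨m, le_rfl, he⟩

/-- The index `i` of the first sample with a new value is exactly the number of samples that are
smaller. -/
theorem GridInv.new {S X X' : ℕ → ℝ} {N N' : ℕ → ℕ} {n m i : ℕ} (h : GridInv S n X N m i)
    (hS : SortedOn S 0 n) (hi : i < n) (hi1 : S i < 1) (hX : X m < S i)
    (hX' : ∀ x, X' x = if x = m + 1 then S i else X x)
    (hN' : ∀ x, N' x = if x = m + 1 then i else N x) : GridInv S n X' N' (m + 1) (i + 1) := by
  have eX : ∀ j ≤ m, X' j = X j := fun j hj => by rw [hX', if_neg (by omega)]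
  have eN : ∀ j ≤ m, N' j = N j := fun j hj => by rw [hN', if_neg (by omega)]
  have eX1 : X' (m + 1) = S i := by rw [hX', if_pos rfl]
  have eN1 : N' (m + 1) = i := by rw [hN', if_pos rfl]
  have hle : ∀ j ≤ m, X j ≤ X m := fun j hj => by
    rcases hj.lt_or_eq with hj | rfl
    · exact (h.lt j m hj le_rfl).le
    · exact le_rfl
  refine ⟨hi, by rw [eX 0 (Nat.zero_le _), h.zero], eX1 ▸ hi1, ?_, by have := h.m_le; omega, ?_, ?_, ?_, ?_⟩
  · intro a b hab hb
    rcases Nat.le_succ_iff.1 hb with hb | rfl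
    · rw [eX a (by omega), eX b hb]; exact h.lt a b hab hb
    · rw [eX a (by omega), eX1]; exact (hle a (by omega)).trans_lt hX
  · intro j hj
    rcases Nat.le_succ_iff.1 hj with hj | rfl
    · rw [eN j hj]; exact (h.N_le j hj).trans (Nat.le_succ _)
    · rw [eN1]; exact Nat.le_succ _
  · intro i' hi' j hj
    rcases Nat.le_succ_iff.1 hj with hj | rfl
    · rw [eN j hj, eX j hj]
      rcases Nat.lt_succ_iff_lt_or_eq.1 hi' with hi' | rfl
      · exact h.count i' hi' j hj
      · exact ⟨fun hc => absurd (h.N_le j hj) (by omega), fun hc => absurd (hle j hj)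
          (not_le.2 (hX.trans hc))⟩
    · rw [eN1, eX1]
      rcases Nat.lt_succ_iff_lt_or_eq.1 hi' with hi' | rfl
      · obtain ⟨l, hl, e⟩ := h.mem i' hi'
        exact ⟨fun _ => by rw [e]; exact (hle l hl).trans_lt hX, fun _ => hi'⟩
      · simp
  · intro i' hi'
    rcases Nat.lt_succ_iff_lt_or_eq.1 hi' with hi' | rfl
    · obtain ⟨l, hl, e⟩ := h.mem i' hi'
      exact ⟨l, by omega, by rw [eX l hl, e]⟩
    · exact ⟨m + 1, le_rfl, eX1.symm⟩
  · intro i' hi' hn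
    rw [eX1]; exact hS i i' (Nat.zero_le _) (by omega) hn

theorem GridInv.isGrid {S X X' : ℕ → ℝ} {N N' : ℕ → ℕ} {n m : ℕ} (h : GridInv S n X N m n)
    (hS : ∀ i < n, S i < 1)
    (hX' : ∀ x, X' x = if x = m + 1 then 1 else X x)
    (hN' : ∀ x, N' x = if x = m + 1 then n else N x) : IsGrid S n X' N' (m + 1) := by
  have eX : ∀ j ≤ m, X' j = X j := fun j hj => by rw [hX', if_neg (by omega)]
  have eN : ∀ j ≤ m, N' j = N j := fun j hj => by rw [hN', if_neg (by omega)]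
  have eX1 : X' (m + 1) = 1 := by rw [hX', if_pos rfl]
  have eN1 : N' (m + 1) = n := by rw [hN', if_pos rfl]
  have hle : ∀ j ≤ m, X j < 1 := fun j hj => by
    rcases hj.lt_or_eq with hj | rfl
    · exact (h.lt j m hj le_rfl).trans h.top
    · exact h.top
  refine ⟨by rw [eX 0 (Nat.zero_le _), h.zero], eX1, eN1, ?_, by have := h.m_le; omega, ?_, ?_, ?_⟩
  · intro a b hab hb
    rcases Nat.le_succ_iff.1 hb with hb | rfl
    · rw [eX a (by omega), eX b hb]; exact h.lt a b hab hb
    · rw [eX a (by omega), eX1]; exact hle a (by omega)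
  · intro j hj
    rcases Nat.le_succ_iff.1 hj with hj | rfl
    · rw [eN j hj]; exact h.N_le j hj
    · rw [eN1]
  · intro i hi j hj
    rcases Nat.le_succ_iff.1 hj with hj | rfl
    · rw [eN j hj, eX j hj]; exact h.count i hi j hj
    · rw [eN1, eX1]; exact ⟨fun _ => hS i hi, fun _ => hi⟩
  · intro i hi
    obtain ⟨l, hl, e⟩ := h.mem i hi
    exact ⟨l, by omega, by rw [eX l hl, e]⟩

/-! ### Programs for the sample size, the sample and the grid. -/

namespace Prog

/-- Find the sample size, a power of `2` that is at least `2 ^ 25 * k * (L + 1) / ε ^ 2`, where `L`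
is the least number with `k / ε ^ 2 ≤ 2 ^ L`. -/
def sampleSize : Prog :=
  .seq (.seq (.seq (.regR 6 (.ofNat (.lit 1))) (.regN 3 (.lit 1)))
    (.loop (.ltR (.reg 6) (.div (.ofNat (.reg 1)) (.mul (.reg 2) (.reg 2))))
      (.seq (.regR 6 (.add (.reg 6) (.reg 6))) (.incr 3))))
  (.seq (.seq (.regR 6 (.div (.mul (.mul (.ofNat (.lit 33554432)) (.ofNat (.reg 1)))
      (.ofNat (.reg 3))) (.mul (.reg 2) (.reg 2)))) (.regN 2 (.lit 1)))
    (.loop (.ltR (.ofNat (.reg 2)) (.reg 6)) (.regN 2 (.add (.reg 2) (.reg 2)))))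

def drawSample : Prog :=
  .seq (.regN 4 (.lit 0))
    (.loop (.ltN (.reg 4) (.reg 2)) (.seq (.draw 3 (.reg 4)) (.incr 4)))

def gridStep : Prog :=
  .ite (.ltR (.get 5 (.reg 11)) (.get 3 (.reg 4)))
    (.seq (.incr 11) (.seq (.setR 5 (.reg 11) (.get 3 (.reg 4)))
      (.seq (.setN 10 (.reg 11) (.reg 4)) (.incr 4))))
    (.incr 4)

def makeGrid : Prog :=
  .seq (.seq (.seq (.setR 5 (.lit 0) (.ofNat (.lit 0))) (.seq (.setN 10 (.lit 0) (.lit 0))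
    (.seq (.regN 11 (.lit 0)) (.regN 4 (.lit 0)))))
    (.loop (.ltN (.reg 4) (.reg 2)) gridStep))
  (.seq (.incr 11) (.seq (.setR 5 (.reg 11) (.ofNat (.lit 1))) (.setN 10 (.reg 11) (.reg 2))))

variable {ω : ℕ → ℝ} {k n : ℕ} {ε : ℝ}

/-- `L` and `μ` are binary logarithms rounded up, found by doubling because the machine has neither
logarithms nor rounding; register `3` ends with `L + 1`. -/
theorem sampleSize_ensures {L μ : ℕ} {s : State} (h1 : s.nat 1 0 = k) (h2 : s.real 2 0 = ε)
    (hd : s.draws = 0) (hL : k / ε ^ 2 ≤ 2 ^ L) (hL' : ∀ j < L, (2 : ℝ) ^ j < k / ε ^ 2)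
    (hμ : 33554432 * k * (L + 1) / ε ^ 2 ≤ 2 ^ μ)
    (hμ' : ∀ j < μ, (2 : ℝ) ^ j < 33554432 * k * (L + 1) / ε ^ 2) :
    sampleSize.Ensures ω s (40 * L + 30 * μ + 80) (fun s' => s'.nat 1 0 = k ∧ s'.real 2 0 = ε ∧
      s'.nat 2 0 = 2 ^ μ ∧ s'.draws = 0) := by
  let I : ℕ → State → Prop := fun f s => s.nat 1 0 = k ∧ s.real 2 0 = ε ∧ s.draws = 0 ∧ f ≤ L ∧
    s.nat 3 0 = L - f + 1 ∧ s.real 6 0 = 2 ^ (L - f)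
  let J : ℕ → State → Prop := fun f s => s.nat 1 0 = k ∧ s.real 2 0 = ε ∧ s.draws = 0 ∧ f ≤ μ ∧
    s.real 6 0 = 33554432 * k * (L + 1) / ε ^ 2 ∧ s.nat 2 0 = 2 ^ (μ - f)
  refine Ensures.mono (B := (9 + (L * (13 + 12 + 1) + (12 + 1))) +
    ((20 + 4) + (μ * (7 + 6 + 1) + (6 + 1)))) (Ensures.seq (Ensures.seq (M := I L)
    (Ensures.of_loopFree (by simp [LoopFree]) (by simp [bound, NExp.cost, RExp.cost]) ?_)
    (fun s' hs' => Ensures.loop I ?_ _ _ hs')) fun s₁ hs₁ => Ensures.seq (M := J μ)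
    (Ensures.of_loopFree (by simp [LoopFree]) (by simp [bound, NExp.cost, RExp.cost]) ?_)
    (fun s' hs' => Ensures.loop J ?_ _ _ hs')) (by omega) ?_
  · refine ⟨?_, ?_, ?_, le_rfl, ?_, ?_⟩ <;> simp [exec, NExp.eval, RExp.eval, h1, h2, hd]
  · rintro f s ⟨i1, i2, i3, hf, i4, i5⟩ hb
    simp only [BExp.eval, NExp.eval, RExp.eval, i1, i2, i5, ← pow_two] at hb
    have hf0 : 0 < f := by
      rcases Nat.eq_zero_or_pos f with rfl | h
      · exact absurd hL (not_le.2 hb)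
      · exact h
    refine ⟨hf0, Ensures.of_loopFree (by simp [LoopFree])
      (by simp [bound, NExp.cost, RExp.cost]) ⟨?_, ?_, ?_, by omega, ?_, ?_⟩⟩ <;>
      simp [exec, NExp.eval, RExp.eval, i1, i2, i3, i4, i5]
    · omega
    · rw [← two_mul, ← pow_succ']; congr 1; omega
  · obtain ⟨⟨f, i1, i2, i3, hf, i4, i5⟩, hb⟩ := hs₁
    simp only [BExp.eval, NExp.eval, RExp.eval, i1, i2, i5, ← pow_two] at hb
    -- By minimality of `L` the loop cannot stop before its `L`-th iteration.
    have hf0 : f = 0 := by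
      by_contra hcon
      exact hb (hL' _ (by omega))
    subst hf0
    refine ⟨?_, ?_, ?_, le_rfl, ?_, ?_⟩ <;>
      simp [exec, NExp.eval, RExp.eval, i1, i2, i3, i4, pow_two]
  · rintro f s ⟨i1, i2, i3, hf, i4, i5⟩ hb
    simp only [BExp.eval, NExp.eval, RExp.eval, i4, i5] at hb
    push_cast at hb
    have hf0 : 0 < f := by
      rcases Nat.eq_zero_or_pos f with rfl | h
      · exact absurd hμ (not_le.2 hb)
      · exact h
    refine ⟨hf0, Ensures.of_loopFree (by simp [LoopFree])
      (by simp [bound, NExp.cost, RExp.cost]) ⟨?_, ?_, ?_, by omega, ?_, ?_⟩⟩ <;>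
      simp [exec, NExp.eval, i1, i2, i3, i4, i5]
    rw [← two_mul, ← pow_succ']; congr 1; omega
  · rintro s' ⟨⟨f, i1, i2, i3, hf, i4, i5⟩, hb⟩
    simp only [BExp.eval, NExp.eval, RExp.eval, i4, i5] at hb
    push_cast at hb
    have hf0 : f = 0 := by
      by_contra hcon
      exact hb (hμ' _ (by omega))
    subst hf0
    exact ⟨i1, i2, i5, i3⟩

theorem drawSample_ensures {s : State} (h1 : s.nat 1 0 = k) (h2 : s.real 2 0 = ε)
    (hn : s.nat 2 0 = n) (hd : s.draws = 0) :
    drawSample.Ensures ω s (20 * n + 20) (fun s' => s'.Frame k ε n ∧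
      ∀ i < n, s'.real 3 i = ω i) := by
  let I : ℕ → State → Prop := fun f s => s.nat 1 0 = k ∧ s.real 2 0 = ε ∧ s.nat 2 0 = n ∧
    f ≤ n ∧ s.draws = n - f ∧ s.nat 4 0 = n - f ∧ ∀ i < n - f, s.real 3 i = ω i
  refine Ensures.mono (B := 4 + (n * (9 + 5 + 1) + (5 + 1))) (Ensures.seq (M := I n)
    (Ensures.of_loopFree (by simp [LoopFree]) (by simp [bound, NExp.cost]) ?_)
    (fun s' hs' => Ensures.loop I ?_ _ _ hs')) (by omega) ?_
  · refine ⟨?_, ?_, ?_, le_rfl, ?_, ?_, ?_⟩ <;> simp [exec, NExp.eval, h1, h2, hn, hd]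
  · rintro f s ⟨i1, i2, i3, hf, i4, i5, i6⟩ hb
    simp only [BExp.eval, NExp.eval, i3, i5] at hb
    refine ⟨by omega, Ensures.of_loopFree (by simp [LoopFree])
      (by simp [bound, NExp.cost, RExp.cost]) ⟨?_, ?_, ?_, by omega, ?_, ?_, ?_⟩⟩ <;>
      simp [exec, NExp.eval, i1, i2, i3, i4, i5]
    · omega
    · omega
    · intro i hi
      split_ifs with h
      · rw [h]
      · exact i6 i (by omega)
  · rintro s' ⟨⟨f, i1, i2, i3, hf, i4, i5, i6⟩, hb⟩
    simp only [BExp.eval, NExp.eval, i3, i5] at hb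
    have : n - f = n := by omega
    rw [this] at i4 i6
    exact ⟨⟨i1, i3, i2, i4⟩, i6⟩

theorem makeGrid_ensures {S : ℕ → ℝ} {s : State} (hs : s.Frame k ε n) (h3 : s.real 3 = S)
    (hS : SortedOn S 0 n) (hS01 : ∀ i < n, S i ∈ Ico (0 : ℝ) 1) :
    makeGrid.Ensures ω s (60 * n + 60) (fun s' => s'.Frame k ε n ∧
      IsGrid S n (s'.real 5) (s'.nat 10) (s'.nat 11 0)) := by
  let I : ℕ → State → Prop := fun f s => s.Frame k ε n ∧ s.real 3 = S ∧ n ≤ s.nat 4 0 + f ∧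
    GridInv S n (s.real 5) (s.nat 10) (s.nat 11 0) (s.nat 4 0)
  refine Ensures.mono (B := (16 + (n * (32 + 5 + 1) + (5 + 1))) + 18) (Ensures.seq (Ensures.seq
    (M := I n)
    (Ensures.of_loopFree (by simp [LoopFree]) (by simp [bound, NExp.cost, RExp.cost]) ?_)
    (fun s' hs' => Ensures.loop I ?_ _ _ hs')) (R := fun s' => s'.Frame k ε n ∧
      IsGrid S n (s'.real 5) (s'.nat 10) (s'.nat 11 0)) ?_) (by omega) (fun _ h => h)
  · obtain ⟨f1, f2, f3, f4⟩ := hs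
    refine ⟨⟨?_, ?_, ?_, ?_⟩, ?_, ?_, ?_, ?_, ?_, ?_, ?_, ?_, ?_, ?_, ?_⟩
    all_goals simp [exec, NExp.eval, RExp.eval, f1, f2, f3, f4]
    · funext x; simp [h3]
    · intro a b hab hb; omega
    · exact fun i hi => (hS01 i hi).1
  · rintro f s ⟨⟨f1, f2, f3, f4⟩, i3, hf, hG⟩ hb
    simp only [BExp.eval, NExp.eval, f2] at hb
    refine ⟨by omega, ?_⟩
    refine (Ensures.ite (B := 24) (fun hc => Ensures.of_loopFree (by simp [LoopFree])
      (by simp [bound, NExp.cost, RExp.cost]) ?_) (fun hc => Ensures.of_loopFree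
      (by simp [LoopFree]) (by simp [bound, NExp.cost, RExp.cost]) ?_)).mono
      (by simp [BExp.cost, NExp.cost, RExp.cost]) fun _ h => h
    · simp only [BExp.eval, NExp.eval, RExp.eval, i3] at hc
      refine ⟨⟨?_, ?_, ?_, ?_⟩, ?_, ?_, ?_⟩
      pick_goal 7
      · have := hG.new (X' := fun x => if x = s.nat 11 0 + 1 then S (s.nat 4 0) else s.real 5 x)
          (N' := fun x => if x = s.nat 11 0 + 1 then s.nat 4 0 else s.nat 10 x)
          hS hb (hS01 _ hb).2 hc (fun x => rfl) (fun x => rfl)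
        convert this using 1 <;> simp [exec, NExp.eval, RExp.eval, i3]
        all_goals funext x; simp
      all_goals simp [exec, NExp.eval, RExp.eval, f1, f2, f3, f4]
      · funext x; simp [i3]
      · omega
    · simp only [BExp.eval, NExp.eval, RExp.eval, i3] at hc
      refine ⟨⟨?_, ?_, ?_, ?_⟩, ?_, ?_, ?_⟩
      pick_goal 7
      · have := hG.same hb hc
        convert this using 1 <;> simp [exec, NExp.eval]
        all_goals funext x; simp
      all_goals simp [exec, NExp.eval, f1, f2, f3, f4, i3]
      · omega
  · rintro s₁ ⟨⟨f, ⟨f1, f2, f3, f4⟩, i3, -, hG⟩, hb⟩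
    simp only [BExp.eval, NExp.eval, f2] at hb
    have hi : s₁.nat 4 0 = n := le_antisymm hG.i_le (not_lt.1 hb)
    rw [hi] at hG
    refine Ensures.of_loopFree (by simp [LoopFree]) (by simp [bound, NExp.cost, RExp.cost])
      ⟨⟨?_, ?_, ?_, ?_⟩, ?_⟩
    pick_goal 5
    · have := hG.isGrid (X' := fun x => if x = s₁.nat 11 0 + 1 then 1 else s₁.real 5 x)
        (N' := fun x => if x = s₁.nat 11 0 + 1 then n else s₁.nat 10 x)
        (fun i hi => (hS01 i hi).2) (fun x => rfl) (fun x => rfl)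
      convert this using 1 <;> simp [exec, NExp.eval, RExp.eval, f2]
      all_goals funext x; simp
    all_goals simp [exec, NExp.eval, f1, f2, f3, f4]

end Prog

/-! ## Greedy partitioning of the grid -/

/-- On the grid points up to `X v`, the empirical distribution function is within `τ` of a line
through its value at `X u`. -/
def Feasible (X : ℕ → ℝ) (N : ℕ → ℕ) (n : ℕ) (τ : ℝ) (u v : ℕ) : Prop :=
  ∃ x : ℝ, ∀ j, u < j → j ≤ v → |((N j : ℝ) - N u) / n - x * (X j - X u)| ≤ τ

/-- A partition of the grid into `l` feasible pieces none of which, but the last one, can be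
extended. -/
structure IsGreedy (X : ℕ → ℝ) (N : ℕ → ℕ) (n m : ℕ) (τ : ℝ) (l : ℕ) (v : ℕ → ℕ) : Prop where
  zero : v 0 = 0
  last : v l = m
  lt : ∀ i < l, v i < v (i + 1)
  feasible : ∀ i < l, Feasible X N n τ (v i) (v (i + 1))
  maximal : ∀ i, i + 1 < l → ¬ Feasible X N n τ (v i) (v (i + 1) + 1)

/-- `b` and `c` are the breakpoints and heights of the histogram with the `l` pieces that `v`
describes and with the empirical weights. -/
structure IsFlattening (X : ℕ → ℝ) (N : ℕ → ℕ) (n l : ℕ) (v : ℕ → ℕ) (b c : ℕ → ℝ) : Prop where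
  break_eq : ∀ i ≤ l, b i = X (v i)
  height_eq : ∀ i < l,
    c i = ((N (v (i + 1)) : ℝ) - N (v i)) / n / (X (v (i + 1)) - X (v i))

/-- The state of the greedy algorithm: `l` pieces are complete, the current one is `[u, j)`, and
`[lo, hi]` are its feasible slopes. -/
structure GreedyInv (X : ℕ → ℝ) (N : ℕ → ℕ) (n m : ℕ) (τ : ℝ) (b c : ℕ → ℝ) (l u j : ℕ)
    (lo hi : ℝ) (v : ℕ → ℕ) : Prop where
  zero : v 0 = 0
  last : v l = u
  lt : ∀ i < l, v i < v (i + 1)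
  feasible : ∀ i < l, Feasible X N n τ (v i) (v (i + 1))
  maximal : ∀ i < l, ¬ Feasible X N n τ (v i) (v (i + 1) + 1)
  flat : IsFlattening X N n l v b c
  u_le : u ≤ j
  j_le : j ≤ m
  u_lt : u < m
  slope : u < j → lo ≤ hi ∧ ∀ x, (lo ≤ x ∧ x ≤ hi ↔
    ∀ j', u < j' → j' ≤ j → |((N j' : ℝ) - N u) / n - x * (X j' - X u)| ≤ τ)

/-- Each grid point confines the slope to an interval. The feasible slopes of a piece are thus an
interval, and two registers and a constant number of operations per grid point suffice to maintain
it. -/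
theorem abs_sub_mul_le_iff {D x d τ : ℝ} (hd : 0 < d) :
    |D - x * d| ≤ τ ↔ (D - τ) / d ≤ x ∧ x ≤ (D + τ) / d := by
  rw [abs_le, div_le_iff₀ hd, le_div_iff₀ hd]
  constructor <;> rintro ⟨h₁, h₂⟩ <;> constructor <;> linarith

section Greedy

variable {X : ℕ → ℝ} {N : ℕ → ℕ} {n m : ℕ} {τ : ℝ} {b c : ℕ → ℝ} {l u j : ℕ} {lo hi : ℝ}
  {v : ℕ → ℕ}

/-- The guard `u < j` is there because in an empty piece `lo` and `hi` are left over from the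
previous piece and carry no information. -/
theorem GreedyInv.extend (h : GreedyInv X N n m τ b c l u j lo hi v) (hX : X u < X (j + 1))
    (hj : j < m) {lo' hi' : ℝ} (hle : lo' ≤ hi')
    (hs : ∀ x, (lo' ≤ x ∧ x ≤ hi') ↔ ((u < j → lo ≤ x ∧ x ≤ hi) ∧
      (((N (j + 1) : ℝ) - N u) / n - τ) / (X (j + 1) - X u) ≤ x ∧
        x ≤ (((N (j + 1) : ℝ) - N u) / n + τ) / (X (j + 1) - X u))) :
    GreedyInv X N n m τ b c l u (j + 1) lo' hi' v := by
  refine ⟨h.zero, h.last, h.lt, h.feasible, h.maximal, h.flat, h.u_le.trans (Nat.le_succ _), hj,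
    h.u_lt, fun _ => ⟨hle, fun x => ?_⟩⟩
  rw [hs, ← abs_sub_mul_le_iff (sub_pos.2 hX)]
  constructor
  · rintro ⟨h1, h2⟩ j' hj' hj''
    rcases Nat.le_succ_iff.1 hj'' with hj'' | rfl
    · exact ((h.slope (by omega)).2 x).1 (h1 (by omega)) j' hj' hj''
    · exact h2
  · intro h1
    exact ⟨fun huj => ((h.slope huj).2 x).2 fun j' hj' hj'' => h1 j' hj' (by omega),
      h1 _ (Nat.lt_succ_of_le h.u_le) le_rfl⟩

theorem IsFlattening.snoc {b' c' : ℕ → ℝ} (h : IsFlattening X N n l v b c)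
    (hb : ∀ x, b' x = if x = l + 1 then X j else b x)
    (hc : ∀ x, c' x = if x = l then ((N j : ℝ) - N (v l)) / n / (X j - X (v l)) else c x) :
    IsFlattening X N n (l + 1) (Function.update v (l + 1) j) b' c' := by
  have e : ∀ i ≤ l, Function.update v (l + 1) j i = v i := fun i hi => by
    rw [Function.update_of_ne (by omega)]
  have e1 : Function.update v (l + 1) j (l + 1) = j := Function.update_self ..
  constructor
  · intro i hi
    rw [hb]
    split_ifs with h1
    · rw [h1, e1]
    · rw [e i (by omega), h.break_eq i (by omega)]
  · intro i hi
    rw [hc]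
    split_ifs with h1
    · rw [h1, e1, e l le_rfl]
    · rw [e i (by omega), e (i + 1) (by omega), h.height_eq i (by omega)]

theorem GreedyInv.feasible_current (h : GreedyInv X N n m τ b c l u j lo hi v) (huj : u < j) :
    Feasible X N n τ u j :=
  ⟨lo, ((h.slope huj).2 lo).1 ⟨le_rfl, (h.slope huj).1⟩⟩

/-- The slopes allowed by the next grid point are disjoint from `[lo, hi]`. So no line serves the
piece extended by one cell, which is the maximality of the completed piece. -/
theorem GreedyInv.close (h : GreedyInv X N n m τ b c l u j lo hi v) (huj : u < j)
    (hX : X u < X (j + 1)) (hj : j < m)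
    (hcl : ¬ ((((N (j + 1) : ℝ) - N u) / n - τ) / (X (j + 1) - X u) ≤ hi ∧
        lo ≤ (((N (j + 1) : ℝ) - N u) / n + τ) / (X (j + 1) - X u)))
    {b' c' : ℕ → ℝ} (hb : ∀ x, b' x = if x = l + 1 then X j else b x)
    (hc : ∀ x, c' x = if x = l then ((N j : ℝ) - N u) / n / (X j - X u) else c x) :
    GreedyInv X N n m τ b' c' (l + 1) j j lo hi (Function.update v (l + 1) j) := by
  have e : ∀ i ≤ l, Function.update v (l + 1) j i = v i := fun i hi => by
    rw [Function.update_of_ne (by omega)]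
  have e1 : Function.update v (l + 1) j (l + 1) = j := Function.update_self ..
  refine ⟨by rw [e 0 (Nat.zero_le _), h.zero], e1, ?_, ?_, ?_,
    h.flat.snoc hb (by rw [h.last]; exact hc), le_rfl, h.j_le, hj,
    fun hlt => absurd hlt (lt_irrefl _)⟩
  · intro i hi
    rcases Nat.lt_succ_iff_lt_or_eq.1 hi with hi | rfl
    · rw [e i hi.le, e (i + 1) hi]; exact h.lt i hi
    · rw [e i le_rfl, e1, h.last]; exact huj
  · intro i hi
    rcases Nat.lt_succ_iff_lt_or_eq.1 hi with hi | rfl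
    · rw [e i hi.le, e (i + 1) hi]; exact h.feasible i hi
    · rw [e i le_rfl, e1, h.last]; exact h.feasible_current huj
  · intro i hi
    rcases Nat.lt_succ_iff_lt_or_eq.1 hi with hi | rfl
    · rw [e i hi.le, e (i + 1) hi]; exact h.maximal i hi
    · rw [e i le_rfl, e1, h.last]
      rintro ⟨x, hx⟩
      have h1 := ((h.slope huj).2 x).2 fun j' hj' hj'' => hx j' hj' (by omega)
      have h2 := (abs_sub_mul_le_iff (sub_pos.2 hX)).1 (hx (j + 1) (by omega) le_rfl)
      exact hcl ⟨h2.1.trans h1.2, h1.1.trans h2.2⟩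

/-- The piece still open at the end is nonempty because `u < m`; it is the only one for which
maximality is not claimed. -/
theorem GreedyInv.finish (h : GreedyInv X N n m τ b c l u m lo hi v)
    {b' c' : ℕ → ℝ} (hb : ∀ x, b' x = if x = l + 1 then X m else b x)
    (hc : ∀ x, c' x = if x = l then ((N m : ℝ) - N u) / n / (X m - X u) else c x) :
    ∃ v', IsGreedy X N n m τ (l + 1) v' ∧ IsFlattening X N n (l + 1) v' b' c' := by
  have e : ∀ i ≤ l, Function.update v (l + 1) m i = v i := fun i hi => by
    rw [Function.update_of_ne (by omega)]
  have e1 : Function.update v (l + 1) m (l + 1) = m := Function.update_self ..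
  refine ⟨Function.update v (l + 1) m, ⟨by rw [e 0 (Nat.zero_le _), h.zero], e1, ?_, ?_, ?_⟩,
    h.flat.snoc hb (by rw [h.last]; exact hc)⟩
  · intro i hi
    rcases Nat.lt_succ_iff_lt_or_eq.1 hi with hi | rfl
    · rw [e i hi.le, e (i + 1) hi]; exact h.lt i hi
    · rw [e i le_rfl, e1, h.last]; exact h.u_lt
  · intro i hi
    rcases Nat.lt_succ_iff_lt_or_eq.1 hi with hi | rfl
    · rw [e i hi.le, e (i + 1) hi]; exact h.feasible i hi
    · rw [e i le_rfl, e1, h.last]; exact h.feasible_current h.u_lt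
  · intro i hi
    rw [e i (by omega), e (i + 1) (by omega)]
    exact h.maximal i (by omega)

end Greedy

/-! ### The greedy step as a program. -/

namespace Prog

/-- The empirical weight of the part of the grid from the cell in register `12` to the cell `i`. -/
abbrev weightExp (i : NExp) : RExp :=
  .div (.sub (.ofNat (.get 10 i)) (.ofNat (.get 10 (.reg 12)))) (.ofNat (.reg 2))

abbrev lengthExp (i : NExp) : RExp := .sub (.get 5 i) (.get 5 (.reg 12))

def slopeBounds : Prog :=
  .seq (.regR 10 (.div (.sub (weightExp (.add (.reg 5) (.lit 1))) (.reg 7))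
      (lengthExp (.add (.reg 5) (.lit 1)))))
    (.regR 11 (.div (.add (weightExp (.add (.reg 5) (.lit 1))) (.reg 7))
      (lengthExp (.add (.reg 5) (.lit 1)))))

def closePiece : Prog :=
  .seq (.setR 1 (.reg 0) (.div (weightExp (.reg 5)) (lengthExp (.reg 5))))
    (.seq (.incr 0) (.seq (.setR 0 (.reg 0) (.get 5 (.reg 5))) (.regN 12 (.reg 5))))

def extendPiece : Prog :=
  .seq (.ite (.ltN (.reg 12) (.reg 5))
      (.seq (.ite (.ltR (.reg 8) (.reg 10)) (.regR 8 (.reg 10)) .skip)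
        (.ite (.ltR (.reg 11) (.reg 9)) (.regR 9 (.reg 11)) .skip))
      (.seq (.regR 8 (.reg 10)) (.regR 9 (.reg 11))))
    (.incr 5)

def greedyStep : Prog :=
  .seq slopeBounds
    (.ite (.and (.ltN (.reg 12) (.reg 5))
        (.not (.and (.not (.ltR (.reg 9) (.reg 10))) (.not (.ltR (.reg 11) (.reg 8))))))
      closePiece extendPiece)

def greedy : Prog :=
  .seq (.seq (.seq (.regN 0 (.lit 0)) (.seq (.regN 12 (.lit 0)) (.seq (.regN 5 (.lit 0))
      (.setR 0 (.lit 0) (.get 5 (.lit 0))))))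
    (.loop (.ltN (.reg 5) (.reg 11)) greedyStep)) closePiece

variable {ω : ℕ → ℝ} {k n : ℕ} {ε : ℝ}

/-- The memory during the search for a partition of the grid. -/
structure _root_.State.HasGrid (X : ℕ → ℝ) (N : ℕ → ℕ) (m : ℕ) (τ : ℝ) (s : State) : Prop where
  hX : s.real 5 = X
  hN : s.nat 10 = N
  hm : s.nat 11 0 = m
  hτ : s.real 7 0 = τ

/-- A step either extends the piece or closes it without moving `j`. The potential `2 * (m - j)`,
plus `1` if the current piece is nonempty, falls in both cases. -/
theorem greedyStep_ensures {X : ℕ → ℝ} {N : ℕ → ℕ} {m : ℕ} {τ : ℝ} {s : State} {v : ℕ → ℕ}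
    (hτ0 : 0 < τ) (hX : ∀ a b, a < b → b ≤ m → X a < X b)
    (hs : s.Frame k ε n) (hg : s.HasGrid X N m τ)
    (hv : GreedyInv X N n m τ (s.real 0) (s.real 1) (s.nat 0 0) (s.nat 12 0) (s.nat 5 0)
      (s.real 8 0) (s.real 9 0) v) (hj : s.nat 5 0 < m) :
    greedyStep.Ensures ω s 200 (fun s' => s'.Frame k ε n ∧ s'.HasGrid X N m τ ∧
      (∃ v', GreedyInv X N n m τ (s'.real 0) (s'.real 1) (s'.nat 0 0) (s'.nat 12 0) (s'.nat 5 0)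
      (s'.real 8 0) (s'.real 9 0) v') ∧
      2 * (m - s'.nat 5 0) + (if s'.nat 12 0 < s'.nat 5 0 then 1 else 0) <
        2 * (m - s.nat 5 0) + (if s.nat 12 0 < s.nat 5 0 then 1 else 0)) := by
  have hXu : X (s.nat 12 0) < X (s.nat 5 0 + 1) := hX _ _ (Nat.lt_succ_of_le hv.u_le) hj
  have hd := sub_pos.2 hXu
  set lo' := (((N (s.nat 5 0 + 1) : ℝ) - N (s.nat 12 0)) / n - τ) /
    (X (s.nat 5 0 + 1) - X (s.nat 12 0)) with hlo'
  set hi' := (((N (s.nat 5 0 + 1) : ℝ) - N (s.nat 12 0)) / n + τ) /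
    (X (s.nat 5 0 + 1) - X (s.nat 12 0)) with hhi'
  -- A single constraint can always be met, so every piece can take its first cell, however heavy
  -- the atom in it.
  have hlohi : lo' ≤ hi' := (div_le_div_iff_of_pos_right hd).2 (by linarith)
  obtain ⟨f1, f2, f3, f4⟩ := hs
  obtain ⟨g1, g2, g3, g4⟩ := hg
  have key := Ensures.seq (ω := ω) (P := slopeBounds) (s := s) (B₁ := 80) (M := fun s' =>
    s'.Frame k ε n ∧ s'.HasGrid X N m τ ∧ s'.real 0 = s.real 0 ∧ s'.real 1 = s.real 1 ∧
    s'.nat 0 0 = s.nat 0 0 ∧ s'.nat 12 0 = s.nat 12 0 ∧ s'.nat 5 0 = s.nat 5 0 ∧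
    s'.real 8 0 = s.real 8 0 ∧ s'.real 9 0 = s.real 9 0 ∧ s'.real 10 0 = lo' ∧
    s'.real 11 0 = hi')
    (Q := .ite (.and (.ltN (.reg 12) (.reg 5))
        (.not (.and (.not (.ltR (.reg 9) (.reg 10))) (.not (.ltR (.reg 11) (.reg 8))))))
      closePiece extendPiece) (B₂ := 120)
    (R := fun s' => s'.Frame k ε n ∧ s'.HasGrid X N m τ ∧
      (∃ v', GreedyInv X N n m τ (s'.real 0) (s'.real 1) (s'.nat 0 0) (s'.nat 12 0) (s'.nat 5 0)
      (s'.real 8 0) (s'.real 9 0) v') ∧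
      2 * (m - s'.nat 5 0) + (if s'.nat 12 0 < s'.nat 5 0 then 1 else 0) <
        2 * (m - s.nat 5 0) + (if s.nat 12 0 < s.nat 5 0 then 1 else 0))
    (Ensures.of_loopFree (by simp [LoopFree, slopeBounds])
      (by simp [slopeBounds, bound, NExp.cost, RExp.cost]) ?_) ?_
  · exact key.mono (by norm_num) fun _ h => h
  · refine ⟨⟨?_, ?_, ?_, ?_⟩, ⟨?_, ?_, ?_, ?_⟩, ?_, ?_, ?_, ?_, ?_, ?_, ?_, ?_, ?_⟩
    all_goals simp [slopeBounds, exec, NExp.eval, RExp.eval, f1, f2, f3, f4, g1, g2, g3, g4,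
      hlo', hhi']
    all_goals funext x; simp [g1, g2]
  clear f1 f2 f3 f4 g1 g2 g3 g4
  rintro s₁ ⟨⟨f1, f2, f3, f4⟩, ⟨g1, g2, g3, g4⟩, e1, e2, e3, e4, e5, e6, e7, e8, e9⟩
  refine (Ensures.ite (B := 70) (fun hc => Ensures.of_loopFree (by simp [LoopFree, closePiece])
      (by simp [closePiece, bound, NExp.cost, RExp.cost]) ?_) (fun hc => Ensures.of_loopFree
      (by simp [extendPiece, LoopFree])
      (by simp [extendPiece, BExp.cost, bound, NExp.cost, RExp.cost]) ?_)).mono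
      (by simp [BExp.cost, NExp.cost, RExp.cost]) fun _ h => h
  · simp only [BExp.eval, NExp.eval, RExp.eval, e4, e5, e6, e7, e8, e9, not_lt] at hc
    refine ⟨⟨?_, ?_, ?_, ?_⟩, ⟨?_, ?_, ?_, ?_⟩,
      ⟨Function.update v (s.nat 0 0 + 1) (s.nat 5 0), ?_⟩, ?_⟩
    pick_goal 9
    · have := hv.close hc.1 hXu hj hc.2
        (b' := fun x => if x = s.nat 0 0 + 1 then X (s.nat 5 0) else s.real 0 x)
        (c' := fun x => if x = s.nat 0 0 then ((N (s.nat 5 0) : ℝ) - N (s.nat 12 0)) / n /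
          (X (s.nat 5 0) - X (s.nat 12 0)) else s.real 1 x) (fun x => rfl) (fun x => rfl)
      convert this using 1 <;>
        simp [closePiece, exec, NExp.eval, RExp.eval, e3, e4, e5, e6, e7]
      all_goals funext x; simp [g1, g2, f2, e1, e2]
    all_goals simp [closePiece, exec, NExp.eval, RExp.eval, f1, f2, f3, f4, g2, g3, g4, e5, hc.1]
    all_goals funext x; simp [g1, g2]
  · simp only [BExp.eval, NExp.eval, RExp.eval, e4, e5, e6, e7, e8, e9, not_lt] at hc
    by_cases huj : s.nat 12 0 < s.nat 5 0
    · have hc' := not_not.1 (not_and.1 hc huj)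
      have hv' := hv.extend hXu hj (lo' := max (s.real 8 0) lo') (hi' := min (s.real 9 0) hi')
        (max_le (le_min (hv.slope huj).1 hc'.2) (le_min hc'.1 hlohi)) (fun x => by
          rw [max_le_iff, le_min_iff]
          constructor
          · rintro ⟨⟨h1, h2⟩, h3, h4⟩
            exact ⟨fun _ => ⟨h1, h3⟩, h2, h4⟩
          · rintro ⟨h1, h2, h3⟩
            exact ⟨⟨(h1 huj).1, h2⟩, (h1 huj).2, h3⟩)
      refine ⟨⟨?_, ?_, ?_, ?_⟩, ⟨?_, ?_, ?_, ?_⟩, ⟨v, ?_⟩, ?_⟩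
      pick_goal 9
      · by_cases h1 : s.real 8 0 < lo' <;> by_cases h2 : hi' < s.real 9 0
        · rw [max_eq_right h1.le, min_eq_right h2.le] at hv'
          convert hv' using 1 <;> simp [extendPiece, exec, NExp.eval, RExp.eval, BExp.eval,
            e3, e4, e5, e6, e7, e8, e9, huj, h1, h2]
          all_goals funext x; simp [e1, e2]
        · rw [max_eq_right h1.le, min_eq_left (not_lt.1 h2)] at hv'
          convert hv' using 1 <;> simp [extendPiece, exec, NExp.eval, RExp.eval, BExp.eval,
            e3, e4, e5, e6, e7, e8, e9, huj, h1, h2]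
          all_goals funext x; simp [e1, e2]
        · rw [max_eq_left (not_lt.1 h1), min_eq_right h2.le] at hv'
          convert hv' using 1 <;> simp [extendPiece, exec, NExp.eval, RExp.eval, BExp.eval,
            e3, e4, e5, e6, e7, e8, e9, huj, h1, h2]
          all_goals funext x; simp [e1, e2]
        · rw [max_eq_left (not_lt.1 h1), min_eq_left (not_lt.1 h2)] at hv'
          convert hv' using 1 <;> simp [extendPiece, exec, NExp.eval, RExp.eval, BExp.eval,
            e1, e2, e3, e4, e5, e6, e7, e8, e9, huj, h1, h2]
      all_goals by_cases h1 : s.real 8 0 < lo' <;> by_cases h2 : hi' < s.real 9 0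
      all_goals simp [extendPiece, exec, NExp.eval, RExp.eval, BExp.eval, f1, f2, f3, f4, g1, g2,
        g3, g4, e4, e5, e6, e7, e8, e9, huj, h1, h2]
      all_goals first | (funext x; simp [g1, g2]) | (split_ifs <;> omega)
    · have hv' := hv.extend hXu hj (lo' := lo') (hi' := hi') hlohi (fun x =>
        ⟨fun h => ⟨fun h' => absurd h' huj, h⟩, fun h => h.2⟩)
      refine ⟨⟨?_, ?_, ?_, ?_⟩, ⟨?_, ?_, ?_, ?_⟩, ⟨v, ?_⟩, ?_⟩
      pick_goal 9
      · convert hv' using 1 <;> simp [extendPiece, exec, NExp.eval, RExp.eval, BExp.eval,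
            e3, e4, e5, e8, e9, huj]
        all_goals funext x; simp [e1, e2]
      all_goals simp [extendPiece, exec, NExp.eval, RExp.eval, BExp.eval, f1, f2, f3, f4, g2,
        g3, g4, e4, e5, e8, e9, huj]
      all_goals first | (funext x; simp [g1, g2]) | (split_ifs <;> omega)

end Prog

/-! ## The whole program -/

theorem IsGrid.pos {S : ℕ → ℝ} {n m : ℕ} {X : ℕ → ℝ} {N : ℕ → ℕ} (h : IsGrid S n X N m) :
    0 < m := by
  rcases Nat.eq_zero_or_pos m with hm | hm
  · have h0 := h.zero
    have h1 := h.one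
    rw [hm, h0] at h1
    norm_num at h1
  · exact hm

/-- Empirical weights differ by at most `1`, so the slope `0` is feasible everywhere once `1 ≤ τ`,
and the first piece could not have stopped early. -/
theorem IsGreedy.length_le_one {X : ℕ → ℝ} {N : ℕ → ℕ} {n m : ℕ} {τ : ℝ} {l : ℕ} {v : ℕ → ℕ}
    (h : IsGreedy X N n m τ l v) (hN : ∀ j ≤ m, N j ≤ n) (hτ : 1 ≤ τ) : l ≤ 1 := by
  by_contra hcon
  have hle : ∀ d, d ≤ l → v (l - d) ≤ m := by
    intro d
    induction d with
    | zero => intro _; rw [Nat.sub_zero, h.last]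
    | succ d ih =>
      intro hd
      have := h.lt (l - (d + 1)) (by omega)
      rw [show l - (d + 1) + 1 = l - d by omega] at this
      exact this.le.trans (ih (by omega))
  have hle' : ∀ i ≤ l, v i ≤ m := fun i hi => by
    have := hle (l - i) (by omega)
    rwa [show l - (l - i) = i by omega] at this
  refine h.maximal 0 (by omega) ⟨0, fun j _ hj => ?_⟩
  have h1 : v 1 < v 2 := h.lt 1 (by omega)
  have h2 := hle' 2 (by omega)
  have hj' : N j ≤ n := hN j (by simp at hj; omega)
  have h0 : N (v 0) ≤ n := hN _ (hle' 0 (by omega))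
  rw [zero_mul, sub_zero]
  refine le_trans ?_ hτ
  rw [abs_div, Nat.abs_cast]
  refine div_le_one_of_le₀ ?_ (Nat.cast_nonneg _)
  have a1 : (N j : ℝ) ≤ n := by exact_mod_cast hj'
  have a2 : (N (v 0) : ℝ) ≤ n := by exact_mod_cast h0
  have a3 : (0 : ℝ) ≤ N j := Nat.cast_nonneg _
  have a4 : (0 : ℝ) ≤ N (v 0) := Nat.cast_nonneg _
  rw [abs_le]
  constructor <;> linarith

/-! ### The doubling search and the whole learner. -/

namespace Prog

/-- Double `τ` until the greedy partition has at most `4 * k` pieces. -/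
def search : Prog :=
  .seq (.seq (.regN 0 (.add (.add (.add (.reg 1) (.reg 1)) (.add (.reg 1) (.reg 1))) (.lit 1)))
      (.regR 7 (.div (.reg 2) (.mul (.ofNat (.lit 512)) (.ofNat (.reg 1))))))
    (.loop (.ltN (.add (.add (.reg 1) (.reg 1)) (.add (.reg 1) (.reg 1))) (.reg 0))
      (.seq (.regR 7 (.add (.reg 7) (.reg 7))) greedy))

def outputUniform : Prog :=
  .seq (.regN 0 (.lit 1)) (.seq (.setR 0 (.lit 0) (.ofNat (.lit 0)))
    (.seq (.setR 0 (.lit 1) (.ofNat (.lit 1))) (.setR 1 (.lit 0) (.ofNat (.lit 1)))))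

/-- The learning algorithm. -/
def learn : Prog :=
  .seq (.seq (.regN 1 (.reg 0)) (.regR 2 (.reg 0)))
    (.ite (.ltR (.reg 2) (.ofNat (.lit 1)))
      (.seq sampleSize (.seq drawSample (.seq mergeSort (.seq makeGrid search))))
      outputUniform)

variable {ω : ℕ → ℝ} {k n : ℕ} {ε : ℝ}

/-- The potential of `greedyStep_ensures` starts at `2 * m`, whence the linear running time. -/
theorem greedy_ensures {X : ℕ → ℝ} {N : ℕ → ℕ} {m : ℕ} {τ : ℝ} {s : State}
    (hτ0 : 0 < τ) (hX : ∀ a b, a < b → b ≤ m → X a < X b) (hm : 0 < m)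
    (hs : s.Frame k ε n) (hg : s.HasGrid X N m τ) :
    greedy.Ensures ω s (420 * m + 100) (fun s' => s'.Frame k ε n ∧ s'.HasGrid X N m τ ∧
      ∃ v, IsGreedy X N n m τ (s'.nat 0 0) v ∧
        IsFlattening X N n (s'.nat 0 0) v (s'.real 0) (s'.real 1)) := by
  let I : ℕ → State → Prop := fun f s => s.Frame k ε n ∧ s.HasGrid X N m τ ∧
    (∃ v, GreedyInv X N n m τ (s.real 0) (s.real 1) (s.nat 0 0) (s.nat 12 0) (s.nat 5 0)
      (s.real 8 0) (s.real 9 0) v) ∧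
    2 * (m - s.nat 5 0) + (if s.nat 12 0 < s.nat 5 0 then 1 else 0) ≤ f
  refine Ensures.mono (B := (16 + (2 * m * (200 + 5 + 1) + (5 + 1))) + 60)
    (Ensures.seq (Ensures.seq (M := I (2 * m))
    (Ensures.of_loopFree (by simp [LoopFree]) (by simp [bound, NExp.cost, RExp.cost]) ?_)
    (fun s' hs' => Ensures.loop I ?_ _ _ hs')) (R := fun s' => s'.Frame k ε n ∧
      s'.HasGrid X N m τ ∧ ∃ v, IsGreedy X N n m τ (s'.nat 0 0) v ∧
        IsFlattening X N n (s'.nat 0 0) v (s'.real 0) (s'.real 1)) ?_) (by omega) (fun _ h => h)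
  · obtain ⟨f1, f2, f3, f4⟩ := hs
    obtain ⟨g1, g2, g3, g4⟩ := hg
    refine ⟨⟨?_, ?_, ?_, ?_⟩, ⟨?_, ?_, ?_, ?_⟩, ⟨fun _ => 0, ⟨rfl, ?_, ?_, ?_, ?_, ⟨?_, ?_⟩, ?_, ?_,
      ?_, ?_⟩⟩, ?_⟩
    all_goals simp [exec, NExp.eval, RExp.eval, f1, f2, f3, f4, g1, g3, g4, hm]
    all_goals funext x; simp [g1, g2]
  · rintro f s ⟨hf, hg, ⟨v, hv⟩, hle⟩ hb
    simp only [BExp.eval, NExp.eval, hg.hm] at hb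
    refine ⟨by omega, (greedyStep_ensures hτ0 hX hf hg hv hb).mono le_rfl ?_⟩
    rintro s' ⟨h1, h2, h3, h4⟩
    exact ⟨h1, h2, h3, by omega⟩
  · rintro s₁ ⟨⟨f, ⟨f1, f2, f3, f4⟩, ⟨g1, g2, g3, g4⟩, ⟨v, hv⟩, -⟩, hb⟩
    simp only [BExp.eval, NExp.eval, g3] at hb
    have hj : s₁.nat 5 0 = m := le_antisymm hv.j_le (not_lt.1 hb)
    rw [hj] at hv
    refine Ensures.of_loopFree (by simp [LoopFree, closePiece])
      (by simp [closePiece, bound, NExp.cost, RExp.cost])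
      ⟨⟨?_, ?_, ?_, ?_⟩, ⟨?_, ?_, ?_, ?_⟩, ?_⟩
    pick_goal 9
    · have := hv.finish
        (b' := fun x => if x = s₁.nat 0 0 + 1 then X m else s₁.real 0 x)
        (c' := fun x => if x = s₁.nat 0 0 then ((N m : ℝ) - N (s₁.nat 12 0)) / n /
          (X m - X (s₁.nat 12 0)) else s₁.real 1 x) (fun x => rfl) (fun x => rfl)
      convert this using 4 <;>
        simp [closePiece, exec, NExp.eval, RExp.eval]
      all_goals funext x; simp [g1, g2, f2, hj]
    all_goals simp [closePiece, exec, NExp.eval, RExp.eval, f1, f2, f3, f4, g3, g4]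
    all_goals funext x; simp [g1, g2]

/-- The final alternative is what the analysis needs: `τ` is the first threshold tried, or half of
it still gave more than `4 * k` pieces. -/
theorem search_ensures {S X : ℕ → ℝ} {N : ℕ → ℕ} {m J : ℕ} {s : State}
    (hk : 1 ≤ k) (hε : 0 < ε) (hJ0 : 0 < J) (hJ : 512 * k / ε ≤ 2 ^ J)
    (hs : s.Frame k ε n) (hX : s.real 5 = X) (hN : s.nat 10 = N) (hm : s.nat 11 0 = m)
    (hG : IsGrid S n X N m) :
    search.Ensures ω s (J * (420 * m + 130) + 60) (fun s' => s'.draws = n ∧ s'.nat 0 0 ≤ 4 * k ∧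
      ∃ τ v, 0 < τ ∧ IsGreedy X N n m τ (s'.nat 0 0) v ∧
        IsFlattening X N n (s'.nat 0 0) v (s'.real 0) (s'.real 1) ∧
        (τ = ε / (256 * k) ∨ ∃ l' v', 4 * k < l' ∧ IsGreedy X N n m (τ / 2) l' v')) := by
  have hk0 : (0 : ℝ) < k := by exact_mod_cast hk
  have hm0 := hG.pos
  let τ : ℕ → ℝ := fun f => 2 ^ (J - f) * (ε / (512 * k))
  have hτ : ∀ f, 0 < τ f := fun f => by positivity
  let I : ℕ → State → Prop := fun f s => s.Frame k ε n ∧ s.HasGrid X N m (τ f) ∧ f ≤ J ∧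
    ((f = J ∧ s.nat 0 0 = 4 * k + 1) ∨ (f < J ∧ ∃ v, IsGreedy X N n m (τ f) (s.nat 0 0) v ∧
        IsFlattening X N n (s.nat 0 0) v (s.real 0) (s.real 1) ∧
        (τ f = ε / (256 * k) ∨ ∃ l' v', 4 * k < l' ∧ IsGreedy X N n m (τ f / 2) l' v')))
  refine Ensures.mono (B := 30 + (J * ((9 + (420 * m + 100)) + 14 + 1) + (14 + 1)))
    (Ensures.seq (M := I J)
    (Ensures.of_loopFree (by simp [LoopFree]) (by simp [bound, NExp.cost, RExp.cost]) ?_)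
    (fun s' hs' => Ensures.loop I ?_ _ _ hs')) ?_ ?_
  · obtain ⟨f1, f2, f3, f4⟩ := hs
    refine ⟨⟨?_, ?_, ?_, ?_⟩, ⟨?_, ?_, ?_, ?_⟩, le_rfl, Or.inl ⟨rfl, ?_⟩⟩
    all_goals simp [exec, NExp.eval, RExp.eval, f1, f2, f3, f4, hm, τ]
    · funext x; simp [hX]
    · funext x; simp [hN]
    · omega
  · rintro f s ⟨hf, ⟨g1, g2, g3, g4⟩, hfJ, hI⟩ hb
    simp only [BExp.eval, NExp.eval, hf.hk] at hb
    have hf0 : 0 < f := by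
      rcases Nat.eq_zero_or_pos f with rfl | h
      · exfalso
        -- After `J` doublings the threshold is at least `1`, so there is at most one piece and the
        -- loop test fails.
        have h1 : 1 ≤ τ 0 := by
          simp only [τ, Nat.sub_zero]
          have : 512 * k / ε * (ε / (512 * k)) = 1 := by field_simp
          rw [← this]
          exact mul_le_mul_of_nonneg_right hJ (by positivity)
        rcases hI with ⟨rfl, -⟩ | ⟨-, v, hv, -⟩
        · exact lt_irrefl _ hJ0
        · have := hv.length_le_one hG.N_le h1
          omega
      · exact h
    refine ⟨hf0, ?_⟩
    have hτf : τ (f - 1) = τ f + τ f := by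
      simp only [τ]
      rw [show J - (f - 1) = (J - f) + 1 by omega, pow_succ]; ring
    have hτf' : τ (f - 1) / 2 = τ f := by rw [hτf]; ring
    refine Ensures.seq (M := fun s' => s'.Frame k ε n ∧ s'.HasGrid X N m (τ (f - 1)))
      (Ensures.of_loopFree (by simp [LoopFree]) (by simp [bound, NExp.cost, RExp.cost]) ?_) ?_
    · obtain ⟨f1, f2, f3, f4⟩ := hf
      refine ⟨⟨?_, ?_, ?_, ?_⟩, ⟨?_, ?_, ?_, ?_⟩⟩
      all_goals simp [exec, NExp.eval, RExp.eval, f1, f2, f3, f4, g2, g3, g4, hτf]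
      funext x; simp [g1]
    · rintro s₁ ⟨hf₁, hg₁⟩
      refine (greedy_ensures (hτ _) hG.lt hm0 hf₁ hg₁).mono le_rfl ?_
      rintro s₂ ⟨hf₂, hg₂, v, hv, hfl⟩
      refine ⟨hf₂, hg₂, by omega, Or.inr ⟨by omega, v, hv, hfl, ?_⟩⟩
      rw [hτf']
      -- Before the first run the piece count is only the sentinel `4 * k + 1`, which forces one
      -- iteration, and doubling the start value gives `ε / (256 * k)`. Later the partition that
      -- just failed is the witness at half the threshold.
      rcases hI with ⟨rfl, -⟩ | ⟨-, v', hv', -⟩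
      · left
        rw [hτf]
        simp only [τ, Nat.sub_self, pow_zero, one_mul]
        field_simp
        norm_num
      · exact Or.inr ⟨_, v', by omega, hv'⟩
  · have : J * ((9 + (420 * m + 100)) + 14 + 1) ≤ J * (420 * m + 130) :=
      Nat.mul_le_mul_left _ (by omega)
    omega
  · rintro s' ⟨⟨f, hf, hg, hfJ, hI⟩, hb⟩
    simp only [BExp.eval, NExp.eval, hf.hk] at hb
    rcases hI with ⟨-, h⟩ | ⟨-, v, hv, hfl, hor⟩
    · omega
    · exact ⟨hf.hd, by omega, τ f, v, hτ f, hv, hfl, hor⟩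


/-- Taking for `g` the indicator of the complement of `A`, the sum over the original sample
vanishes, and so do all the nonnegative terms of the sum over `S`. -/
theorem sample_mem_of_sum_eq {S : ℕ → ℝ} {A : Set ℝ} (hω : ∀ i, ω i ∈ A)
    (h : ∀ g : ℝ → ℝ, ∑ x ∈ Finset.range n, g (S x) = ∑ x ∈ Finset.range n, g (ω x)) :
    ∀ i < n, S i ∈ A := by
  classical
  have h1 := h fun x => if x ∈ A then 0 else 1
  rw [Finset.sum_eq_zero (s := Finset.range n) (f := fun x => if ω x ∈ A then (0 : ℝ) else 1)
    fun x _ => if_pos (hω x), Finset.sum_eq_zero_iff_of_nonneg] at h1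
  · intro i hi
    by_contra hcon
    have := h1 i (Finset.mem_range.2 hi)
    rw [if_neg hcon] at this
    exact one_ne_zero this
  · intro i _
    split_ifs <;> norm_num

/-- What the algorithm computes from the sample points `ω 0, …, ω (n - 1)`. -/
structure _root_.State.IsLearned (ω : ℕ → ℝ) (k : ℕ) (ε : ℝ) (n : ℕ) (S X : ℕ → ℝ) (N : ℕ → ℕ)
    (m : ℕ) (τ : ℝ) (v : ℕ → ℕ) (s : State) : Prop where
  draws : s.draws = n
  pieces_le : s.pieces ≤ 4 * k
  sum_eq : ∀ g : ℝ → ℝ, ∑ x ∈ Finset.range n, g (S x) = ∑ x ∈ Finset.range n, g (ω x)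
  isGrid : IsGrid S n X N m
  pos : 0 < τ
  isGreedy : IsGreedy X N n m τ s.pieces v
  isFlattening : IsFlattening X N n s.pieces v (s.real 0) (s.real 1)
  minimal : τ = ε / (256 * k) ∨ ∃ l' v', 4 * k < l' ∧ IsGreedy X N n m (τ / 2) l' v'

theorem learn_ensures {L μ : ℕ} (hω : ∀ i, ω i ∈ Ico (0 : ℝ) 1) (hk : 1 ≤ k) (hε : 0 < ε)
    (hε1 : ε < 1) (hL : k / ε ^ 2 ≤ 2 ^ L) (hL' : ∀ j < L, (2 : ℝ) ^ j < k / ε ^ 2)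
    (hμ : 33554432 * k * (L + 1) / ε ^ 2 ≤ 2 ^ μ)
    (hμ' : ∀ j < μ, (2 : ℝ) ^ j < 33554432 * k * (L + 1) / ε ^ 2) :
    learn.Ensures ω (State.init k ε) (10000 * ((L + μ + 1) * 2 ^ μ)) (fun s =>
      ∃ S X N m τ v, s.IsLearned ω k ε (2 ^ μ) S X N m τ v) := by
  have hn1 : 1 ≤ 2 ^ μ := Nat.one_le_two_pow
  generalize hn : 2 ^ μ = n at hn1 ⊢
  -- Since `ε < 1`, the ratio `k / ε` is at most `k / ε ^ 2 ≤ 2 ^ L`, and `512 = 2 ^ 9`; hence `L +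
  -- 9` doublings suffice.
  have hJ : 512 * k / ε ≤ 2 ^ (L + 9) := by
    have h1 : (k : ℝ) / ε ≤ k / ε ^ 2 :=
      div_le_div_of_nonneg_left (Nat.cast_nonneg _) (by positivity) (by nlinarith)
    calc 512 * k / ε = 512 * (k / ε) := by ring
      _ ≤ 512 * 2 ^ L := by linarith
      _ = 2 ^ (L + 9) := by rw [pow_add]; norm_num [mul_comm]
  have key := Ensures.seq (ω := ω) (P := .seq (.regN 1 (.reg 0)) (.regR 2 (.reg 0)))
    (s := State.init k ε) (B₁ := 8)
    (M := fun s => s.nat 1 0 = k ∧ s.real 2 0 = ε ∧ s.draws = 0)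
    (Ensures.of_loopFree (by simp [LoopFree]) (by simp [bound, NExp.cost, RExp.cost])
      (by simp [exec, NExp.eval, RExp.eval, State.init]))
    (Q := .ite (.ltR (.reg 2) (.ofNat (.lit 1)))
      (.seq sampleSize (.seq drawSample (.seq mergeSort (.seq makeGrid search))))
      outputUniform)
    (R := fun s => ∃ S X N m τ v, s.IsLearned ω k ε n S X N m τ v)
    (fun s hs => Ensures.ite (B := (40 * L + 30 * μ + 80) + ((20 * n + 20) +
      ((μ * (225 * n + 66) + 10) + ((60 * n + 60) + ((L + 9) * (420 * (n + 1) + 130) + 60)))))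
      (fun _ => ?_) (fun hc => ?_))
  · refine key.mono ?_ (fun _ h => h)
    simp only [BExp.cost, RExp.cost, NExp.cost]
    have h1 : L ≤ L * n := Nat.le_mul_of_pos_right _ hn1
    have h2 : μ ≤ μ * n := Nat.le_mul_of_pos_right _ hn1
    have e1 : μ * (225 * n + 66) = 225 * (μ * n) + 66 * μ := by ring
    have e2 : (L + 9) * (420 * (n + 1) + 130) = 420 * (L * n) + 550 * L + 3780 * n + 4950 := by ring
    have e3 : (L + μ + 1) * n = L * n + μ * n + n := by ring
    rw [e1, e2, e3]
    omega
  · obtain ⟨h1, h2, h3⟩ := hs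
    refine Ensures.seq (sampleSize_ensures h1 h2 h3 hL hL' hμ hμ') ?_
    rintro s₁ ⟨h1, h2, h3, h4⟩
    refine Ensures.seq (drawSample_ensures h1 h2 (h3.trans hn) h4) ?_
    rintro s₂ ⟨hf₂, hS₂⟩
    refine Ensures.seq (mergeSort_ensures hf₂ rfl hn.symm) ?_
    rintro s₃ ⟨hf₃, hS₃, hsum₃⟩
    have hsum : ∀ g : ℝ → ℝ, ∑ x ∈ Finset.range n, g (s₃.real 3 x) =
        ∑ x ∈ Finset.range n, g (ω x) := fun g => (hsum₃ g).trans
      (Finset.sum_congr rfl fun x hx => by rw [hS₂ x (Finset.mem_range.1 hx)])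
    refine Ensures.seq (makeGrid_ensures hf₃ rfl hS₃ (sample_mem_of_sum_eq hω hsum)) ?_
    rintro s₄ ⟨hf₄, hG⟩
    refine (search_ensures hk hε (Nat.succ_pos _) hJ hf₄ rfl rfl rfl hG).mono ?_ ?_
    · have := Nat.mul_le_mul_left (L + 9) (show 420 * s₄.nat 11 0 + 130 ≤ 420 * (n + 1) + 130 by
        have := hG.m_le
        omega)
      exact Nat.add_le_add_right this _
    · rintro s₅ ⟨hd, hp, τ, v, hτ, hv, hfl, hor⟩
      exact ⟨_, _, _, _, τ, v, hd, hp, hsum, hG, hτ, hv, hfl, hor⟩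
  · simp only [BExp.eval, RExp.eval, NExp.eval, hs.2.1, Nat.cast_one] at hc
    exact absurd hε1 hc

/-- A total variation distance never exceeds `1 ≤ ε`, so the uniform distribution will do. For large
`ε` the bound on the sample size drops below one, so drawing nothing is also forced there. -/
theorem learn_ensures_of_one_le (hε : 1 ≤ ε) :
    learn.Ensures ω (State.init k ε) 100 (fun s => s.draws = 0 ∧ s.pieces = 1 ∧
      s.real 0 0 = 0 ∧ s.real 0 1 = 1 ∧ s.real 1 0 = 1) := by
  refine Ensures.mono (B := 8 + (6 + 1 + 40)) (Ensures.seq (M := fun s => s.real 2 0 = ε ∧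
    s.draws = 0) (Ensures.of_loopFree (by simp [LoopFree]) (by simp [bound, NExp.cost, RExp.cost])
      (by simp [exec, NExp.eval, RExp.eval, State.init]))
    (fun s hs => (Ensures.ite (B := 40) (fun hc => ?_) (fun _ => ?_)).mono
      (by simp [BExp.cost, RExp.cost, NExp.cost]) fun _ h => h)) (by norm_num) fun _ h => h
  · simp only [BExp.eval, RExp.eval, NExp.eval, hs.1, Nat.cast_one] at hc
    exact absurd hε (not_le.2 hc)
  · refine Ensures.of_loopFree (by simp [LoopFree, outputUniform])
      (by simp [outputUniform, bound, NExp.cost, RExp.cost]) ?_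
    simp [outputUniform, exec, NExp.eval, RExp.eval, hs.2, State.pieces]

end Prog

/-! ## Histograms as measures -/

/-- A discrete intermediate value theorem. -/
theorem exists_step_of_le_of_lt {α : Type*} [LinearOrder α] (f : ℕ → α) {s t : ℕ} {x : α}
    (hst : s ≤ t) (hs : f s ≤ x) (ht : x < f t) :
    ∃ j, s ≤ j ∧ j < t ∧ f j ≤ x ∧ x < f (j + 1) := by
  induction t, hst using Nat.le_induction with
  | base => exact absurd ht (not_lt.2 hs)
  | succ t hst ih =>
    rcases le_or_gt (f t) x with h | h
    · exact ⟨t, hst, Nat.lt_succ_self t, h, ht⟩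
    · obtain ⟨j, h1, h2, h3⟩ := ih h
      exact ⟨j, h1, by omega, h3⟩

namespace IsHistogram

variable {l : ℕ} {b c : ℕ → ℝ}

theorem mono (h : IsHistogram l b c) {i j : ℕ} (hij : i ≤ j) (hj : j ≤ l) : b i ≤ b j := by
  induction j, hij using Nat.le_induction with
  | base => exact le_rfl
  | succ j hij ih => exact (ih (by omega)).trans (h.2.2.1 j (by omega))

theorem mem_Icc (h : IsHistogram l b c) {i : ℕ} (hi : i ≤ l) : b i ∈ Icc (0 : ℝ) 1 :=
  ⟨h.1 ▸ h.mono (Nat.zero_le i) hi, h.2.1 ▸ h.mono hi le_rfl⟩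

theorem histDensity_eq (h : IsHistogram l b c) {r : ℕ} (hr : r < l) {x : ℝ}
    (hx : x ∈ Ico (b r) (b (r + 1))) : histDensity l b c x = c r := by
  unfold histDensity
  rw [Finset.sum_eq_single_of_mem r (Finset.mem_range.2 hr), indicator_of_mem hx]
  intro i hi hir
  refine indicator_of_notMem (fun hxi => ?_) _
  have hi := Finset.mem_range.1 hi
  rcases lt_or_gt_of_ne hir with h1 | h1
  · exact absurd ((h.mono (show i + 1 ≤ r by omega) hr.le).trans hx.1) (not_le.2 hxi.2)
  · exact absurd ((h.mono (show r + 1 ≤ i by omega) hi.le).trans hxi.1) (not_le.2 hx.2)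

theorem histDensity_eq_zero (h : IsHistogram l b c) {x : ℝ} (hx : x ∉ Ico (0 : ℝ) 1) :
    histDensity l b c x = 0 := by
  unfold histDensity
  refine Finset.sum_eq_zero fun i hi => indicator_of_notMem (fun hxi => hx ?_) _
  have hi := Finset.mem_range.1 hi
  exact ⟨(h.mem_Icc hi.le).1.trans hxi.1, hxi.2.trans_le (h.mem_Icc (i := i + 1) hi).2⟩

theorem histMeasure_apply (h : IsHistogram l b c) {r : ℕ} (hr : r < l) {A : Set ℝ}
    (hA : MeasurableSet A) (hAr : A ⊆ Ico (b r) (b (r + 1))) :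
    histMeasure l b c A = ENNReal.ofReal (c r) * volume A := by
  rw [histMeasure, withDensity_apply _ hA,
    setLIntegral_congr_fun hA (g := fun _ => ENNReal.ofReal (c r))
      fun x hx => by rw [h.histDensity_eq hr (hAr hx)]]
  simp

theorem histMeasure_real (h : IsHistogram l b c) {r : ℕ} (hr : r < l) {A : Set ℝ}
    (hA : MeasurableSet A) (hAr : A ⊆ Ico (b r) (b (r + 1))) :
    (histMeasure l b c).real A = c r * volume.real A := by
  rw [Measure.real, h.histMeasure_apply hr hA hAr, ENNReal.toReal_mul,
    ENNReal.toReal_ofReal (h.2.2.2.1 r hr), Measure.real]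

theorem histMeasure_real_Ico (h : IsHistogram l b c) {r : ℕ} (hr : r < l) {x y : ℝ}
    (hxy : x ≤ y) (hx : b r ≤ x) (hy : y ≤ b (r + 1)) :
    (histMeasure l b c).real (Ico x y) = c r * (y - x) := by
  rw [h.histMeasure_real hr measurableSet_Ico (Ico_subset_Ico hx hy), Real.volume_real_Ico_of_le hxy]

theorem histMeasure_compl (h : IsHistogram l b c) : histMeasure l b c (Ico (0 : ℝ) 1)ᶜ = 0 := by
  rw [histMeasure, withDensity_apply _ measurableSet_Ico.compl,
    setLIntegral_congr_fun measurableSet_Ico.compl (g := fun _ => 0)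
      fun x hx => by rw [h.histDensity_eq_zero hx, ENNReal.ofReal_zero]]
  simp

theorem histMeasure_real_singleton (x : ℝ) : (histMeasure l b c).real {x} = 0 := by
  have h : histMeasure l b c {x} = 0 := withDensity_absolutelyContinuous _ _ Real.volume_singleton
  rw [Measure.real, h, ENNReal.toReal_zero]

theorem isProbabilityMeasure (h : IsHistogram l b c) :
    IsProbabilityMeasure (histMeasure l b c) := by
  constructor
  have key : ∀ r ≤ l, histMeasure l b c (Ico 0 (b r)) =
      ENNReal.ofReal (∑ i ∈ Finset.range r, c i * (b (i + 1) - b i)) := by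
    intro r
    induction r with
    | zero => intro _; simp [h.1]
    | succ r ih =>
      intro hr
      have h1 := h.mono (Nat.le_succ r) hr
      rw [← Ico_union_Ico_eq_Ico (h.mem_Icc (i := r) (by omega)).1 h1,
        measure_union (Ico_disjoint_Ico_same) measurableSet_Ico, ih (by omega),
        h.histMeasure_apply hr measurableSet_Ico le_rfl, Real.volume_Ico,
        ← ENNReal.ofReal_mul (h.2.2.2.1 r hr), ← ENNReal.ofReal_add,
        Finset.sum_range_succ]
      · exact Finset.sum_nonneg fun i hi => mul_nonneg
          (h.2.2.2.1 i (by have := Finset.mem_range.1 hi; omega))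
          (sub_nonneg.2 (h.2.2.1 i (by have := Finset.mem_range.1 hi; omega)))
      · exact mul_nonneg (h.2.2.2.1 r hr) (sub_nonneg.2 h1)
  have h1 := key l le_rfl
  rw [h.2.1, h.2.2.2.2, ENNReal.ofReal_one] at h1
  rw [← measure_add_measure_compl (measurableSet_Ico (a := (0 : ℝ)) (b := 1)), h1,
    h.histMeasure_compl, add_zero]

end IsHistogram

/-- Shows that the infimum in `opt` is over a nonempty class. The first piece is all of `[0,1)`, the
others are empty. -/
theorem isHistogram_uniform {k : ℕ} (hk : 1 ≤ k) :
    IsHistogram k (fun i => if i = 0 then 0 else 1) (fun _ => 1) := by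
  refine ⟨if_pos rfl, if_neg (by omega), fun i _ => ?_, fun _ _ => zero_le_one, ?_⟩
  · simp only [Nat.succ_ne_zero, if_false]
    split_ifs <;> norm_num
  · rw [Finset.sum_eq_single_of_mem 0 (Finset.mem_range.2 hk)]
    · simp
    · intro i _ hi
      simp [hi]

/-! ## Total variation distance -/

section

variable {p q : Measure ℝ}

theorem bddAbove_dTV (q p : Measure ℝ) [IsProbabilityMeasure p] [IsProbabilityMeasure q] :
    BddAbove (range fun A : {A : Set ℝ // MeasurableSet A} => |q.real A - p.real A|) := by
  refine ⟨1, ?_⟩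
  rintro _ ⟨A, rfl⟩
  have h1 : q.real A ≤ 1 := measureReal_le_one
  have h2 : p.real A ≤ 1 := measureReal_le_one
  have h3 : 0 ≤ q.real (A : Set ℝ) := measureReal_nonneg
  have h4 : 0 ≤ p.real (A : Set ℝ) := measureReal_nonneg
  exact abs_le.2 ⟨by linarith, by linarith⟩

theorem abs_sub_le_dTV [IsProbabilityMeasure p] [IsProbabilityMeasure q] {A : Set ℝ}
    (hA : MeasurableSet A) : |q.real A - p.real A| ≤ dTV q p :=
  le_ciSup (bddAbove_dTV q p) ⟨A, hA⟩

theorem dTV_le {D : ℝ} (h : ∀ A, MeasurableSet A → |q.real A - p.real A| ≤ D) : dTV q p ≤ D :=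
  have : Nonempty {A : Set ℝ // MeasurableSet A} := ⟨⟨∅, MeasurableSet.empty⟩⟩
  ciSup_le fun A => h A A.2

theorem dTV_nonneg : 0 ≤ dTV q p := Real.iSup_nonneg fun _ => abs_nonneg _

theorem dTV_le_one [IsProbabilityMeasure p] [IsProbabilityMeasure q] : dTV q p ≤ 1 :=
  dTV_le fun A _ => by
    have h1 : q.real A ≤ 1 := measureReal_le_one
    have h2 : p.real A ≤ 1 := measureReal_le_one
    have h3 : 0 ≤ q.real A := measureReal_nonneg
    have h4 : 0 ≤ p.real A := measureReal_nonneg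
    exact abs_le.2 ⟨by linarith, by linarith⟩

theorem opt_nonneg (k : ℕ) (p : Measure ℝ) : 0 ≤ opt k p := Real.iInf_nonneg fun _ => dTV_nonneg

theorem exists_isHistogram_dTV_le {k : ℕ} (hk : 1 ≤ k) (p : Measure ℝ) {δ : ℝ} (hδ : 0 < δ) :
    ∃ b c, IsHistogram k b c ∧ dTV (histMeasure k b c) p ≤ opt k p + δ := by
  have : Nonempty {q : Measure ℝ // IsFlat k q} := ⟨⟨_, _, _, isHistogram_uniform hk, rfl⟩⟩
  obtain ⟨⟨q, b, c, hq, rfl⟩, h⟩ := exists_lt_of_ciInf_lt (show opt k p < opt k p + δ by linarith)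
  exact ⟨b, c, hq, h.le⟩

/-- Bounds for unions give bounds for the sum of the absolute deviations. -/
theorem sum_abs_sub_le [IsFiniteMeasure p] [IsFiniteMeasure q] {K : ℕ} {J : ℕ → Set ℝ} {D : ℝ}
    (hJ : ∀ i < K, MeasurableSet (J i))
    (hd : (Finset.range K : Set ℕ).PairwiseDisjoint J)
    (h : ∀ s ⊆ Finset.range K, |q.real (⋃ i ∈ s, J i) - p.real (⋃ i ∈ s, J i)| ≤ D) :
    ∑ i ∈ Finset.range K, |q.real (J i) - p.real (J i)| ≤ 2 * D := by
  classical
  have hsum : ∀ s ⊆ Finset.range K, |∑ i ∈ s, (q.real (J i) - p.real (J i))| ≤ D := by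
    intro s hs
    have hm : ∀ i ∈ s, MeasurableSet (J i) := fun i hi => hJ i (Finset.mem_range.1 (hs hi))
    have hd' : (s : Set ℕ).PairwiseDisjoint J := hd.subset (by exact_mod_cast hs)
    rw [Finset.sum_sub_distrib, ← measureReal_biUnion_finset hd' hm,
      ← measureReal_biUnion_finset hd' hm]
    exact h s hs
  set d : ℕ → ℝ := fun i => q.real (J i) - p.real (J i) with hdef
  -- Split by the sign of the deviation: each half is, up to sign, the deviation on a single union,
  -- whence the factor `2`.
  rw [← Finset.sum_filter_add_sum_filter_not (Finset.range K) (fun i => 0 ≤ d i), two_mul]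
  refine add_le_add ?_ ?_
  · refine le_trans (le_of_eq ?_) ((le_abs_self _).trans
      (hsum ((Finset.range K).filter fun i => 0 ≤ d i) (Finset.filter_subset _ _)))
    exact Finset.sum_congr rfl fun i hi => abs_of_nonneg (Finset.mem_filter.1 hi).2
  · refine le_trans (le_of_eq ?_) ((neg_le_abs _).trans
      (hsum ((Finset.range K).filter fun i => ¬ 0 ≤ d i) (Finset.filter_subset _ _)))
    rw [← Finset.sum_neg_distrib]
    exact Finset.sum_congr rfl fun i hi => abs_of_neg (not_le.1 (Finset.mem_filter.1 hi).2)

end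

/-! ## The approximation guarantee for a fixed sample -/

/-- The set function `e` has the weight `N t - N s` out of `n` on the part `[X s, X t)` of the grid
`0 = X 0 < ⋯ < X m = 1`, and lives on the grid points. -/
structure IsGridWeight (e : Set ℝ → ℝ) (X : ℕ → ℝ) (N : ℕ → ℕ) (n m : ℕ) : Prop where
  n_pos : 0 < n
  m_pos : 0 < m
  zero : X 0 = 0
  one : X m = 1
  lt : ∀ s t, s < t → t ≤ m → X s < X t
  N_zero : N 0 = 0
  N_last : N m = n
  N_mono : ∀ s t, s ≤ t → t ≤ m → N s ≤ N t
  weight : ∀ s t, s ≤ t → t ≤ m → e (Ico (X s) (X t)) = ((N t : ℝ) - N s) / n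
  atom : ∀ j < m, e (Ico (X j) (X (j + 1))) = e {X j}

namespace IsGreedy

variable {X : ℕ → ℝ} {N : ℕ → ℕ} {n m : ℕ} {τ : ℝ} {l : ℕ} {v : ℕ → ℕ}

theorem strictMono (h : IsGreedy X N n m τ l v) {i j : ℕ} (hij : i < j) (hj : j ≤ l) :
    v i < v j := by
  induction j, hij using Nat.le_induction with
  | base => exact h.lt i hj
  | succ j hij ih => exact (ih (by omega)).trans (h.lt j hj)

theorem mono (h : IsGreedy X N n m τ l v) {i j : ℕ} (hij : i ≤ j) (hj : j ≤ l) : v i ≤ v j := by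
  rcases hij.lt_or_eq with hij | rfl
  · exact (h.strictMono hij hj).le
  · exact le_rfl

theorem le_last (h : IsGreedy X N n m τ l v) {i : ℕ} (hi : i ≤ l) : v i ≤ m :=
  h.last ▸ h.mono hi le_rfl

end IsGreedy

namespace IsGridWeight

variable {e : Set ℝ → ℝ} {X : ℕ → ℝ} {N : ℕ → ℕ} {n m : ℕ} {τ : ℝ} {l : ℕ} {v : ℕ → ℕ}

theorem mono (h : IsGridWeight e X N n m) {s t : ℕ} (hst : s ≤ t) (ht : t ≤ m) : X s ≤ X t := by
  rcases hst.lt_or_eq with hst | rfl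
  · exact (h.lt s t hst ht).le
  · exact le_rfl

theorem isHistogram (h : IsGridWeight e X N n m) (hv : IsGreedy X N n m τ l v) {b c : ℕ → ℝ}
    (hf : IsFlattening X N n l v b c) : IsHistogram l b c := by
  have hn : (0 : ℝ) < n := by exact_mod_cast h.n_pos
  refine ⟨by rw [hf.break_eq 0 (Nat.zero_le _), hv.zero, h.zero],
    by rw [hf.break_eq l le_rfl, hv.last, h.one], ?_, ?_, ?_⟩
  · intro i hi
    rw [hf.break_eq i hi.le, hf.break_eq (i + 1) hi]
    exact h.mono (hv.lt i hi).le (hv.le_last hi)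
  · intro i hi
    rw [hf.height_eq i hi]
    have h1 : (N (v i) : ℝ) ≤ N (v (i + 1)) := by
      exact_mod_cast h.N_mono _ _ (hv.lt i hi).le (hv.le_last hi)
    exact div_nonneg (div_nonneg (sub_nonneg.2 h1) hn.le)
      (sub_nonneg.2 (h.mono (hv.lt i hi).le (hv.le_last hi)))
  · have : ∀ i ∈ Finset.range l, c i * (b (i + 1) - b i) =
        (N (v (i + 1)) : ℝ) / n - N (v i) / n := by
      intro i hi
      have hi := Finset.mem_range.1 hi
      rw [hf.height_eq i hi, hf.break_eq i hi.le, hf.break_eq (i + 1) hi,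
        div_mul_cancel₀ _ (sub_pos.2 (h.lt _ _ (hv.lt i hi) (hv.le_last hi))).ne', sub_div]
    rw [Finset.sum_congr rfl this, Finset.sum_range_sub (fun i => (N (v i) : ℝ) / n), hv.last,
      hv.zero, h.N_zero, h.N_last, Nat.cast_zero, zero_div, sub_zero, div_self hn.ne']

/-- A feasible piece is approximated well by its flattening on all subintervals. -/
theorem abs_weight_sub_le (h : IsGridWeight e X N n m) {u w s t : ℕ}
    (hf : Feasible X N n τ u w) (hτ : 0 ≤ τ) (huw : u < w) (hw : w ≤ m) (hus : u ≤ s)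
    (hst : s ≤ t) (htw : t ≤ w) :
    |((N t : ℝ) - N s) / n - ((N w : ℝ) - N u) / n / (X w - X u) * (X t - X s)| ≤ 3 * τ := by
  obtain ⟨x, hx⟩ := hf
  have hd : 0 < X w - X u := sub_pos.2 (h.lt _ _ huw hw)
  have hx' : ∀ j, u ≤ j → j ≤ w → |((N j : ℝ) - N u) / n - x * (X j - X u)| ≤ τ := by
    intro j hj hj'
    rcases hj.lt_or_eq with hj | rfl
    · exact hx j hj hj'
    · simpa using hτ
  set H := ((N w : ℝ) - N u) / n / (X w - X u) with hH
  have hHw : ((N w : ℝ) - N u) / n = H * (X w - X u) := by rw [hH, div_mul_cancel₀ _ hd.ne']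
  have h1 := hx' s hus (hst.trans htw)
  have h2 := hx' t (hus.trans hst) htw
  have h3 := hx' w huw.le le_rfl
  rw [hHw, ← sub_mul, abs_mul, abs_of_pos hd] at h3
  -- Feasibility at the right end `w` compares the flattened slope `H` with `x` over the whole
  -- piece, and a subinterval is shorter.
  have h4 : |(H - x) * (X t - X s)| ≤ τ := by
    rw [abs_mul]
    refine (mul_le_mul_of_nonneg_left ?_ (abs_nonneg _)).trans h3
    have a1 := h.mono hus ((hst.trans htw).trans hw)
    have a2 := h.mono htw hw
    have a3 := h.mono hst (htw.trans hw)
    rw [abs_le]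
    constructor <;> linarith
  -- Three errors of size `τ`: one at each end of the subinterval, and one for the change of slope.
  have e1 : ((N t : ℝ) - N s) / n - H * (X t - X s) =
      (((N t : ℝ) - N u) / n - x * (X t - X u)) - (((N s : ℝ) - N u) / n - x * (X s - X u)) -
        (H - x) * (X t - X s) := by ring
  rw [e1]
  rw [abs_le] at h1 h2 h4 ⊢
  constructor <;> linarith [h1.1, h1.2, h2.1, h2.2, h4.1, h4.2]

/-- A histogram without breakpoints in `[X s, X t)` is constant there. -/
theorem exists_piece (h : IsGridWeight e X N n m) {k : ℕ} {b c : ℕ → ℝ} (hq : IsHistogram k b c)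
    {s t : ℕ} (hst : s < t) (ht : t ≤ m) (hb : ∀ r < k, b r ∉ Ico (X s) (X t)) :
    ∃ r < k, b r ≤ X s ∧ X t ≤ b (r + 1) := by
  have h0 : b 0 ≤ X s := by rw [hq.1, ← h.zero]; exact h.mono (Nat.zero_le _) (by omega)
  have h1 : X s < b k := by
    rw [hq.2.1, ← h.one]; exact h.lt _ _ (by omega) le_rfl
  obtain ⟨r, -, hr, h2, h3⟩ := exists_step_of_le_of_lt b (Nat.zero_le k) h0 h1
  refine ⟨r, hr, h2, ?_⟩
  by_contra hcon
  -- The endpoint `b k = 1` is not among the excluded breakpoints, but it lies to the right of the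
  -- whole grid.
  rcases (show r + 1 ≤ k from hr).lt_or_eq with h4 | h4
  · exact hb _ h4 ⟨h3.le, not_le.1 hcon⟩
  · rw [h4, hq.2.1, ← h.one] at hcon
    exact hcon (h.mono ht le_rfl)

end IsGridWeight

/-- Among disjoint sets, at most `k` contain one of `k` given points. -/
theorem card_filter_exists_mem_le {ι α : Type*} (s : Finset ι) {I : ι → Set α} {k : ℕ} (b : ℕ → α)
    [DecidablePred fun i => ∃ r < k, b r ∈ I i] (hI : (s : Set ι).PairwiseDisjoint I) :
    (s.filter fun i => ∃ r < k, b r ∈ I i).card ≤ k := by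
  classical
  have hex : ∀ i, ∃ r, (∃ r < k, b r ∈ I i) → r < k ∧ b r ∈ I i := fun i => by
    by_cases h : ∃ r < k, b r ∈ I i
    · obtain ⟨r, hr⟩ := h
      exact ⟨r, fun _ => hr⟩
    · exact ⟨0, fun h' => absurd h' h⟩
  choose ρ hρ using hex
  have := Finset.card_le_card_of_injOn (s := s.filter fun i => ∃ r < k, b r ∈ I i)
    (t := Finset.range k) ρ (fun i hi => by
      have hi : i ∈ s.filter fun i => ∃ r < k, b r ∈ I i := by exact_mod_cast hi
      exact Finset.mem_coe.2 (Finset.mem_range.2 (hρ i (Finset.mem_filter.1 hi).2).1)) ?_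
  · rwa [Finset.card_range] at this
  · intro i hi j hj hij
    have hi := Finset.mem_filter.1 (Finset.mem_coe.1 hi)
    have hj := Finset.mem_filter.1 (Finset.mem_coe.1 hj)
    by_contra hne
    refine Set.disjoint_left.1 (hI hi.1 hj.1 hne) (hρ i hi.2).2 ?_
    rw [hij]
    exact (hρ j hj.2).2

/-- A finite set of natural numbers from `0` to `m` in increasing order. -/
theorem exists_enumeration (T : Finset ℕ) {m : ℕ} (h0 : 0 ∈ T) (hm : m ∈ T) (hT : ∀ t ∈ T, t ≤ m) :
    ∃ (R : ℕ) (w : ℕ → ℕ), R + 1 = T.card ∧ w 0 = 0 ∧ w R = m ∧ (∀ i < R, w i < w (i + 1)) ∧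
      (∀ i ≤ R, w i ∈ T) ∧ ∀ i < R, ∀ x ∈ T, w i < x → w (i + 1) ≤ x := by
  have hc : 0 < T.card := Finset.card_pos.2 ⟨0, h0⟩
  obtain ⟨R, hR⟩ := Nat.exists_eq_succ_of_ne_zero hc.ne'
  let o := T.orderEmbOfFin hR
  have ho : ∀ x ∈ T, ∃ i, o i = x := fun x hx => by
    have : x ∈ Set.range o := by rw [Finset.range_orderEmbOfFin]; exact hx
    exact this
  let w : ℕ → ℕ := fun i => if h : i < R + 1 then o ⟨i, h⟩ else 0
  have hw : ∀ i (h : i < R + 1), w i = o ⟨i, h⟩ := fun i h => dif_pos h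
  refine ⟨R, w, hR.symm, ?_, ?_, ?_, ?_, ?_⟩
  · obtain ⟨i, hi⟩ := ho 0 h0
    rw [hw 0 (by omega)]
    have : o ⟨0, by omega⟩ ≤ o i := o.monotone (Fin.mk_le_of_le_val (Nat.zero_le _))
    exact Nat.le_zero.1 (this.trans_eq hi)
  · obtain ⟨i, hi⟩ := ho m hm
    rw [hw R (by omega)]
    have : o i ≤ o ⟨R, by omega⟩ := o.monotone (Fin.le_def.2 (Nat.lt_succ_iff.1 i.2))
    exact le_antisymm (hT _ (Finset.orderEmbOfFin_mem T hR _)) (hi.symm.trans_le this)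
  · intro i hi
    rw [hw i (by omega), hw (i + 1) (by omega)]
    exact o.strictMono (Fin.lt_def.2 (Nat.lt_succ_self i))
  · intro i hi
    rw [hw i (by omega)]
    exact Finset.orderEmbOfFin_mem T hR _
  · intro i hi x hx hix
    obtain ⟨j, rfl⟩ := ho x hx
    rw [hw i (by omega)] at hix
    rw [hw (i + 1) (by omega)]
    have := o.lt_iff_lt.1 hix
    exact o.monotone (Fin.le_def.2 (Nat.succ_le_of_lt (Fin.lt_def.1 this)))

/-- The sum of the deviations of `e` and `q` on at most `K` disjoint intervals is at most `G`. -/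
def IntervalDeviationLE (e q : Set ℝ → ℝ) (K : ℕ) (G : ℝ) : Prop :=
  ∀ J : ℕ → Set ℝ, (∀ i < K, (J i).OrdConnected) → (Finset.range K : Set ℕ).PairwiseDisjoint J →
    ∑ i ∈ Finset.range K, |e (J i) - q (J i)| ≤ G

theorem IsGridWeight.pairwiseDisjoint_Ico {e : Set ℝ → ℝ} {X : ℕ → ℝ} {N : ℕ → ℕ} {n m : ℕ}
    (h : IsGridWeight e X N n m) {s t : ℕ → ℕ} {I : Set ℕ} (ht : ∀ i ∈ I, t i ≤ m)
    (hts : ∀ i ∈ I, ∀ j ∈ I, i < j → t i ≤ s j) (hst : ∀ i ∈ I, s i ≤ t i) :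
    I.PairwiseDisjoint fun i => Ico (X (s i)) (X (t i)) := by
  intro i hi j hj hij
  refine Set.disjoint_left.2 fun x hx hx' => ?_
  rcases lt_or_gt_of_ne hij with h1 | h1
  · exact absurd ((h.mono (hts i hi j hj h1) ((hst j hj).trans (ht j hj))).trans hx'.1)
      (not_le.2 hx.2)
  · exact absurd ((h.mono (hts j hj i hi h1) ((hst i hi).trans (ht i hi))).trans hx.1)
      (not_le.2 hx'.2)

/-- If the greedy partition has at least `4 * k` pieces, then `τ` is small. -/
theorem IsGreedy.mul_le {e : Set ℝ → ℝ} {X : ℕ → ℝ} {N : ℕ → ℕ} {n m : ℕ} {τ : ℝ} {l : ℕ}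
    {v : ℕ → ℕ} (hv : IsGreedy X N n m τ l v) (h : IsGridWeight e X N n m) (hτ : 0 ≤ τ) {k : ℕ}
    {b c : ℕ → ℝ} (hq : IsHistogram k b c) {G : ℝ}
    (hG : IntervalDeviationLE e (histMeasure k b c).real (7 * k) G) (hl : 4 * k ≤ l) :
    k * τ ≤ G := by
  classical
  -- Pieces are taken in pairs because maximality concerns one cell beyond a piece; that cell
  -- belongs to the second piece of the pair, so the `2 * k` witnesses stay disjoint.
  let I : ℕ → Set ℝ := fun i => Ico (X (v (2 * i))) (X (v (2 * i + 2)))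
  have hdis : (Finset.range (2 * k) : Set ℕ).PairwiseDisjoint I := by
    refine h.pairwiseDisjoint_Ico (s := fun i => v (2 * i)) (t := fun i => v (2 * i + 2))
      (fun i hi => ?_) (fun i hi j hj hij => ?_) (fun i hi => ?_)
    · exact hv.le_last (by have := Finset.mem_range.1 (Finset.mem_coe.1 hi); omega)
    · exact hv.mono (by omega) (by have := Finset.mem_range.1 (Finset.mem_coe.1 hj); omega)
    · exact hv.mono (by omega) (by have := Finset.mem_range.1 (Finset.mem_coe.1 hi); omega)
  have hcard := card_filter_exists_mem_le (k := k) (Finset.range (2 * k)) b hdis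
  have hcard' := Finset.card_filter_add_card_filter_not (s := Finset.range (2 * k))
    (fun i => ∃ r < k, b r ∈ I i)
  rw [Finset.card_range] at hcard'
  -- At most `k` of the `2 * k` pairs contain one of the `k` left endpoints of the pieces of `q`, so
  -- at least `k` remain.
  set F := (Finset.range (2 * k)).filter fun i => ¬ ∃ r < k, b r ∈ I i with hF
  have hex : ∀ i, ∃ j, i ∈ F → v (2 * i) < j ∧ j ≤ v (2 * i + 2) ∧
      τ < |e (Ico (X (v (2 * i))) (X j)) - (histMeasure k b c).real (Ico (X (v (2 * i))) (X j))| := by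
    intro i
    by_cases hi : i ∈ F
    · have hi' := Finset.mem_filter.1 hi
      have hik := Finset.mem_range.1 hi'.1
      have hlt : v (2 * i) < v (2 * i + 2) := hv.strictMono (by omega) (by omega)
      have hlast : v (2 * i + 2) ≤ m := hv.le_last (by omega)
      have hlt2 : v (2 * i + 1) < v (2 * i + 2) := hv.strictMono (by omega) (by omega)
      obtain ⟨r, hr, hr1, hr2⟩ := h.exists_piece hq hlt hlast fun r hr hm => hi'.2 ⟨r, hr, hm⟩
      have hmax := hv.maximal (2 * i) (by omega)
      -- Otherwise the height of `q` on this pair would be a feasible slope for the extended piece.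
      have : ∃ j, v (2 * i) < j ∧ j ≤ v (2 * i + 1) + 1 ∧
          τ < |((N j : ℝ) - N (v (2 * i))) / n - c r * (X j - X (v (2 * i)))| := by
        by_contra hcon
        push Not at hcon
        exact hmax ⟨c r, hcon⟩
      obtain ⟨j, hj1, hj2, hj3⟩ := this
      refine ⟨j, fun _ => ⟨hj1, by omega, ?_⟩⟩
      rw [h.weight _ _ hj1.le (by omega), hq.histMeasure_real_Ico hr (h.mono hj1.le (by omega)) hr1
        ((h.mono (by omega) hlast).trans hr2)]
      exact hj3
    · exact ⟨0, fun h' => absurd h' hi⟩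
  choose j hj using hex
  -- Empty sets pad the family to `7 * k` members; their terms are nonnegative and are simply
  -- dropped.
  let J : ℕ → Set ℝ := fun i => if i ∈ F then Ico (X (v (2 * i))) (X (j i)) else ∅
  have hFsub : ∀ i ∈ F, i < 2 * k := fun i hi => Finset.mem_range.1 (Finset.mem_filter.1 hi).1
  have hJI : ∀ i ∈ F, J i ⊆ I i := fun i hi => by
    simp only [J, if_pos hi, I]
    exact Ico_subset_Ico le_rfl (h.mono (hj i hi).2.1 (hv.le_last (by have := hFsub i hi; omega)))
  have hsum := hG J (fun i _ => by
      simp only [J]; split_ifs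
      · exact ordConnected_Ico
      · exact ordConnected_empty) (fun i _ i' _ hne => by
      by_cases hi : i ∈ F
      · by_cases hi' : i' ∈ F
        · exact (hdis (Finset.mem_coe.2 (Finset.mem_range.2 (hFsub i hi)))
            (Finset.mem_coe.2 (Finset.mem_range.2 (hFsub i' hi'))) hne).mono (hJI i hi) (hJI i' hi')
        · simp [Function.onFun, J, hi']
      · simp [Function.onFun, J, hi])
  have h1 : (F.card : ℝ) * τ ≤ ∑ i ∈ F, |e (J i) - (histMeasure k b c).real (J i)| := by
    rw [← nsmul_eq_mul]
    refine Finset.card_nsmul_le_sum _ _ _ fun i hi => ?_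
    simp only [J, if_pos hi]
    exact (hj i hi).2.2.le
  have h2 : ∑ i ∈ F, |e (J i) - (histMeasure k b c).real (J i)| ≤
      ∑ i ∈ Finset.range (7 * k), |e (J i) - (histMeasure k b c).real (J i)| :=
    Finset.sum_le_sum_of_subset_of_nonneg (fun i hi => Finset.mem_range.2 (by
      have := hFsub i hi; omega)) fun _ _ _ => abs_nonneg _
  have h3 : (k : ℝ) ≤ F.card := by exact_mod_cast (by omega : k ≤ F.card)
  exact (mul_le_mul_of_nonneg_right h3 hτ).trans (h1.trans (h2.trans hsum))

/-- A finite measure on `[0,1)` is the sum of its parts on a partition into intervals. -/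
theorem IsGridWeight.real_eq_sum {e : Set ℝ → ℝ} {X : ℕ → ℝ} {N : ℕ → ℕ} {n m : ℕ}
    (h : IsGridWeight e X N n m) {R : ℕ} {w : ℕ → ℕ} (h0 : w 0 = 0) (hR : w R = m)
    (hlt : ∀ i < R, w i < w (i + 1)) (hle : ∀ i ≤ R, w i ≤ m) {p : Measure ℝ} [IsFiniteMeasure p]
    (hp : p (Ico (0 : ℝ) 1)ᶜ = 0) {A : Set ℝ} (hA : MeasurableSet A) :
    p.real A = ∑ i ∈ Finset.range R, p.real (A ∩ Ico (X (w i)) (X (w (i + 1)))) := by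
  have key : ∀ r ≤ R, p.real (A ∩ Ico 0 (X (w r))) =
      ∑ i ∈ Finset.range r, p.real (A ∩ Ico (X (w i)) (X (w (i + 1)))) := by
    intro r
    induction r with
    | zero => intro _; simp [h0, h.zero]
    | succ r ih =>
      intro hr
      rw [Finset.sum_range_succ, ← ih (by omega), ← measureReal_union _ (hA.inter measurableSet_Ico),
        ← inter_union_distrib_left, Ico_union_Ico_eq_Ico]
      · rw [← h.zero]; exact h.mono (Nat.zero_le _) (hle _ (by omega))
      · exact h.mono (hlt r hr).le (hle _ hr)
      · exact Ico_disjoint_Ico_same.mono inter_subset_right inter_subset_right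
  rw [← key R le_rfl, hR, h.one]
  refine measureReal_congr ?_
  have : (Ico (0 : ℝ) 1) =ᵐ[p] univ := by
    rw [ae_eq_univ]; exact hp
  have h2 : (A ∩ Ico (0 : ℝ) 1 : Set ℝ) =ᵐ[p] (A ∩ univ : Set ℝ) :=
    (Filter.EventuallyEq.refl _ A).inter this
  rw [inter_univ] at h2
  exact h2.symm

/-- For two densities constant on an interval, the worst subset is the interval itself. -/
theorem abs_mul_sub_mul_le {H q a d : ℝ} (ha : 0 ≤ a) (had : a ≤ d) :
    |H * a - q * a| ≤ |H * d - q * d| := by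
  rw [← sub_mul, ← sub_mul, abs_mul, abs_mul, abs_of_nonneg ha, abs_of_nonneg (ha.trans had)]
  exact mul_le_mul_of_nonneg_left had (abs_nonneg _)

/-- The flattening of a greedy partition with at most `4 * k` pieces is close to every `k`-flat
distribution from which the sample deviates little. -/
theorem IsGreedy.dTV_le {e : Set ℝ → ℝ} {X : ℕ → ℝ} {N : ℕ → ℕ} {n m : ℕ} {τ : ℝ} {l : ℕ}
    {v : ℕ → ℕ} (hv : IsGreedy X N n m τ l v) (h : IsGridWeight e X N n m) (hτ : 0 ≤ τ) {k : ℕ}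
    {b c : ℕ → ℝ} (hq : IsHistogram k b c) {G : ℝ}
    (hG : IntervalDeviationLE e (histMeasure k b c).real (7 * k) G) (hl : l ≤ 4 * k)
    {b' c' : ℕ → ℝ} (hf : IsFlattening X N n l v b' c') :
    dTV (histMeasure l b' c') (histMeasure k b c) ≤ 21 * (k * τ) + 3 * G := by
  classical
  have hh := h.isHistogram hv hf
  have ih := hh.isProbabilityMeasure
  have iq := hq.isProbabilityMeasure
  set p := histMeasure l b' c' with hp
  set q := histMeasure k b c with hqdef
  have hn : (0 : ℝ) < n := by exact_mod_cast h.n_pos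
  let cell : ℕ → Set ℝ := fun j => Ico (X j) (X (j + 1))
  -- The grid cells in which `q` may jump.
  let Bad := (Finset.range m).filter fun j => ∃ r < k, b r ∈ cell j
  have hBad : Bad.card ≤ k := by
    refine card_filter_exists_mem_le _ b (h.pairwiseDisjoint_Ico (s := fun j => j)
      (t := fun j => j + 1) (fun i hi => ?_) (fun i _ j _ hij => hij) fun i _ => Nat.le_succ i)
    exact Finset.mem_range.1 (Finset.mem_coe.1 hi)
  -- Both ends of each bad cell are cut points, so that such a cell is a part by itself.
  let T := ((Finset.range (l + 1)).image v ∪ Bad) ∪ Bad.image Nat.succ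
  have hvT : ∀ i ≤ l, v i ∈ T := fun i hi => Finset.mem_union_left _ (Finset.mem_union_left _
    (Finset.mem_image_of_mem _ (Finset.mem_range.2 (Nat.lt_succ_of_le hi))))
  have hBT : ∀ j ∈ Bad, j ∈ T := fun j hj =>
    Finset.mem_union_left _ (Finset.mem_union_right _ hj)
  have hBT' : ∀ j ∈ Bad, j + 1 ∈ T := fun j hj =>
    Finset.mem_union_right _ (Finset.mem_image_of_mem _ hj)
  have hTcard : T.card ≤ l + 1 + k + k := by
    refine (Finset.card_union_le _ _).trans (add_le_add ((Finset.card_union_le _ _).trans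
      (add_le_add ?_ hBad)) (Finset.card_image_le.trans hBad))
    exact Finset.card_image_le.trans_eq (Finset.card_range _)
  have hTm : ∀ t ∈ T, t ≤ m := by
    intro t ht
    rcases Finset.mem_union.1 ht with ht | ht
    · rcases Finset.mem_union.1 ht with ht | ht
      · obtain ⟨i, hi, rfl⟩ := Finset.mem_image.1 ht
        exact hv.le_last (Nat.lt_succ_iff.1 (Finset.mem_range.1 hi))
      · exact (Finset.mem_range.1 (Finset.mem_filter.1 ht).1).le
    · obtain ⟨j, hj, rfl⟩ := Finset.mem_image.1 ht
      exact Finset.mem_range.1 (Finset.mem_filter.1 hj).1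
  obtain ⟨R, w, hRT, hw0, hwR, hwlt, hwT, hwnext⟩ := exists_enumeration T
    (hv.zero ▸ hvT 0 (Nat.zero_le _)) (hv.last ▸ hvT l le_rfl) hTm
  have hwm : ∀ i ≤ R, w i ≤ m := fun i hi => hTm _ (hwT i hi)
  -- There are at most `l + 1 + 2 * k` cut points, so in fact `R ≤ 6 * k`.
  have hR7 : R ≤ 7 * k := by omega
  have hwmono : ∀ i j, i ≤ j → j ≤ R → w i ≤ w j := by
    intro i j hij
    induction j, hij using Nat.le_induction with
    | base => exact fun _ => le_rfl
    | succ j hij ih => exact fun hj => (ih (by omega)).trans (hwlt j hj).le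
  let W : ℕ → Set ℝ := fun i => Ico (X (w i)) (X (w (i + 1)))
  have hWdis : (Finset.range R : Set ℕ).PairwiseDisjoint W := by
    refine h.pairwiseDisjoint_Ico (s := w) (t := fun i => w (i + 1)) (fun i hi => ?_)
      (fun i hi j hj hij => ?_) (fun i hi => ?_)
    · exact hwm _ (Finset.mem_range.1 (Finset.mem_coe.1 hi))
    · exact hwmono _ _ hij (Finset.mem_range.1 (Finset.mem_coe.1 hj)).le
    · exact (hwlt i (Finset.mem_range.1 (Finset.mem_coe.1 hi))).le
  let J₁ : ℕ → Set ℝ := fun i => if i < R then W i else ∅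
  -- The left endpoints of the bad cells, as degenerate intervals; they detect sample weight that
  -- `q` cannot match.
  let J₂ : ℕ → Set ℝ := fun i => if i < R ∧ w i ∈ Bad then {X (w i)} else ∅
  have hXW : ∀ i < R, X (w i) ∈ W i := fun i hi =>
    ⟨le_rfl, h.lt _ _ (hwlt i hi) (hwm (i + 1) hi)⟩
  have hJ₂W : ∀ i, i < R → J₂ i ⊆ W i := by
    intro i hi
    simp only [J₂]
    split_ifs
    · exact singleton_subset_iff.2 (hXW i hi)
    · exact empty_subset _
  have dis : ∀ J : ℕ → Set ℝ, (∀ i < R, J i ⊆ W i) → (∀ i, ¬ i < R → J i = ∅) →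
      (Finset.range (7 * k) : Set ℕ).PairwiseDisjoint J := by
    intro J hJ hJ0 i _ j _ hij
    by_cases hi : i < R
    · by_cases hj : j < R
      · exact (hWdis (Finset.mem_coe.2 (Finset.mem_range.2 hi))
          (Finset.mem_coe.2 (Finset.mem_range.2 hj)) hij).mono (hJ i hi) (hJ j hj)
      · simp [Function.onFun, hJ0 j hj]
    · simp [Function.onFun, hJ0 i hi]
  have hG₁ : ∑ i ∈ Finset.range R, |e (W i) - q.real (W i)| ≤ G := by
    refine le_trans (le_trans (le_of_eq ?_) (Finset.sum_le_sum_of_subset_of_nonneg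
      (Finset.range_mono hR7) fun i _ _ => abs_nonneg (e (J₁ i) - q.real (J₁ i))))
      (hG J₁ (fun i _ => ?_) (dis J₁ (fun i hi => by simp [J₁, hi]) fun i hi => by simp [J₁, hi]))
    · exact Finset.sum_congr rfl fun i hi => by
        simp only [J₁, if_pos (Finset.mem_range.1 hi)]
    · simp only [J₁]; split_ifs
      · exact ordConnected_Ico
      · exact ordConnected_empty
  have hG₂ : ∑ i ∈ Finset.range R, |e (J₂ i) - q.real (J₂ i)| ≤ G := by
    refine le_trans (Finset.sum_le_sum_of_subset_of_nonneg
      (Finset.range_mono hR7) fun i _ _ => abs_nonneg (e (J₂ i) - q.real (J₂ i)))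
      (hG J₂ (fun i _ => ?_) (dis J₂ hJ₂W fun i hi => by simp [J₂, hi]))
    simp only [J₂]; split_ifs
    · exact ordConnected_singleton
    · exact ordConnected_empty
  have main : ∀ A, MeasurableSet A → ∀ i < R, |p.real (A ∩ W i) - q.real (A ∩ W i)| ≤
      3 * τ + |e (W i) - q.real (W i)| + 2 * |e (J₂ i) - q.real (J₂ i)| := by
    intro A hA i hi
    have hwi := hwlt i hi
    have hwi' := hwm (i + 1) hi
    have hAW : MeasurableSet (A ∩ W i) := hA.inter measurableSet_Ico
    obtain ⟨a, -, ha, ha1, ha2⟩ := exists_step_of_le_of_lt v (Nat.zero_le l)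
      (x := w i) (by rw [hv.zero]; exact Nat.zero_le _) (by rw [hv.last]; omega)
    have ha3 : w (i + 1) ≤ v (a + 1) := hwnext i hi _ (hvT _ ha) ha2
    have hva := hv.lt a ha
    have hvm : v (a + 1) ≤ m := hv.le_last ha
    have hb1 : b' a ≤ X (w i) := by
      rw [hf.break_eq a ha.le]; exact h.mono ha1 (by omega)
    have hb2 : X (w (i + 1)) ≤ b' (a + 1) := by
      rw [hf.break_eq (a + 1) ha]; exact h.mono ha3 hvm
    have hpW : p.real (W i) = c' a * (X (w (i + 1)) - X (w i)) :=
      hh.histMeasure_real_Ico ha (h.mono hwi.le hwi') hb1 hb2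
    have heW : e (W i) = ((N (w (i + 1)) : ℝ) - N (w i)) / n := h.weight _ _ hwi.le hwi'
    have hpe : |e (W i) - p.real (W i)| ≤ 3 * τ := by
      rw [hpW, heW, hf.height_eq a ha]
      exact h.abs_weight_sub_le (hv.feasible a ha) hτ hva hvm ha1 hwi.le ha3
    -- In a bad cell the masses of both distributions are compared with `e (W i)`, which equals the
    -- deviation of `e` from `q` at the atom because `q` has none.
    by_cases hbad : w i ∈ Bad
    · have hnext : w (i + 1) = w i + 1 :=
        le_antisymm (hwnext i hi _ (hBT' _ hbad) (Nat.lt_succ_self _)) hwi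
      have hJ : J₂ i = {X (w i)} := by simp only [J₂, if_pos (And.intro hi hbad)]
      have hat : e (J₂ i) = e (W i) := by
        rw [hJ]; simp only [W, hnext]; exact (h.atom _ (by omega)).symm
      have hqJ : q.real (J₂ i) = 0 := by rw [hJ]; exact IsHistogram.histMeasure_real_singleton _
      have h1 : p.real (A ∩ W i) ≤ p.real (W i) := measureReal_mono inter_subset_right
      have h2 : q.real (A ∩ W i) ≤ q.real (W i) := measureReal_mono inter_subset_right
      have h3 : 0 ≤ p.real (A ∩ W i) := measureReal_nonneg
      have h4 : 0 ≤ q.real (A ∩ W i) := measureReal_nonneg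
      have h5 := neg_le_abs (e (W i) - p.real (W i))
      have h6 := neg_le_abs (e (W i) - q.real (W i))
      have h7 := le_abs_self (e (W i))
      have h8 := abs_nonneg (e (W i) - q.real (W i))
      have h9 := abs_nonneg (e (W i))
      rw [hat, hqJ, sub_zero]
      rw [abs_le]
      constructor <;> linarith
    -- A breakpoint inside the part would lie in some bad cell, whose left end would be a cut point:
    -- the left end of this part or one in its interior. Both are excluded.
    · have hnb : ∀ r < k, b r ∉ Ico (X (w i)) (X (w (i + 1))) := by
        intro r hr hmem
        obtain ⟨j, hj1, hj2, hj3⟩ := exists_step_of_le_of_lt X hwi.le hmem.1 hmem.2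
        have hjB : j ∈ Bad := Finset.mem_filter.2 ⟨Finset.mem_range.2 (by omega), r, hr, hj3⟩
        rcases hj1.lt_or_eq with hj1 | rfl
        · exact absurd (hwnext i hi j (hBT j hjB) hj1) (by omega)
        · exact hbad hjB
      obtain ⟨r, hr, hr1, hr2⟩ := h.exists_piece hq hwi hwi' hnb
      have hqW : q.real (W i) = c r * (X (w (i + 1)) - X (w i)) :=
        hq.histMeasure_real_Ico hr (h.mono hwi.le hwi') hr1 hr2
      have h1 : p.real (A ∩ W i) = c' a * volume.real (A ∩ W i) :=
        hh.histMeasure_real ha hAW (inter_subset_right.trans (Ico_subset_Ico hb1 hb2))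
      have h2 : q.real (A ∩ W i) = c r * volume.real (A ∩ W i) :=
        hq.histMeasure_real hr hAW (inter_subset_right.trans (Ico_subset_Ico hr1 hr2))
      have h3 : volume.real (A ∩ W i) ≤ X (w (i + 1)) - X (w i) := by
        rw [← Real.volume_real_Ico_of_le (h.mono hwi.le hwi')]
        exact measureReal_mono inter_subset_right (by simp)
      have h4 : |p.real (A ∩ W i) - q.real (A ∩ W i)| ≤ |p.real (W i) - q.real (W i)| := by
        rw [h1, h2, hpW, hqW]
        exact abs_mul_sub_mul_le measureReal_nonneg h3
      have h5 := abs_sub_le (p.real (W i)) (e (W i)) (q.real (W i))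
      rw [abs_sub_comm (p.real (W i)) (e (W i))] at h5
      have h6 := abs_nonneg (e (J₂ i) - q.real (J₂ i))
      linarith
  refine _root_.dTV_le fun A hA => ?_
  have eA : p.real A - q.real A =
      ∑ i ∈ Finset.range R, (p.real (A ∩ W i) - q.real (A ∩ W i)) := by
    rw [Finset.sum_sub_distrib]
    exact congrArg₂ _ (h.real_eq_sum hw0 hwR hwlt hwm hh.histMeasure_compl hA)
      (h.real_eq_sum hw0 hwR hwlt hwm hq.histMeasure_compl hA)
  rw [eA]
  have hRk : (R : ℝ) ≤ 7 * k := by exact_mod_cast hR7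
  calc _ ≤ ∑ i ∈ Finset.range R, |p.real (A ∩ W i) - q.real (A ∩ W i)| :=
        Finset.abs_sum_le_sum_abs _ _
    _ ≤ ∑ i ∈ Finset.range R, (3 * τ + |e (W i) - q.real (W i)| +
        2 * |e (J₂ i) - q.real (J₂ i)|) :=
        Finset.sum_le_sum fun i hi => main A hA i (Finset.mem_range.1 hi)
    _ = R * (3 * τ) + ∑ i ∈ Finset.range R, |e (W i) - q.real (W i)| +
        2 * ∑ i ∈ Finset.range R, |e (J₂ i) - q.real (J₂ i)| := by
        rw [Finset.sum_add_distrib, Finset.sum_add_distrib, Finset.mul_sum]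
        simp
    _ ≤ 7 * k * (3 * τ) + G + 2 * G := by
        have := mul_le_mul_of_nonneg_right hRk (show 0 ≤ 3 * τ by linarith)
        linarith
    _ = _ := by ring

/-! ## Uniform convergence of the empirical distribution on unions of intervals -/

/-- The empirical distribution of the first `n` sample points. -/
noncomputable def empirical (ω : ℕ → ℝ) (n : ℕ) : Measure ℝ :=
  (n : ENNReal)⁻¹ • ∑ i ∈ Finset.range n, Measure.dirac (ω i)

theorem empirical_real (ω : ℕ → ℝ) (n : ℕ) {A : Set ℝ} (hA : MeasurableSet A) :
    (empirical ω n).real A = (∑ i ∈ Finset.range n, A.indicator (fun _ => (1 : ℝ)) (ω i)) / n := by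
  have h : ∀ x : ℝ, (A.indicator (1 : ℝ → ENNReal) x).toReal = A.indicator (fun _ => (1 : ℝ)) x := by
    intro x
    by_cases hx : x ∈ A <;> simp [hx]
  rw [Measure.real, empirical, Measure.smul_apply, Measure.finsetSum_apply, smul_eq_mul,
    ENNReal.toReal_mul, ENNReal.toReal_inv, ENNReal.toReal_natCast, ENNReal.toReal_sum,
    div_eq_inv_mul]
  · refine congrArg _ (Finset.sum_congr rfl fun i _ => ?_)
    rw [Measure.dirac_apply' _ hA, h]
  · exact fun i _ => measure_ne_top _ _

instance (ω : ℕ → ℝ) (n : ℕ) : IsFiniteMeasure (empirical ω n) := by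
  refine ⟨?_⟩
  rcases Nat.eq_zero_or_pos n with rfl | hn
  · simp [empirical]
  · rw [empirical, Measure.smul_apply, smul_eq_mul]
    exact ENNReal.mul_lt_top (ENNReal.inv_lt_top.2 (by exact_mod_cast hn)) (measure_lt_top _ _)

section Hoeffding

variable {p : Measure ℝ} [IsProbabilityMeasure p]

/-- Hoeffding: an indicator takes values in `[0,1]`, so after centring it is sub-Gaussian with
variance proxy `1 / 4`. -/
theorem measure_empirical_ge_le {A : Set ℝ} (hA : MeasurableSet A) {n : ℕ} (hn : 0 < n) {δ : ℝ}
    (hδ : 0 ≤ δ) :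
    (Measure.infinitePi fun _ : ℕ => p).real {ω | δ ≤ (empirical ω n).real A - p.real A} ≤
      Real.exp (-(2 * n * δ ^ 2)) := by
  have hn0 : (0 : ℝ) < n := by exact_mod_cast hn
  let g : ℝ → ℝ := A.indicator fun _ => (1 : ℝ)
  have hg : Measurable g := measurable_const.indicator hA
  have hg01 : ∀ x, g x ∈ Icc (0 : ℝ) 1 := fun x => by
    by_cases hx : x ∈ A <;> simp [g, hx]
  have hint : ∫ x, g x ∂p = p.real A := by
    simp only [g]
    rw [integral_indicator_const _ hA, smul_eq_mul, mul_one]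
  have hindep := ProbabilityTheory.iIndepFun_infinitePi (P := fun _ : ℕ => p)
    (X := fun _ x => g x - p.real A) (fun _ => hg.sub_const _)
  have hsub : ∀ i < n, ProbabilityTheory.HasSubgaussianMGF (fun ω : ℕ → ℝ => g (ω i) - p.real A)
      ((‖(1 : ℝ) - 0‖₊ / 2) ^ 2) (Measure.infinitePi fun _ : ℕ => p) := by
    intro i _
    have h1 : ∫ ω : ℕ → ℝ, g (ω i) ∂(Measure.infinitePi fun _ : ℕ => p) = p.real A := by
      rw [← hint]
      have := (measurePreserving_eval_infinitePi (fun _ : ℕ => p) i).map_eq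
      conv_rhs => rw [← this]
      rw [integral_map (measurable_pi_apply i).aemeasurable hg.aestronglyMeasurable]
    have h2 := ProbabilityTheory.hasSubgaussianMGF_of_mem_Icc (a := 0) (b := 1)
      (μ := Measure.infinitePi fun _ : ℕ => p) (X := fun ω : ℕ → ℝ => g (ω i))
      (hg.comp (measurable_pi_apply i)).aemeasurable
      (Filter.Eventually.of_forall fun ω => hg01 _)
    rwa [h1] at h2
  have key := ProbabilityTheory.HasSubgaussianMGF.measure_sum_range_ge_le_of_iIndepFun hindep hsub
    (ε := n * δ) (by positivity)
  have hset : {ω : ℕ → ℝ | n * δ ≤ ∑ i ∈ Finset.range n, (g (ω i) - p.real A)} =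
      {ω | δ ≤ (empirical ω n).real A - p.real A} := by
    ext ω
    rw [mem_ofPred_eq, mem_ofPred_eq]
    rw [empirical_real ω n hA, Finset.sum_sub_distrib, Finset.sum_const, Finset.card_range,
      nsmul_eq_mul, le_sub_iff_add_le, le_sub_iff_add_le, le_div_iff₀ hn0]
    constructor <;> intro h <;> linarith
  rw [hset] at key
  refine key.trans (le_of_eq ?_)
  congr 1
  simp
  field_simp
  try norm_num

/-- The lower tail for `A` is the upper tail for its complement. -/
theorem measure_abs_empirical_ge_le {A : Set ℝ} (hA : MeasurableSet A) {n : ℕ} (hn : 0 < n)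
    {δ : ℝ} (hδ : 0 ≤ δ) :
    (Measure.infinitePi fun _ : ℕ => p).real {ω | δ ≤ |(empirical ω n).real A - p.real A|} ≤
      2 * Real.exp (-(2 * n * δ ^ 2)) := by
  have hn0 : (0 : ℝ) < n := by exact_mod_cast hn
  have h1 := measure_empirical_ge_le (p := p) hA hn hδ
  have h2 := measure_empirical_ge_le (p := p) hA.compl hn hδ
  have huniv : ∀ ω, (empirical ω n).real univ = 1 := fun ω => by
    rw [empirical_real ω n MeasurableSet.univ]
    simp [hn0.ne']
  refine (measureReal_mono (s₂ := {ω | δ ≤ (empirical ω n).real A - p.real A} ∪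
    {ω | δ ≤ (empirical ω n).real Aᶜ - p.real Aᶜ}) ?_).trans
    ((measureReal_union_le _ _).trans (by linarith))
  intro ω hω
  rw [mem_ofPred_eq] at hω
  rcases le_abs.1 hω with h | h
  · exact Or.inl h
  · refine Or.inr ?_
    show δ ≤ (empirical ω n).real Aᶜ - p.real Aᶜ
    have e1 := measureReal_compl (μ := empirical ω n) hA
    have e2 := measureReal_compl (μ := p) hA
    rw [huniv ω] at e1
    rw [probReal_univ] at e2
    linarith

/-- Divide the line into at most `2 * M + 1` cells, which are points or have mass at most `1 / M`. -/
noncomputable def cellIndex (p : Measure ℝ) (M : ℕ) (x : ℝ) : ℕ :=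
  ⌊(M : ℝ) * p.real (Iic x)⌋₊ + ⌊(M : ℝ) * p.real (Iio x)⌋₊

theorem cellIndex_left_mono (p : Measure ℝ) [IsProbabilityMeasure p] (M : ℕ) :
    Monotone fun x => ⌊(M : ℝ) * p.real (Iic x)⌋₊ := fun _ _ hxy =>
  Nat.floor_le_floor (mul_le_mul_of_nonneg_left (measureReal_mono (Iic_subset_Iic.2 hxy))
    (Nat.cast_nonneg _))

theorem cellIndex_right_mono (p : Measure ℝ) [IsProbabilityMeasure p] (M : ℕ) :
    Monotone fun x => ⌊(M : ℝ) * p.real (Iio x)⌋₊ := fun _ _ hxy =>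
  Nat.floor_le_floor (mul_le_mul_of_nonneg_left (measureReal_mono (Iio_subset_Iio hxy))
    (Nat.cast_nonneg _))

theorem cellIndex_mono (p : Measure ℝ) [IsProbabilityMeasure p] (M : ℕ) :
    Monotone (cellIndex p M) :=
  fun _ _ hxy => add_le_add (cellIndex_left_mono p M hxy) (cellIndex_right_mono p M hxy)

theorem cellIndex_le (p : Measure ℝ) [IsProbabilityMeasure p] (M : ℕ) (x : ℝ) :
    cellIndex p M x ≤ 2 * M := by
  have h : ∀ A : Set ℝ, ⌊(M : ℝ) * p.real A⌋₊ ≤ M := fun A => by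
    refine Nat.floor_le_of_le ?_
    exact mul_le_of_le_one_right (Nat.cast_nonneg _) measureReal_le_one
  have h1 := h (Iic x)
  have h2 := h (Iio x)
  unfold cellIndex
  omega

theorem measurableSet_preimage_cellIndex (p : Measure ℝ) [IsProbabilityMeasure p] (M : ℕ)
    (I : Set ℕ) : MeasurableSet (cellIndex p M ⁻¹' I) :=
  (cellIndex_mono p M).measurable (MeasurableSet.of_discrete)

/-- If `x < y` have the same index, monotonicity of both floors makes the floors of `M * p (Iio x)`
and `M * p (Iic y)` equal, so `p (Icc x y)` is at most `1 / M`. This is why the index uses open and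
closed half-lines: it isolates heavy atoms. -/
theorem real_cell_le {M : ℕ} (hM : 0 < M) {i : ℕ}
    (hi : ¬ (cellIndex p M ⁻¹' {i}).Subsingleton) :
    p.real (cellIndex p M ⁻¹' {i}) ≤ 1 / M := by
  have hM0 : (0 : ℝ) < M := by exact_mod_cast hM
  have key : ∀ x y, cellIndex p M x = i → cellIndex p M y = i → x < y →
      p.real (Icc x y) ≤ 1 / M := by
    intro x y hx hy hxy
    have h1 := cellIndex_left_mono p M hxy.le
    have h2 := cellIndex_right_mono p M hxy.le
    have h3 : ⌊(M : ℝ) * p.real (Iio x)⌋₊ ≤ ⌊(M : ℝ) * p.real (Iic x)⌋₊ :=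
      Nat.floor_le_floor (mul_le_mul_of_nonneg_left (measureReal_mono Iio_subset_Iic_self) hM0.le)
    have h4 : ⌊(M : ℝ) * p.real (Iic x)⌋₊ ≤ ⌊(M : ℝ) * p.real (Iio y)⌋₊ :=
      Nat.floor_le_floor (mul_le_mul_of_nonneg_left
        (measureReal_mono fun z hz => lt_of_le_of_lt hz hxy) hM0.le)
    simp only at h1 h2
    unfold cellIndex at hx hy
    have h5 : ⌊(M : ℝ) * p.real (Iic y)⌋₊ = ⌊(M : ℝ) * p.real (Iio x)⌋₊ := by omega
    have h6 : (M : ℝ) * p.real (Iic y) < ⌊(M : ℝ) * p.real (Iic y)⌋₊ + 1 := Nat.lt_floor_add_one _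
    have h7 : (⌊(M : ℝ) * p.real (Iio x)⌋₊ : ℝ) ≤ M * p.real (Iio x) :=
      Nat.floor_le (by positivity)
    rw [h5] at h6
    have h8 : p.real (Icc x y) = p.real (Iic y) - p.real (Iio x) := by
      have hsub : Iio x ⊆ Iic y := fun z hz => (lt_trans hz hxy).le
      rw [← measureReal_sdiff hsub measurableSet_Iio]
      congr 1
      ext z
      simp
    rw [h8, le_div_iff₀ hM0]
    linarith
  have hm : MeasurableSet (cellIndex p M ⁻¹' {i}) := measurableSet_preimage_cellIndex p M _
  -- A cell need not contain its endpoints, but a compact subset lies between two of its own points;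
  -- inner regularity does the rest.
  have hcompact : ∀ K ⊆ cellIndex p M ⁻¹' {i}, IsCompact K → p K ≤ ENNReal.ofReal (1 / M) := by
    intro K hK hKc
    rw [← ENNReal.ofReal_toReal (measure_ne_top p K)]
    refine ENNReal.ofReal_le_ofReal ?_
    change p.real K ≤ 1 / M
    rcases K.eq_empty_or_nonempty with rfl | hne
    · simp
    have h1 := hK (hKc.sInf_mem hne)
    have h2 := hK (hKc.sSup_mem hne)
    have hsub : K ⊆ Icc (sInf K) (sSup K) := fun x hx =>
      ⟨csInf_le hKc.bddBelow hx, le_csSup hKc.bddAbove hx⟩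
    have hle : sInf K ≤ sSup K := by
      obtain ⟨x, hx⟩ := hne
      exact (hsub hx).1.trans (hsub hx).2
    rcases hle.lt_or_eq with h3 | h3
    · exact (measureReal_mono hsub).trans (key _ _ h1 h2 h3)
    -- Here `K` is a single point, and an interval that joins it to another point of the cell bounds
    -- its mass.
    · obtain ⟨x, hx, y, hy, hxy⟩ := Set.not_subsingleton_iff.1 hi
      have hsub' : K ⊆ {sInf K} := fun z hz => by
        have := hsub hz
        rw [← h3, Icc_self] at this
        exact this
      have : ∃ z, cellIndex p M z = i ∧ z ≠ sInf K := by
        by_cases hxs : x = sInf K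
        · exact ⟨y, hy, fun h => hxy (hxs.trans h.symm)⟩
        · exact ⟨x, hx, hxs⟩
      obtain ⟨z, hz, hzs⟩ := this
      rcases lt_or_gt_of_ne hzs with h4 | h4
      · exact (measureReal_mono (hsub'.trans (singleton_subset_iff.2 (mem_Icc.2 ⟨h4.le, le_rfl⟩)))).trans
          (key _ _ hz h1 h4)
      · exact (measureReal_mono (hsub'.trans (singleton_subset_iff.2 (mem_Icc.2 ⟨le_rfl, h4.le⟩)))).trans
          (key _ _ h1 hz h4)
  have : p (cellIndex p M ⁻¹' {i}) ≤ ENNReal.ofReal (1 / M) := by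
    rw [hm.measure_eq_iSup_isCompact]
    exact iSup_le fun K => iSup_le fun hK => iSup_le fun hKc => hcompact K hK hKc
  exact ENNReal.toReal_le_of_le_ofReal (by positivity) this

/-- An interval is sandwiched between two unions of consecutive cells. -/
theorem exists_cells {M : ℕ} (hM : 0 < M) {J : Set ℝ} (hJ : J.OrdConnected) :
    ∃ a b a' b' : ℕ, a < 2 * M + 2 ∧ b < 2 * M + 2 ∧ a' < 2 * M + 2 ∧ b' < 2 * M + 2 ∧
      cellIndex p M ⁻¹' Ico a' b' ⊆ J ∧ J ⊆ cellIndex p M ⁻¹' Ico a b ∧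
      p.real (cellIndex p M ⁻¹' Ico a b \ cellIndex p M ⁻¹' Ico a' b') ≤ 2 / M := by
  classical
  set φ := cellIndex p M with hφ
  have hmono : Monotone φ := cellIndex_mono p M
  rcases J.eq_empty_or_nonempty with rfl | hne
  · exact ⟨0, 0, 0, 0, by omega, by omega, by omega, by omega, by simp, by simp,
      by simp; positivity⟩
  have hne' : (φ '' J).Nonempty := hne.image φ
  have hbdd : BddAbove (φ '' J) := ⟨2 * M, by rintro _ ⟨x, -, rfl⟩; exact cellIndex_le p M x⟩
  obtain ⟨xa, hxa, ha⟩ := Nat.sInf_mem hne'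
  obtain ⟨xb, hxb, hb⟩ := Nat.sSup_mem hne' hbdd
  set a := sInf (φ '' J)
  set b := sSup (φ '' J)
  have ha2 : a ≤ 2 * M := ha ▸ cellIndex_le p M xa
  have hb2 : b ≤ 2 * M := hb ▸ cellIndex_le p M xb
  -- A cell that meets `J` but is not contained in it cannot be a single point, so it is light.
  have hcell : ∀ x ∈ J, ¬ φ ⁻¹' {φ x} ⊆ J → p.real (φ ⁻¹' {φ x}) ≤ 1 / M := by
    intro x hx hsub
    refine real_cell_le hM fun hss => hsub fun y hy => ?_
    rwa [hss hy (rfl : φ x = φ x)]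
  have hM0 : (0 : ℝ) < M := by exact_mod_cast hM
  -- Only the two extreme cells can stick out of `J`, by convexity; the inner run leaves out those
  -- that do.
  refine ⟨a, b + 1, if φ ⁻¹' {a} ⊆ J then a else a + 1, if φ ⁻¹' {b} ⊆ J then b + 1 else b,
    by omega, by omega, by split_ifs <;> omega, by split_ifs <;> omega, ?_, ?_, ?_⟩
  · rintro y ⟨hy1, hy2⟩
    by_cases hya : φ y = a
    · split_ifs at hy1 with h
      · exact h hya
      · omega
    by_cases hyb : φ y = b
    · split_ifs at hy2 with h
      · exact h hyb
      · omega
    have h1 : a < φ y := by split_ifs at hy1 <;> omega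
    have h2 : φ y < b := by split_ifs at hy2 <;> omega
    refine hJ.out hxa hxb ⟨?_, ?_⟩
    · exact (hmono.reflect_lt (ha.trans_lt h1)).le
    · exact (hmono.reflect_lt (h2.trans_eq hb.symm)).le
  · intro x hx
    exact ⟨Nat.sInf_le (mem_image_of_mem φ hx),
      Nat.lt_succ_of_le (le_csSup hbdd (mem_image_of_mem φ hx))⟩
  · have hsub : φ ⁻¹' Ico a (b + 1) \ φ ⁻¹' Ico (if φ ⁻¹' {a} ⊆ J then a else a + 1)
        (if φ ⁻¹' {b} ⊆ J then b + 1 else b) ⊆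
        (if φ ⁻¹' {a} ⊆ J then ∅ else φ ⁻¹' {a}) ∪ (if φ ⁻¹' {b} ⊆ J then ∅ else φ ⁻¹' {b}) := by
      rintro y ⟨⟨hy1, hy2⟩, hy3⟩
      by_contra hcon
      refine hy3 ⟨?_, ?_⟩
      · split_ifs with h
        · exact hy1
        · rw [if_neg h] at hcon
          have : φ y ≠ a := fun h' => hcon (Or.inl h')
          omega
      · split_ifs with h
        · exact hy2
        · rw [if_neg h] at hcon
          have : φ y ≠ b := fun h' => hcon (Or.inr h')
          omega
    refine (measureReal_mono hsub).trans ((measureReal_union_le _ _).trans ?_)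
    have h0 : (0 : ℝ) ≤ 1 / M := by positivity
    have e1 : p.real (if φ ⁻¹' {a} ⊆ J then ∅ else φ ⁻¹' {a}) ≤ 1 / M := by
      split_ifs with h
      · simp
      · rw [← ha] at h ⊢; exact hcell xa hxa h
    have e2 : p.real (if φ ⁻¹' {b} ⊆ J then ∅ else φ ⁻¹' {b}) ≤ 1 / M := by
      split_ifs with h
      · simp
      · rw [← hb] at h ⊢; exact hcell xb hxb h
    calc _ ≤ (1 : ℝ) / M + 1 / M := add_le_add e1 e2
      _ = 2 / M := by ring

/-- The union of `K` runs of cells. -/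
def cellUnion (p : Measure ℝ) (M K : ℕ) (f : Fin K → Fin (2 * M + 2) × Fin (2 * M + 2)) : Set ℝ :=
  ⋃ i, cellIndex p M ⁻¹' Ico ((f i).1 : ℕ) ((f i).2 : ℕ)

theorem measurableSet_cellUnion {M K : ℕ} (f : Fin K → Fin (2 * M + 2) × Fin (2 * M + 2)) :
    MeasurableSet (cellUnion p M K f) :=
  MeasurableSet.iUnion fun _ => measurableSet_preimage_cellIndex p M _

/-- Deviations on the unions of cells control the deviations on all unions of intervals. -/
theorem intervalDeviationLE_of_cellUnion {M K : ℕ} (hM : 0 < M) {e : Measure ℝ}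
    [IsFiniteMeasure e] {δ : ℝ}
    (h : ∀ f, |e.real (cellUnion p M K f) - p.real (cellUnion p M K f)| ≤ δ) :
    IntervalDeviationLE e.real p.real K (2 * (δ + K * (2 / M))) := by
  classical
  intro J hJ hd
  refine sum_abs_sub_le (fun i hi => (hJ i hi).measurableSet) hd fun s hs => ?_
  -- Indices outside `s` receive empty runs, so that every subfamily is covered by unions of exactly
  -- `K` runs.
  have hex : ∀ i : Fin K, ∃ F F' : Fin (2 * M + 2) × Fin (2 * M + 2),
      (i.1 ∈ s → cellIndex p M ⁻¹' Ico (F'.1 : ℕ) F'.2 ⊆ J i) ∧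
      (i.1 ∈ s → J i ⊆ cellIndex p M ⁻¹' Ico (F.1 : ℕ) F.2) ∧
      (i.1 ∉ s → cellIndex p M ⁻¹' Ico (F'.1 : ℕ) F'.2 = ∅) ∧
      p.real (cellIndex p M ⁻¹' Ico (F.1 : ℕ) F.2 \ cellIndex p M ⁻¹' Ico (F'.1 : ℕ) F'.2) ≤
        2 / M := by
    intro i
    by_cases hi : i.1 ∈ s
    · obtain ⟨a, b, a', b', h1, h2, h3, h4, h5, h6, h7⟩ := exists_cells (p := p) hM (hJ i i.2)
      exact ⟨(⟨a, h1⟩, ⟨b, h2⟩), (⟨a', h3⟩, ⟨b', h4⟩), fun _ => h5, fun _ => h6,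
        fun h => absurd hi h, h7⟩
    · exact ⟨(0, 0), (0, 0), fun h => absurd h hi, fun h => absurd h hi, fun _ => by simp,
        by simp; positivity⟩
  choose F F' h1 h2 h3 h4 using hex
  set U := ⋃ i ∈ s, J i
  have hout : U ⊆ cellUnion p M K F := by
    intro x hx
    obtain ⟨i, hi, hx⟩ := mem_iUnion₂.1 hx
    exact mem_iUnion.2 ⟨⟨i, Finset.mem_range.1 (hs hi)⟩, h2 _ hi hx⟩
  have hin : cellUnion p M K F' ⊆ U := by
    intro x hx
    obtain ⟨i, hx⟩ := mem_iUnion.1 hx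
    by_cases hi : i.1 ∈ s
    · exact mem_iUnion₂.2 ⟨i, hi, h1 i hi hx⟩
    · rw [h3 i hi] at hx; exact hx.elim
  have hdiff : p.real (cellUnion p M K F \ cellUnion p M K F') ≤ K * (2 / M) := by
    have hsub : cellUnion p M K F \ cellUnion p M K F' ⊆ ⋃ i : Fin K,
        (cellIndex p M ⁻¹' Ico ((F i).1 : ℕ) (F i).2 \
          cellIndex p M ⁻¹' Ico ((F' i).1 : ℕ) (F' i).2) := by
      rintro x ⟨hx, hx'⟩
      obtain ⟨i, hx⟩ := mem_iUnion.1 hx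
      exact mem_iUnion.2 ⟨i, hx, fun hc => hx' (mem_iUnion.2 ⟨i, hc⟩)⟩
    refine (measureReal_mono hsub).trans ((measureReal_iUnion_fintype_le _).trans
      ((Finset.sum_le_sum fun i _ => h4 i).trans ?_))
    simp
  have hle : p.real (cellUnion p M K F) ≤ p.real (cellUnion p M K F') + K * (2 / M) := by
    rw [measureReal_sdiff (hin.trans hout) (measurableSet_cellUnion F')] at hdiff
    linarith
  have a1 := abs_le.1 (h F)
  have a2 := abs_le.1 (h F')
  have a3 : e.real U ≤ e.real (cellUnion p M K F) := measureReal_mono hout (measure_ne_top _ _)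
  have a4 : e.real (cellUnion p M K F') ≤ e.real U := measureReal_mono hin (measure_ne_top _ _)
  have a5 : p.real U ≤ p.real (cellUnion p M K F) := measureReal_mono hout (measure_ne_top _ _)
  have a6 : p.real (cellUnion p M K F') ≤ p.real U := measureReal_mono hin (measure_ne_top _ _)
  rw [abs_le]
  constructor <;> linarith [a1.1, a1.2, a2.1, a2.2]

/-- The union bound runs over the finitely many choices of `K` pairs of run ends, although there are
infinitely many families of intervals. -/
theorem measure_not_intervalDeviationLE_le {M K n : ℕ} (hM : 0 < M) (hn : 0 < n) {δ : ℝ}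
    (hδ : 0 ≤ δ) :
    (Measure.infinitePi fun _ : ℕ => p)
      {ω | ¬ IntervalDeviationLE (empirical ω n).real p.real K (2 * (δ + K * (2 / M)))} ≤
      ENNReal.ofReal ((2 * M + 2) ^ (2 * K) * (2 * Real.exp (-(2 * n * δ ^ 2)))) := by
  classical
  let B : (Fin K → Fin (2 * M + 2) × Fin (2 * M + 2)) → Set (ℕ → ℝ) := fun f =>
    {ω | δ ≤ |(empirical ω n).real (cellUnion p M K f) - p.real (cellUnion p M K f)|}
  have hsub : {ω | ¬ IntervalDeviationLE (empirical ω n).real p.real K (2 * (δ + K * (2 / M)))} ⊆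
      ⋃ f, B f := by
    intro ω hω
    by_contra hcon
    refine hω (intervalDeviationLE_of_cellUnion hM fun f => ?_)
    by_contra hf
    exact hcon (mem_iUnion.2 ⟨f, (not_le.1 hf).le⟩)
  have hreal : (Measure.infinitePi fun _ : ℕ => p).real (⋃ f, B f) ≤
      (2 * M + 2) ^ (2 * K) * (2 * Real.exp (-(2 * n * δ ^ 2))) := by
    refine (measureReal_iUnion_fintype_le _).trans ((Finset.sum_le_sum fun f _ =>
      measure_abs_empirical_ge_le (measurableSet_cellUnion f) hn hδ).trans (le_of_eq ?_))
    rw [Finset.sum_const, Finset.card_univ, nsmul_eq_mul, Fintype.card_fun, Fintype.card_prod,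
      Fintype.card_fin, Fintype.card_fin]
    push_cast
    rw [← pow_two, ← pow_mul]
  refine (measure_mono hsub).trans ?_
  rw [← ENNReal.ofReal_toReal (measure_ne_top _ (⋃ f, B f))]
  exact ENNReal.ofReal_le_ofReal hreal

end Hoeffding

/-! ## The learning theorem -/

theorem exists_least_two_pow_ge (x : ℝ) : ∃ L : ℕ, x ≤ 2 ^ L ∧ ∀ j < L, (2 : ℝ) ^ j < x := by
  classical
  have hex : ∃ L : ℕ, x ≤ 2 ^ L := by
    obtain ⟨L, hL⟩ := pow_unbounded_of_one_lt x (one_lt_two)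
    exact ⟨L, hL.le⟩
  exact ⟨Nat.find hex, Nat.find_spec hex, fun j hj => not_le.1 (Nat.find_min hex hj)⟩

theorem two_pow_le_of_minimal {x : ℝ} {L : ℕ} (hx : 1 ≤ x) (h : ∀ j < L, (2 : ℝ) ^ j < x) :
    (2 : ℝ) ^ L ≤ 2 * x := by
  rcases Nat.eq_zero_or_pos L with rfl | hL
  · rw [pow_zero]; linarith
  · have := h (L - 1) (by omega)
    rw [show L = L - 1 + 1 by omega, pow_succ]
    linarith

/-- The counts `N` identify the samples below a grid point by their rank. Since every sample is a
grid point, the weight of a cell sits at its left end. -/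
theorem IsGrid.isGridWeight {S X : ℕ → ℝ} {N : ℕ → ℕ} {n m : ℕ} (h : IsGrid S n X N m)
    (hn : 0 < n) {ω : ℕ → ℝ}
    (hsum : ∀ g : ℝ → ℝ, ∑ x ∈ Finset.range n, g (S x) = ∑ x ∈ Finset.range n, g (ω x)) :
    IsGridWeight (empirical ω n).real X N n m := by
  have hX : ∀ s t, s ≤ t → t ≤ m → X s ≤ X t := fun s t hst ht => by
    rcases hst.lt_or_eq with hst | rfl
    · exact (h.lt s t hst ht).le
    · exact le_rfl
  have hN : ∀ s t, s ≤ t → t ≤ m → N s ≤ N t := by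
    intro s t hst ht
    by_contra hcon
    have hlt : N t < n := (not_le.1 hcon).trans_le (h.N_le s (by omega))
    exact lt_irrefl _ ((h.count _ hlt t ht).2
      (((h.count _ hlt s (by omega)).1 (not_le.1 hcon)).trans_le (hX s t hst ht)))
  refine ⟨hn, h.pos, h.zero, h.one, h.lt, ?_, h.N_last, hN, ?_, ?_⟩
  · by_contra hcon
    obtain ⟨j, hj, e⟩ := h.mem 0 hn
    have := (h.count 0 hn 0 (Nat.zero_le _)).1 (Nat.pos_of_ne_zero hcon)
    rw [e] at this
    exact absurd (hX 0 j (Nat.zero_le _) hj.le) (not_le.2 this)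
  · intro s t hst ht
    rw [empirical_real ω n measurableSet_Ico, ← hsum]
    congr 1
    have h1 : ∀ i ∈ Finset.range n, (Ico (X s) (X t)).indicator (fun _ => (1 : ℝ)) (S i) =
        if i ∈ Finset.Ico (N s) (N t) then 1 else 0 := by
      intro i hi
      have hi := Finset.mem_range.1 hi
      have h2 := h.count i hi s (by omega)
      have h3 := h.count i hi t ht
      have h4 : S i ∈ Ico (X s) (X t) ↔ i ∈ Finset.Ico (N s) (N t) := by
        rw [Finset.mem_Ico, mem_Ico, ← h3, ← not_lt, ← h2, not_lt]
      by_cases hm : S i ∈ Ico (X s) (X t)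
      · rw [indicator_of_mem hm, if_pos (h4.1 hm)]
      · rw [indicator_of_notMem hm, if_neg fun hc => hm (h4.2 hc)]
    have hsub : Finset.range n ∩ Finset.Ico (N s) (N t) = Finset.Ico (N s) (N t) := by
      refine Finset.inter_eq_right.2 fun i hi => Finset.mem_range.2 ?_
      exact (Finset.mem_Ico.1 hi).2.trans_le (h.N_le t ht)
    rw [Finset.sum_congr rfl h1, Finset.sum_ite_mem, hsub, Finset.sum_const, Nat.card_Ico,
      nsmul_eq_mul, mul_one, Nat.cast_sub (hN s t hst ht)]
  · intro j hj
    rw [empirical_real ω n measurableSet_Ico, empirical_real ω n (measurableSet_singleton _),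
      ← hsum, ← hsum]
    congr 1
    refine Finset.sum_congr rfl fun i hi => ?_
    obtain ⟨l, hl, e⟩ := h.mem i (Finset.mem_range.1 hi)
    have h4 : S i ∈ Ico (X j) (X (j + 1)) ↔ S i ∈ ({X j} : Set ℝ) := by
      rw [e, mem_singleton_iff]
      constructor
      · rintro ⟨h1, h2⟩
        have hle : j ≤ l := by
          by_contra hcon
          exact absurd (h.lt l j (by omega) hj.le) (not_lt.2 h1)
        have hge : l ≤ j := by
          by_contra hcon
          exact absurd (hX (j + 1) l (by omega) hl.le) (not_le.2 h2)
        rw [le_antisymm hge hle]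
      · intro h1
        rw [h1]
        exact ⟨le_rfl, h.lt j (j + 1) (Nat.lt_succ_self j) hj⟩
    by_cases hm : S i ∈ Ico (X j) (X (j + 1))
    · rw [indicator_of_mem hm, indicator_of_mem (h4.1 hm)]
    · rw [indicator_of_notMem hm, indicator_of_notMem fun hc => hm (h4.2 hc)]

theorem dTV_triangle {p q r : Measure ℝ} [IsProbabilityMeasure p] [IsProbabilityMeasure q]
    [IsProbabilityMeasure r] : dTV p r ≤ dTV p q + dTV q r :=
  dTV_le fun A hA => (abs_sub_le _ (q.real A) _).trans
    (add_le_add (abs_sub_le_dTV hA) (abs_sub_le_dTV hA))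

/-- Summed over any disjoint family, two probability measures differ by at most twice their total
variation distance, so the extra term does not grow with `K`. -/
theorem IntervalDeviationLE.trans_dTV {e : Set ℝ → ℝ} {p q : Measure ℝ} [IsProbabilityMeasure p]
    [IsProbabilityMeasure q] {K : ℕ} {G : ℝ} (h : IntervalDeviationLE e p.real K G) :
    IntervalDeviationLE e q.real K (G + 2 * dTV q p) := by
  intro J hJ hd
  have h1 := sum_abs_sub_le (p := p) (q := q) (fun i hi => (hJ i hi).measurableSet) hd
    (fun s hs => abs_sub_le_dTV (Finset.measurableSet_biUnion _ fun i hi =>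
      (hJ i (Finset.mem_range.1 (hs hi))).measurableSet))
  refine le_trans ?_ (add_le_add (h J hJ hd) h1)
  rw [← Finset.sum_add_distrib]
  refine Finset.sum_le_sum fun i _ => ?_
  rw [abs_sub_comm (q.real (J i))]
  exact abs_sub_le _ _ _

/-- The hypothesis is good whenever the sample deviates little on unions of intervals. -/
theorem State.IsLearned.dTV_hypothesis_le {ω : ℕ → ℝ} {k n m : ℕ} {ε τ : ℝ} {S X : ℕ → ℝ}
    {N v : ℕ → ℕ} {s : State} (h : s.IsLearned ω k ε n S X N m τ v) (hn : 0 < n) (hk : 1 ≤ k)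
    (hε : 0 < ε) {p : Measure ℝ} [IsProbabilityMeasure p]
    (hdev : IntervalDeviationLE (empirical ω n).real p.real (7 * k) (ε / 128)) :
    dTV s.hypothesis p ≤ 92 * opt k p + ε := by
  have hw := h.isGrid.isGridWeight hn h.sum_eq
  -- An approximate minimiser is enough; its slack `ε / 256` goes into the final `ε`.
  obtain ⟨b, c, hq, hqp⟩ := exists_isHistogram_dTV_le hk p (δ := ε / 256) (by positivity)
  have iq := hq.isProbabilityMeasure
  have ih := (hw.isHistogram h.isGreedy h.isFlattening).isProbabilityMeasure
  have hG := hdev.trans_dTV (q := histMeasure k b c)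
  have h1 := h.isGreedy.dTV_le hw h.pos.le hq hG h.pieces_le h.isFlattening
  have hη : 0 ≤ dTV (histMeasure k b c) p := dTV_nonneg
  have hkτ : k * τ ≤ 2 * (ε / 128 + 2 * dTV (histMeasure k b c) p) := by
    have hk0 : (0 : ℝ) < k := by exact_mod_cast hk
    rcases h.minimal with h2 | ⟨l', v', hl', hv'⟩
    · have : k * τ = ε / 256 := by rw [h2]; field_simp
      rw [this]
      linarith
    · have := hv'.mul_le hw (by have := h.pos; linarith) hq hG hl'.le
      linarith
  have h3 : dTV s.hypothesis p ≤ dTV s.hypothesis (histMeasure k b c) +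
      dTV (histMeasure k b c) p :=
    have : IsProbabilityMeasure s.hypothesis := ih
    dTV_triangle
  have h4 : dTV s.hypothesis (histMeasure k b c) ≤ 21 * (k * τ) +
      3 * (ε / 128 + 2 * dTV (histMeasure k b c) p) := h1
  -- With `G = ε / 128 + 2 * η` and `η` the distance of `q` from `p`, the total is at most `45 * G +
  -- η = 45 * ε / 128 + 91 * η`, and `η ≤ opt k p + ε / 256`.
  linarith [opt_nonneg k p]

/-- The sample is large enough for uniform convergence up to `ε / 128`. -/
theorem measure_not_intervalDeviationLE_le_one_tenth {k L n : ℕ} {ε : ℝ} (hk : 1 ≤ k) (hε : 0 < ε)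
    (hε1 : ε < 1) (hL : k / ε ^ 2 ≤ 2 ^ L) (hn : 33554432 * k * (L + 1) / ε ^ 2 ≤ n)
    (p : Measure ℝ) [IsProbabilityMeasure p] :
    (Measure.infinitePi fun _ : ℕ => p)
      {ω | ¬ IntervalDeviationLE (empirical ω n).real p.real (7 * k) (ε / 128)} ≤ 1 / 10 := by
  have hk1 : (1 : ℝ) ≤ k := by exact_mod_cast hk
  have hk0 : (0 : ℝ) < k := by linarith
  have hn0 : 0 < n := by
    have : (0 : ℝ) < n := lt_of_lt_of_le (by positivity) hn
    exact_mod_cast this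
  have hY1 : (1 : ℝ) ≤ k / ε ^ 2 := by
    rw [le_div_iff₀ (by positivity)]; nlinarith
  have hYε : k / ε ≤ k / ε ^ 2 :=
    div_le_div_of_nonneg_left hk0.le (by positivity) (by nlinarith)
  -- `7168 = 14 * 512` makes the discretisation error `14 * k / M` at most `ε / 512`, equal to the
  -- allowance for Hoeffding.
  obtain ⟨M, hM⟩ : ∃ M, M = ⌈7168 * (k / ε)⌉₊ := ⟨_, rfl⟩
  have hM1 : 7168 * (k / ε) ≤ M := hM ▸ Nat.le_ceil _
  have hM2 : (M : ℝ) < 7168 * (k / ε) + 1 := hM ▸ Nat.ceil_lt_add_one (by positivity)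
  have hM0' : (0 : ℝ) < M := lt_of_lt_of_le (by positivity) hM1
  have hM0 : 0 < M := by exact_mod_cast hM0'
  have hdev : 2 * (ε / 512 + (7 * k : ℕ) * (2 / (M : ℝ))) ≤ ε / 128 := by
    have : (7 * k : ℕ) * (2 / (M : ℝ)) ≤ ε / 512 := by
      push_cast
      rw [mul_div_assoc', div_le_iff₀ hM0']
      calc (7 * k * 2 : ℝ) = ε / 512 * (7168 * (k / ε)) := by field_simp; norm_num
        _ ≤ _ := mul_le_mul_of_nonneg_left hM1 (by positivity)
    linarith
  have hmono : {ω | ¬ IntervalDeviationLE (empirical ω n).real p.real (7 * k) (ε / 128)} ⊆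
      {ω | ¬ IntervalDeviationLE (empirical ω n).real p.real (7 * k)
        (2 * (ε / 512 + (7 * k : ℕ) * (2 / (M : ℝ))))} :=
    fun ω hω hc => hω fun J hJ hd => (hc J hJ hd).trans hdev
  refine (measure_mono hmono).trans ((measure_not_intervalDeviationLE_le hM0 hn0
    (by positivity)).trans ?_)
  have ha : (1 : ℝ) ≤ k * (L + 1) := by
    have : (0 : ℝ) ≤ L := Nat.cast_nonneg _
    nlinarith
  have hexp2 : (2 : ℝ) ≤ Real.exp 1 := by
    have := Real.add_one_le_exp (1 : ℝ); linarith
  have hbase : (2 * M + 2 : ℝ) ≤ 2 ^ (14 + L) := by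
    rw [pow_add]
    have : (2 * M + 2 : ℝ) ≤ 16384 * 2 ^ L := by linarith
    norm_num at this ⊢
    exact this
  -- The exponent is `14 * k * (14 + L)`, at most `196 * (k * (L + 1))`.
  have hpow : (2 * M + 2 : ℝ) ^ (2 * (7 * k)) ≤ Real.exp (196 * (k * (L + 1))) := by
    calc (2 * M + 2 : ℝ) ^ (2 * (7 * k)) ≤ (2 ^ (14 + L)) ^ (2 * (7 * k)) :=
          pow_le_pow_left₀ (by positivity) hbase _
      _ = 2 ^ ((14 + L) * (2 * (7 * k))) := by rw [← pow_mul]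
      _ ≤ 2 ^ (196 * (k * (L + 1))) := pow_le_pow_right₀ one_le_two (by nlinarith)
      _ ≤ Real.exp 1 ^ (196 * (k * (L + 1))) := pow_le_pow_left₀ (by norm_num) hexp2 _
      _ = _ := by rw [← Real.exp_nat_mul]; push_cast; ring_nf
  -- The factor `2 ^ 25` in the sample size gives `2 * 2 ^ 25 / 512 ^ 2 = 256`, which beats the
  -- `196` of the union bound.
  have hexp : Real.exp (-(2 * n * (ε / 512) ^ 2)) ≤ Real.exp (-(256 * (k * (L + 1)))) := by
    refine Real.exp_le_exp.2 (neg_le_neg ?_)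
    calc (256 * (k * (L + 1)) : ℝ) = 2 * (33554432 * k * (L + 1) / ε ^ 2) * (ε / 512) ^ 2 := by
          field_simp; norm_num
      _ ≤ _ := by
          have : (0 : ℝ) ≤ (ε / 512) ^ 2 := by positivity
          nlinarith
  have hfin : (2 * M + 2 : ℝ) ^ (2 * (7 * k)) * (2 * Real.exp (-(2 * n * (ε / 512) ^ 2))) ≤
      1 / 10 := by
    calc _ ≤ Real.exp (196 * (k * (L + 1))) * (Real.exp 1 * Real.exp (-(256 * (k * (L + 1))))) := by
          gcongr
      _ = Real.exp (196 * (k * (L + 1)) + (1 + -(256 * (k * (L + 1))))) := by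
          rw [← Real.exp_add, ← Real.exp_add]
      _ ≤ Real.exp (-59) := Real.exp_le_exp.2 (by linarith)
      _ ≤ 1 / 10 := by
          rw [Real.exp_neg, one_div]
          have := Real.add_one_le_exp (59 : ℝ)
          exact inv_anti₀ (by norm_num) (by linarith)
  calc _ ≤ ENNReal.ofReal (1 / 10) := ENNReal.ofReal_le_ofReal hfin
    _ = 1 / 10 := by
      rw [ENNReal.ofReal_div_of_pos (by norm_num)]
      simp

/-- Take logarithms and use `2 / log 2 < 3`. -/
theorem le_three_mul_log {L : ℕ} {x c : ℝ} (hx : 0 < x) (h : (2 : ℝ) ^ L ≤ 2 ^ c * x ^ 2) :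
    (L : ℝ) ≤ c + 3 * max (Real.log x) 0 := by
  have h1 := Real.log_le_log (by positivity) h
  rw [Real.log_pow, Real.log_mul (by positivity) (by positivity), Real.log_rpow (by norm_num),
    Real.log_pow] at h1
  have h2 := Real.log_two_gt_d9
  have h3 := le_max_left (Real.log x) 0
  have h4 := le_max_right (Real.log x) 0
  push_cast at h1
  by_contra hcon
  nlinarith

/-- The bounds on the running time and the sample size. -/
theorem resource_bounds {k L μ : ℕ} {ε : ℝ} (hk : 1 ≤ k) (hε : 0 < ε) (hε1 : ε < 1)
    (hL' : ∀ j < L, (2 : ℝ) ^ j < k / ε ^ 2)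
    (hμ' : ∀ j < μ, (2 : ℝ) ^ j < 33554432 * k * (L + 1) / ε ^ 2) :
    (2 : ℝ) ^ μ ≤ 268435456 * (k / ε ^ 2) * Real.log (2 + k / ε ^ 2) ∧
      (L + μ + 1 : ℝ) ≤ 35 * Real.log (2 + k / ε ^ 2) ∧ 1 ≤ Real.log (2 + k / ε ^ 2) := by
  have hk1 : (1 : ℝ) ≤ k := by exact_mod_cast hk
  set Y := (k : ℝ) / ε ^ 2 with hY
  have hY1 : 1 ≤ Y := by
    rw [hY, le_div_iff₀ (by positivity)]; nlinarith
  have hlg : 1 ≤ Real.log (2 + Y) := by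
    rw [Real.le_log_iff_exp_le (by linarith)]
    have := Real.exp_one_lt_d9
    linarith
  have hlgle : Real.log (2 + Y) ≤ 2 + Y := by
    have := Real.log_le_sub_one_of_pos (show 0 < 2 + Y by linarith)
    linarith
  have hmax : max (Real.log (2 + Y)) 0 = Real.log (2 + Y) := max_eq_left (by linarith)
  have hL2 : (L : ℝ) ≤ 3 * Real.log (2 + Y) := by
    have := le_three_mul_log (L := L) (x := 2 + Y) (c := 0) (by linarith) (by
      rw [Real.rpow_zero, one_mul]
      have := two_pow_le_of_minimal hY1 hL'
      nlinarith)
    rwa [hmax, zero_add] at this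
  have hT : 33554432 * k * (L + 1) / ε ^ 2 = 33554432 * Y * (L + 1) := by rw [hY]; ring
  rw [hT] at hμ'
  have hL0 : (0 : ℝ) ≤ L := Nat.cast_nonneg _
  have h1 := two_pow_le_of_minimal (by nlinarith) hμ'
  have hμ2 : (2 : ℝ) ^ μ ≤ 268435456 * Y * Real.log (2 + Y) := by
    refine h1.trans ?_
    have : Y * (L + 1) ≤ Y * (4 * Real.log (2 + Y)) :=
      mul_le_mul_of_nonneg_left (by linarith) (by linarith)
    linarith
  refine ⟨hμ2, ?_, hlg⟩
  -- Here `268435456 = 2 ^ 28`, and the logarithm is bounded crudely by its argument to obtain the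
  -- square.
  have hμ3 := le_three_mul_log (L := μ) (x := 2 + Y) (c := 28) (by linarith) (by
    refine hμ2.trans ?_
    have e : (2 : ℝ) ^ (28 : ℝ) = 268435456 := by
      rw [show (28 : ℝ) = ((28 : ℕ) : ℝ) by norm_num, Real.rpow_natCast]; norm_num
    rw [e]
    have : Y * Real.log (2 + Y) ≤ (2 + Y) * (2 + Y) :=
      mul_le_mul (by linarith) hlgle (by linarith) (by linarith)
    nlinarith)
  rw [hmax] at hμ3
  linarith

theorem theorem1 :
    ∃ (A : Prog) (C : ℝ) (c : ℕ), ∀ (k : ℕ) (ε : ℝ), 1 ≤ k → 0 < ε →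
      (∀ ω : ℕ → ℝ, (∀ i, ω i ∈ Ico (0 : ℝ) 1) →
        ∃ (t : ℕ) (s : State), Run ω A (State.init k ε) t s ∧
          (s.draws : ℝ) ≤ C * (k / ε ^ 2) * Real.log (2 + k / ε ^ 2) ^ c ∧
          (t : ℝ) ≤ C * (1 + k / ε ^ 2) * Real.log (2 + k / ε ^ 2) ^ c ∧
          s.OutputsHistogram ∧
          (s.pieces : ℝ) ≤ C * k * Real.log (2 + 1 / ε) ^ 2) ∧
      (∀ (p : Measure ℝ) [IsProbabilityMeasure p], p (Ico (0 : ℝ) 1)ᶜ = 0 →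
        Measure.infinitePi (fun _ : ℕ => p)
          {ω | ¬ ∃ (t : ℕ) (s : State), Run ω A (State.init k ε) t s ∧
            dTV s.hypothesis p ≤ C * opt k p + ε} ≤ 1 / 10) := by
  -- The time bound decides: `10 ^ 4 * 35 * 2 ^ 28` is below `10 ^ 14`. One logarithm comes from the
  -- sample size, the other from sorting and from the number of doublings.
  refine ⟨Prog.learn, 100000000000000, 2, fun k ε hk hε => ?_⟩
  have hk1 : (1 : ℝ) ≤ k := by exact_mod_cast hk
  have hY0 : 0 ≤ (k : ℝ) / ε ^ 2 := by positivity
  have hlog : ∀ x : ℝ, 0 ≤ x → 1 / 4 ≤ Real.log (2 + x) ^ 2 := fun x hx => by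
    have h1 : Real.log 2 ≤ Real.log (2 + x) := Real.log_le_log (by norm_num) (by linarith)
    have h2 := Real.log_two_gt_d9
    nlinarith
  -- The output has at most `4 * k` pieces, so the squared logarithm is needed only through its
  -- lower bound `1 / 4`.
  have hpieces : ∀ j : ℝ, j ≤ 4 * k →
      j ≤ 100000000000000 * k * Real.log (2 + 1 / ε) ^ 2 := fun j hj => by
    have := hlog (1 / ε) (by positivity)
    nlinarith
  have hsupp : ∀ (p : Measure ℝ) [IsProbabilityMeasure p], p (Ico (0 : ℝ) 1)ᶜ = 0 →
      Measure.infinitePi (fun _ : ℕ => p) {ω | ¬ ∀ i, ω i ∈ Ico (0 : ℝ) 1} = 0 := by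
    intro p _ hp
    have : {ω : ℕ → ℝ | ¬ ∀ i, ω i ∈ Ico (0 : ℝ) 1} =
        ⋃ i, (fun ω : ℕ → ℝ => ω i) ⁻¹' (Ico (0 : ℝ) 1)ᶜ := by
      ext ω; simp
    rw [this]
    refine measure_iUnion_null fun i => ?_
    rw [← Measure.map_apply (measurable_pi_apply i) measurableSet_Ico.compl,
      Measure.infinitePi_map_eval, hp]
  rcases lt_or_ge ε 1 with hε1 | hε1
  · obtain ⟨L, hL, hL'⟩ := exists_least_two_pow_ge ((k : ℝ) / ε ^ 2)
    obtain ⟨μ, hμ, hμ'⟩ := exists_least_two_pow_ge (33554432 * (k : ℝ) * (L + 1) / ε ^ 2)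
    have hn : 0 < 2 ^ μ := by positivity
    constructor
    · intro ω hω
      obtain ⟨t, s, hr, ht, S, X, N, m, τ, v, h⟩ := Prog.learn_ensures hω hk hε hε1 hL hL' hμ hμ'
      obtain ⟨b1, b2, b3⟩ := resource_bounds hk hε hε1 hL' hμ'
      set lg := Real.log (2 + k / ε ^ 2)
      have hYlg : 0 ≤ k / ε ^ 2 * lg := by positivity
      refine ⟨t, s, hr, ?_, ?_, (h.isGrid.isGridWeight hn h.sum_eq).isHistogram h.isGreedy
        h.isFlattening, hpieces _ (by exact_mod_cast h.pieces_le)⟩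
      · rw [h.draws]
        push_cast
        refine b1.trans ?_
        have : k / ε ^ 2 * lg * 1 ≤ k / ε ^ 2 * lg * lg := mul_le_mul_of_nonneg_left b3 hYlg
        nlinarith
      · have ht' : (t : ℝ) ≤ 10000 * ((L + μ + 1) * 2 ^ μ) := by exact_mod_cast ht
        refine ht'.trans ?_
        have : ((L : ℝ) + μ + 1) * 2 ^ μ ≤ 35 * lg * (268435456 * (k / ε ^ 2) * lg) :=
          mul_le_mul b2 b1 (by positivity) (by linarith)
        have h2 : 0 ≤ lg ^ 2 := sq_nonneg _
        have h3 : 0 ≤ k / ε ^ 2 * lg ^ 2 := by positivity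
        nlinarith
    · intro p _ hp
      -- The failure event is only covered by other events, so its measurability is never needed;
      -- streams that leave `[0,1)` form a null set.
      have hsub : {ω : ℕ → ℝ | ¬ ∃ (t : ℕ) (s : State), Run ω Prog.learn (State.init k ε) t s ∧
            dTV s.hypothesis p ≤ 100000000000000 * opt k p + ε} ⊆
          {ω | ¬ ∀ i, ω i ∈ Ico (0 : ℝ) 1} ∪
          {ω | ¬ IntervalDeviationLE (empirical ω (2 ^ μ)).real p.real (7 * k) (ε / 128)} := by
        intro ω hω
        by_contra hcon
        rw [mem_union, not_or, mem_ofPred_eq, mem_ofPred_eq, not_not, not_not] at hcon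
        refine hω ?_
        obtain ⟨t, s, hr, -, S, X, N, m, τ, v, h⟩ :=
          Prog.learn_ensures hcon.1 hk hε hε1 hL hL' hμ hμ'
        exact ⟨t, s, hr, (h.dTV_hypothesis_le hn hk hε hcon.2).trans (by
          linarith [opt_nonneg k p])⟩
      refine (measure_mono hsub).trans ((measure_union_le _ _).trans ?_)
      rw [hsupp p hp, zero_add]
      exact measure_not_intervalDeviationLE_le_one_tenth hk hε hε1 hL (by push_cast; exact hμ) p
  · have hrun : ∀ ω : ℕ → ℝ, ∃ (t : ℕ) (s : State), Run ω Prog.learn (State.init k ε) t s ∧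
        t ≤ 100 ∧ s.draws = 0 ∧ s.pieces = 1 ∧ s.OutputsHistogram := by
      intro ω
      obtain ⟨t, s, hr, ht, h1, h2, h3, h4, h5⟩ :=
        Prog.learn_ensures_of_one_le (ω := ω) (k := k) hε1
      refine ⟨t, s, hr, ht, h1, h2, ?_⟩
      rw [State.OutputsHistogram, h2]
      refine ⟨h3, h4, ?_, ?_, ?_⟩
      · intro i hi
        rw [Nat.lt_one_iff.1 hi, zero_add, h3, h4]
        norm_num
      · intro i hi
        rw [Nat.lt_one_iff.1 hi, h5]
        norm_num
      · simp [h3, h4, h5]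
    constructor
    · intro ω _
      obtain ⟨t, s, hr, ht, h1, h2, h3⟩ := hrun ω
      refine ⟨t, s, hr, ?_, ?_, h3, hpieces _ ?_⟩
      · rw [h1, Nat.cast_zero]; positivity
      · have ht' : (t : ℝ) ≤ 100 := by exact_mod_cast ht
        have := hlog _ hY0
        nlinarith
      · rw [h2]; push_cast; linarith
    · intro p _ _
      have : {ω : ℕ → ℝ | ¬ ∃ (t : ℕ) (s : State), Run ω Prog.learn (State.init k ε) t s ∧
            dTV s.hypothesis p ≤ 100000000000000 * opt k p + ε} = ∅ := by
        refine eq_empty_of_forall_notMem fun ω hω => hω ?_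
        obtain ⟨t, s, hr, -, -, -, h⟩ := hrun ω
        have ih : IsProbabilityMeasure s.hypothesis := IsHistogram.isProbabilityMeasure h
        exact ⟨t, s, hr, dTV_le_one.trans (by linarith [opt_nonneg k p])⟩
      rw [this, measure_empty]
      exact zero_le
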